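/- Let $X=\mathbb P(T_{\mathbb P^2})=SL_3(\mathbb C)/B$ be the threefold of complete flags in $\mathbb C^3$, where $B\subset SL_3(\mathbb C)$ is the subgroup of upper triangular matrices. For $s,t\in\mathbb Z$ let $\mathcal O_{\alpha_1}(s)\otimes\mathcal O_{\alpha_2}(t)$ be the homogeneous holomorphic line bundle $SL_3(\mathbb C)\times_B\mathbb C$ on which $b\in B$ acts on $\mathbb C$ by $\big(b_{11}^{s}(b_{11}b_{22})^{t}\big)^{-1}$. There is a unique $SU(3)$-invariant Kähler form $\omega_0$ on $X$ whose de Rham class is $c_1(X)$. Fix it. For a holomorphic vector bundle $E\to X$ with Hermitian metric $h$, let $F_\nabla$ be the curvature of the Chern connection $\nabla$. For an $\mathrm{End}(E)$-valued top-degree form $T$ put $\mathrm{Im}(T)=\frac{1}{2\sqrt{-1}}(T-T^{*})$, with $T^*$ the $h$-adjoint. The slope is $\mu_{[\omega_0]}(E)=\frac{1}{\mathrm{rank}\,E}\int_X c_1(E)\wedge[\omega_0]^2$. A nonzero bundle $E$ is slope-stable (slope-semistable) if $\mu_{[\omega_0]}(\mathcal F)<\mu_{[\omega_0]}(E)$ (respectively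 $\le$) for every holomorphic subbundle $0\ne\mathcal F\subsetneq E$; it is slope-polystable if it is isomorphic to a direct sum of slope-stable bundles of the same slope, and slope-unstable if it is not slope-semistable. **Theorem.** There exist holomorphic vector bundles $E_1,E_2,E_3\to X$ of rank $>1$, where $E_1$ and $E_2$ are direct sums of line bundles $\mathcal O_{\alpha_1}(s)\otimes\mathcal O_{\alpha_2}(t)$ and $$E_3=\big(\mathcal O_{\alpha_1}(2)\otimes\mathcal O_{\alpha_2}(6)\big)\oplus\big(\mathcal O_{\alpha_1}(3)\otimes\mathcal O_{\alpha_2}(4)\big),$$ such that each $E_j$ carries an $SU(3)$-invariant Hermitian metric $h_j$ whose Chern connection $\nabla$ satisfies the following. 1. On $E_1$: $\sqrt{-1}\Lambda_{\omega_0}F_\nabla=c\,\mathbb 1_{E_1}$ with $c=\frac{\pi}{8}\mu_{[\omega_0]}(E_1)$, the number $I_1=\int_X\mathrm{tr}\big(\omega_0\otimes\mathbb 1_{E_1}-\frac1{2\pi}F_\nabla\big)^3$ is nonzero, and $\mathrm{Im}\Big(e^{-\sqrt{-1}\hat\Theta}\big(\omega_0\otimes\mathbb 1_{E_1}-\frac1{2\pi}F_\nabla\big)^3\Big)=0$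 for $\hat\Theta=\mathrm{Arg}\,I_1$. 2. On $E_2$: $\sqrt{-1}\Lambda_{\omega_0}F_\nabla=c\,\mathbb 1_{E_2}$ with $c=\frac{\pi}{8}\mu_{[\omega_0]}(E_2)$, and $\mathrm{Im}\Big(e^{-\sqrt{-1}\hat\Theta}\big(\omega_0\otimes\mathbb 1_{E_2}-\frac1{2\pi}F_\nabla\big)^3\Big)\neq0$ for every $\hat\Theta\in\mathbb R$. 3. On $E_3$: $\sqrt{-1}\Lambda_{\omega_0}F_\nabla\neq c\,\mathbb 1_{E_3}$ for every $c\in\mathbb R$, the number $I_3=\int_X\mathrm{tr}\big(\omega_0\otimes\mathbb 1_{E_3}-\frac1{2\pi}F_\nabla\big)^3$ is nonzero with $\mathrm{Arg}\,I_3=\pi$, and $\mathrm{Im}\Big(e^{-\sqrt{-1}\hat\Theta}\big(\omega_0\otimes\mathbb 1_{E_3}-\frac1{2\pi}F_\nabla\big)^3\Big)=0$ for $\hat\Theta=\mathrm{Arg}\,I_3=\pi$. Moreover $E_1$ and $E_2$ are slope-polystable, and $E_3$ is slope-unstable. -/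

import Mathlib

open scoped Manifold ContDiff Matrix ComplexOrder

noncomputable section

namespace FlagThreefold

/-- Affine coordinate space `ℂ³`. -/
abbrev C3 : Type := Fin 3 → ℂ

/-- The group `SL₃(ℂ)`. -/
abbrev SL3 : Type := Matrix.SpecialLinearGroup (Fin 3) ℂ

/-- The standard Borel subgroup of upper triangular matrices. -/
def borel : Subgroup SL3 where
  carrier := {b | b 1 0 = 0 ∧ b 2 0 = 0 ∧ b 2 1 = 0}
  one_mem' := by simp
  mul_mem' := by
    rintro a b ⟨h1, h2, h3⟩ ⟨k1, k2, k3⟩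
    simp [Matrix.mul_apply, Fin.sum_univ_three, h1, h2, h3, k1, k2, k3]
  inv_mem' := by
    rintro a ⟨h1, h2, h3⟩
    simp [Matrix.adjugate_fin_three, h1, h2, h3]

/-- The flag threefold `ℙ(T_{ℙ²}) = SL₃(ℂ)/B`, with the quotient topology. -/
abbrev X : Type := SL3 ⧸ borel

/-- The first leading principal minor. -/
def minor1 (a : SL3) : ℂ := a 0 0

/-- The second leading principal minor. -/
def minor2 (a : SL3) : ℂ := a 0 0 * a 1 1 - a 1 0 * a 0 1

/-- The unipotent lower triangular matrix with entries `z`; these matrices represent the points of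
the opposite big cell. -/
def lowerUnip (z : C3) : SL3 :=
  ⟨!![1, 0, 0; z 0, 1, 0; z 1, z 2, 1], by simp [Matrix.det_fin_three]⟩

/-- The coordinates `z` of `a`, determined by `a ∈ lowerUnip z * borel` when both leading minors
are nonzero. -/
def cellCoord (a : SL3) : C3 :=
  ![a 1 0 / a 0 0, a 2 0 / a 0 0, (a 0 0 * a 2 1 - a 2 0 * a 0 1) / minor2 a]

theorem diag_ne_zero {b : SL3} (hb : b ∈ borel) : b 0 0 ≠ 0 ∧ b 1 1 ≠ 0 := by
  obtain ⟨h1, h2, h3⟩ := hb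
  have := b.det_coe
  rw [Matrix.det_fin_three] at this
  simp only [h1, h2, h3] at this
  constructor <;> intro h <;> simp [h] at this

theorem minor1_mul (a : SL3) {b : SL3} (hb : b ∈ borel) :
    minor1 (a * b) = minor1 a * b 0 0 := by
  obtain ⟨h1, h2, h3⟩ := hb
  simp [minor1, Matrix.mul_apply, Fin.sum_univ_three, h1, h2]

theorem minor2_mul (a : SL3) {b : SL3} (hb : b ∈ borel) :
    minor2 (a * b) = minor2 a * (b 0 0 * b 1 1) := by
  obtain ⟨h1, h2, h3⟩ := hb
  simp [minor2, Matrix.mul_apply, Fin.sum_univ_three, h1, h2, h3]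
  ring

theorem cellCoord_mul (a : SL3) {b : SL3} (hb : b ∈ borel) :
    cellCoord (a * b) = cellCoord a := by
  have hm := minor2_mul a hb
  obtain ⟨hb0, hb1⟩ := diag_ne_zero hb
  obtain ⟨h1, h2, h3⟩ := hb
  have key : (a * b) 0 0 * (a * b) 2 1 - (a * b) 2 0 * (a * b) 0 1 =
      (a 0 0 * a 2 1 - a 2 0 * a 0 1) * (b 0 0 * b 1 1) := by
    simp [Matrix.mul_apply, Fin.sum_univ_three, h1, h2, h3]
    ring
  have e00 : (a * b) 0 0 = a 0 0 * b 0 0 := minor1_mul a ⟨h1, h2, h3⟩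
  have e10 : (a * b) 1 0 = a 1 0 * b 0 0 := by
    simp [Matrix.mul_apply, Fin.sum_univ_three, h1, h2]
  have e20 : (a * b) 2 0 = a 2 0 * b 0 0 := by
    simp [Matrix.mul_apply, Fin.sum_univ_three, h1, h2]
  unfold cellCoord
  rw [key, hm, e00, e10, e20, mul_div_mul_right _ _ hb0, mul_div_mul_right _ _ hb0,
    mul_div_mul_right _ _ (mul_ne_zero hb0 hb1)]

theorem coe_lowerUnip (z : C3) :
    ((lowerUnip z : SL3) : Matrix (Fin 3) (Fin 3) ℂ) = !![1, 0, 0; z 0, 1, 0; z 1, z 2, 1] := rfl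

theorem lowerUnip_mem {a : SL3} (h1 : minor1 a ≠ 0) (h2 : minor2 a ≠ 0) :
    (lowerUnip (cellCoord a))⁻¹ * a ∈ borel := by
  have h0 : a 0 0 ≠ 0 := h1
  have h2' : a 0 0 * a 1 1 - a 1 0 * a 0 1 ≠ 0 := h2
  refine ⟨?_, ?_, ?_⟩
  all_goals
    rw [Matrix.SpecialLinearGroup.coe_mul, Matrix.SpecialLinearGroup.coe_inv, coe_lowerUnip]
    simp [cellCoord, Matrix.mul_apply, Fin.sum_univ_three, minor2, Matrix.adjugate_fin_three]
    field_simp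
    ring

@[simp] theorem minor1_lowerUnip (z : C3) : minor1 (lowerUnip z) = 1 := by
  simp [minor1, lowerUnip]

@[simp] theorem minor2_lowerUnip (z : C3) : minor2 (lowerUnip z) = 1 := by
  simp [minor2, lowerUnip]

@[simp] theorem cellCoord_lowerUnip (z : C3) : cellCoord (lowerUnip z) = z := by
  ext i; fin_cases i <;> simp [cellCoord, minor2, lowerUnip]

/-- The open set of `a` in `SL₃(ℂ)` lying over the big cell. -/
def cellSet : Set SL3 := {a | minor1 a ≠ 0 ∧ minor2 a ≠ 0}

theorem mul_mem_cellSet (a : SL3) {b : SL3} (hb : b ∈ borel) :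
    a * b ∈ cellSet ↔ a ∈ cellSet := by
  obtain ⟨hb0, hb1⟩ := diag_ne_zero hb
  simp [cellSet, minor1_mul a hb, minor2_mul a hb, hb0, hb1]

theorem continuous_entry (i j : Fin 3) : Continuous fun a : SL3 => a i j := 
  (continuous_subtype_val).matrix_elem i j

theorem continuous_minor1 : Continuous minor1 := continuous_entry 0 0

theorem continuous_minor2 : Continuous minor2 :=
  ((continuous_entry 0 0).mul (continuous_entry 1 1)).sub
    ((continuous_entry 1 0).mul (continuous_entry 0 1))

theorem isOpen_cellSet : IsOpen cellSet :=
  (continuous_minor1.isOpen_preimage _ isOpen_ne).inter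
    (continuous_minor2.isOpen_preimage _ isOpen_ne)

theorem continuousOn_cellCoord : ContinuousOn cellCoord cellSet := by
  rw [continuousOn_pi]
  have c := fun i j => (continuous_entry i j).continuousOn (s := cellSet)
  intro i
  fin_cases i
  · exact (c 1 0).div (c 0 0) fun a ha => ha.1
  · exact (c 2 0).div (c 0 0) fun a ha => ha.1
  · exact (((c 0 0).mul (c 2 1)).sub ((c 2 0).mul (c 0 1))).div
      continuous_minor2.continuousOn fun a ha => ha.2

theorem continuous_lowerUnip : Continuous lowerUnip := by
  refine Continuous.subtype_mk ?_ _
  refine continuous_matrix fun i j => ?_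
  fin_cases i <;> fin_cases j <;> simp <;> fun_prop

/-- The coordinates on `X` centred at `g B`: the coordinates of `g⁻¹ a` for the point `a B`. -/
def chartFun (g : SL3) (x : X) : C3 :=
  Quotient.liftOn' x (fun a => cellCoord (g⁻¹ * a)) (by
    intro a b hab
    rw [QuotientGroup.leftRel_apply] at hab
    have : g⁻¹ * b = g⁻¹ * a * (a⁻¹ * b) := by group
    simp only [this, cellCoord_mul _ hab])

@[simp] theorem chartFun_mk (g a : SL3) :
    chartFun g (QuotientGroup.mk a : X) = cellCoord (g⁻¹ * a) := rfl

/-- The translate by `g` of the opposite big cell. -/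
def cell (g : SL3) : Set X := {x | Quotient.liftOn' x (fun a => g⁻¹ * a ∈ cellSet) (by
    intro a b hab
    rw [QuotientGroup.leftRel_apply] at hab
    have : g⁻¹ * b = g⁻¹ * a * (a⁻¹ * b) := by group
    simp only [this, mul_mem_cellSet _ hab])}

@[simp] theorem mk_mem_cell (g a : SL3) :
    (QuotientGroup.mk a : X) ∈ cell g ↔ g⁻¹ * a ∈ cellSet := Iff.rfl

/-- The point with coordinates `z` in the chart centred at `g B`. -/
def chartInv (g : SL3) (z : C3) : X := QuotientGroup.mk (g * lowerUnip z)

theorem isOpen_cell (g : SL3) : IsOpen (cell g) := by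
  rw [← (QuotientGroup.isQuotientMap_mk borel).isOpen_preimage]
  exact isOpen_cellSet.preimage (continuous_const.mul continuous_id)

/-- The chart of `X` on the translated big cell `g U⁻`, with
`z ↦ g * !![1, 0, 0; z 0, 1, 0; z 1, z 2, 1] B` as its inverse. -/
def chart (g : SL3) : OpenPartialHomeomorph X C3 where
  toFun := chartFun g
  invFun := chartInv g
  source := cell g
  target := Set.univ
  map_source' _ _ := Set.mem_univ _
  map_target' z _ := by simp [chartInv, cellSet]
  left_inv' x hx := by
    induction x using QuotientGroup.induction_on with
    | H a =>
      rw [chartFun_mk, chartInv, QuotientGroup.eq]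
      have := lowerUnip_mem hx.1 hx.2
      rwa [mul_inv_rev, mul_assoc]
  right_inv' z _ := by simp [chartInv]
  open_source := isOpen_cell g
  open_target := isOpen_univ
  continuousOn_toFun := by
    intro x hx
    refine ContinuousAt.continuousWithinAt ?_
    induction x using QuotientGroup.induction_on with
    | H a =>
      rw [ContinuousAt, ← (QuotientGroup.isOpenQuotientMap_mk (N := borel)).map_nhds_eq,
        Filter.tendsto_map'_iff]
      exact ((continuousOn_cellCoord.continuousAt (isOpen_cellSet.mem_nhds hx))).comp
        (f := fun a : SL3 => g⁻¹ * a) (continuous_const.mul continuous_id).continuousAt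
  continuousOn_invFun := by
    exact (continuous_quot_mk.comp (continuous_const.mul continuous_lowerUnip)).continuousOn

theorem mem_cell_out (x : X) : x ∈ cell (Quotient.out x) := by
  have h : (QuotientGroup.mk (Quotient.out x) : X) = x := QuotientGroup.out_eq' x
  rw [← h, mk_mem_cell, h]
  simp [cellSet, minor1, minor2]

/-- The atlas of `X` by all translates of the opposite big cell. -/
instance : ChartedSpace C3 X where
  atlas := Set.range chart
  chartAt x := chart (Quotient.out x)
  mem_chart_source := mem_cell_out
  chart_mem_atlas _ := ⟨_, rfl⟩

/-- Left translation by `g` carries coordinates in `chart a` to the same coordinates in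
`chart (g * a)`. -/
theorem smul_chart_symm (g a : SL3) (z : C3) :
    g • (chart a).symm z = (chart (g * a)).symm z := by
  change (QuotientGroup.mk (g * (a * lowerUnip z)) : X) = QuotientGroup.mk (g * a * lowerUnip z)
  rw [mul_assoc]

theorem contDiff_entry {𝕜 : Type*} [NontriviallyNormedField 𝕜] [NormedAlgebra 𝕜 ℂ] (h : SL3)
    (i j : Fin 3) : ContDiff 𝕜 ω fun z : C3 => (h * lowerUnip z) i j := by
  simp only [Matrix.SpecialLinearGroup.coe_mul, Matrix.mul_apply, Fin.sum_univ_three,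
    coe_lowerUnip]
  fin_cases j <;> simp <;> fun_prop

/-- Coordinate changes are rational with nonvanishing denominators. -/
theorem contDiffOn_cellCoord {𝕜 : Type*} [NontriviallyNormedField 𝕜] [NormedAlgebra 𝕜 ℂ]
    (h : SL3) : ContDiffOn 𝕜 ω (fun z : C3 => cellCoord (h * lowerUnip z))
      {z | h * lowerUnip z ∈ cellSet} := by
  have c := fun i j => (contDiff_entry (𝕜 := 𝕜) h i j).contDiffOn
    (s := {z | h * lowerUnip z ∈ cellSet})
  rw [contDiffOn_pi]
  intro i
  fin_cases i <;> simp only [cellCoord, div_eq_mul_inv]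
  · exact (c 1 0).mul ((c 0 0).inv fun z hz => hz.1)
  · exact (c 2 0).mul ((c 0 0).inv fun z hz => hz.1)
  · exact (((c 0 0).mul (c 2 1)).sub ((c 2 0).mul (c 0 1))).mul
      ((((c 0 0).mul (c 1 1)).sub ((c 1 0).mul (c 0 1))).inv fun z hz => hz.2)

theorem isManifold_aux {𝕜 : Type*} [NontriviallyNormedField 𝕜] [NormedAlgebra 𝕜 ℂ] :
    IsManifold 𝓘(𝕜, C3) ω X := by
  refine isManifold_of_contDiffOn _ _ _ ?_
  rintro _ _ ⟨g, rfl⟩ ⟨g', rfl⟩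
  refine ((contDiffOn_cellCoord (𝕜 := 𝕜) (g'⁻¹ * g)).congr ?_).mono ?_
  · intro z _
    change cellCoord (g'⁻¹ * (g * lowerUnip z)) = _
    rw [mul_assoc]
  · rintro z ⟨hz, -⟩
    have : g'⁻¹ * (g * lowerUnip z) ∈ cellSet := hz.2
    rwa [← mul_assoc] at this

/-- `X` is a complex manifold. -/
instance : IsManifold 𝓘(ℂ, C3) ω X := isManifold_aux

/-- `X` is a real analytic manifold. -/
instance : IsManifold 𝓘(ℝ, C3) ω X := isManifold_aux

/-! ### Holomorphic vector bundles -/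

/-- A holomorphic vector bundle on `X`, given by a holomorphic cocycle: the vectors `v` over the
trivializing set `i` and `coordChange i j x v` over the trivializing set `j` represent the same
element of the fibre at `x`. -/
structure HolBundle where
  rank : ℕ
  ι : Type
  core : VectorBundleCore ℂ X (Fin rank → ℂ) ι
  holomorphic : core.IsContMDiff 𝓘(ℂ, C3) ω

instance : (tangentBundleCore 𝓘(ℂ, C3) X).IsContMDiff 𝓘(ℂ, C3) ω :=
  tangentBundleCore.isContMDiff (h := (inferInstance : IsManifold 𝓘(ℂ, C3) ω X))

/-- The holomorphic tangent bundle of `X`. -/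
def tangentHolBundle : HolBundle where
  rank := 3
  ι := atlas C3 X
  core := tangentBundleCore 𝓘(ℂ, C3) X
  holomorphic := inferInstance

/-- The local section `x ↦ g * lowerUnip z` of `SL₃(ℂ) → X` over `g U⁻`, where `z` are the
coordinates of `x` in `chart g`. -/
def localSection (g : SL3) (x : X) : SL3 := g * lowerUnip (chart g x)

theorem mk_localSection {g : SL3} {x : X} (hx : x ∈ cell g) :
    (QuotientGroup.mk (localSection g x) : X) = x := (chart g).left_inv hx

/-- The `B`-valued transition function relating the local sections over `g U⁻` and `g' U⁻`. -/
def borelCocycle (g g' : SL3) (x : X) : SL3 := (localSection g x)⁻¹ * localSection g' x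

theorem borelCocycle_mem {g g' : SL3} {x : X} (hx : x ∈ cell g) (hx' : x ∈ cell g') :
    borelCocycle g g' x ∈ borel := by
  rw [borelCocycle, ← QuotientGroup.eq, mk_localSection hx, mk_localSection hx']

/-- The character of `B` of weight `s ϖ₁ + t ϖ₂`, where `w = (s, t)` and `ϖ₁`, `ϖ₂` are the
fundamental weights. -/
def character (w : ℤ × ℤ) (b : SL3) : ℂ := (b 0 0) ^ w.1 * (b 0 0 * b 1 1) ^ w.2

theorem character_mul (w : ℤ × ℤ) {a b : SL3} (ha : a ∈ borel) (hb : b ∈ borel) :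
    character w (a * b) = character w a * character w b := by
  obtain ⟨h1, h2, h3⟩ := ha
  obtain ⟨k1, k2, k3⟩ := hb
  have e0 : (a * b) 0 0 = a 0 0 * b 0 0 := by
    rw [Matrix.SpecialLinearGroup.coe_mul]
    simp [Matrix.mul_apply, Fin.sum_univ_three, k1, k2]
  have e1 : (a * b) 1 1 = a 1 1 * b 1 1 := by
    rw [Matrix.SpecialLinearGroup.coe_mul]
    simp [Matrix.mul_apply, Fin.sum_univ_three, h1, k3]
  simp only [character, e0, e1, mul_zpow]
  ring

theorem contMDiffOn_chart (g : SL3) :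
    ContMDiffOn 𝓘(ℂ, C3) 𝓘(ℂ, C3) ω (chart g) (cell g) :=
  contMDiffOn_of_mem_maximalAtlas (IsManifold.subset_maximalAtlas ⟨g, rfl⟩)

theorem contDiff_adjugate {a : C3 → Matrix (Fin 3) (Fin 3) ℂ}
    (ha : ∀ i j, ContDiff ℂ ω fun z => a z i j) (i j : Fin 3) :
    ContDiff ℂ ω fun z => (a z).adjugate i j := by
  simp only [Matrix.adjugate_fin_three]
  fin_cases i <;> fin_cases j <;> simp
  all_goals
    first
    | exact ((ha _ _).mul (ha _ _)).sub ((ha _ _).mul (ha _ _))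
    | exact ((ha _ _).mul (ha _ _)).neg.add ((ha _ _).mul (ha _ _))

theorem contMDiffOn_borelCocycle (g g' : SL3) (i j : Fin 3) :
    ContMDiffOn 𝓘(ℂ, C3) 𝓘(ℂ, ℂ) ω (fun x => borelCocycle g g' x i j) (cell g ∩ cell g') := by
  have key : ContDiff ℂ ω fun p : C3 × C3 =>
      ((g * lowerUnip p.1)⁻¹ * (g' * lowerUnip p.2)) i j := by
    have e : ∀ p : C3 × C3, ((g * lowerUnip p.1)⁻¹ * (g' * lowerUnip p.2)) i j =
        ∑ k, Matrix.adjugate (g * lowerUnip p.1 : SL3).1 i k * (g' * lowerUnip p.2) k j := by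
      intro p
      rw [Matrix.SpecialLinearGroup.coe_mul, Matrix.mul_apply,
        Matrix.SpecialLinearGroup.coe_inv]
    simp only [e]
    refine ContDiff.sum fun k _ => ContDiff.mul ?_ ?_
    · exact (contDiff_adjugate (contDiff_entry g) i k).comp contDiff_fst
    · exact (contDiff_entry g' k j).comp contDiff_snd
  have pair : ContMDiffOn 𝓘(ℂ, C3) 𝓘(ℂ, C3 × C3) ω (fun x : X => (chart g x, chart g' x))
      (cell g ∩ cell g') :=
    ((contMDiffOn_chart g).mono Set.inter_subset_left).prodMk_space
      ((contMDiffOn_chart g').mono Set.inter_subset_right)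
  have := key.contMDiff.comp_contMDiffOn pair
  exact this

theorem contMDiffOn_zpow {f : X → ℂ} {s : Set X} (hf : ContMDiffOn 𝓘(ℂ, C3) 𝓘(ℂ, ℂ) ω f s)
    (h0 : ∀ x ∈ s, f x ≠ 0) (n : ℤ) :
    ContMDiffOn 𝓘(ℂ, C3) 𝓘(ℂ, ℂ) ω (fun x => f x ^ n) s := by
  have hz : ContDiffOn ℂ ω (fun y : ℂ => y ^ n) {y | y ≠ 0} := by
    cases n with
    | ofNat n => simpa using (contDiff_id.pow n).contDiffOn
    | negSucc n =>
      simp only [zpow_negSucc]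
      exact ((contDiff_id.pow (n + 1)).contDiffOn).inv fun y hy => pow_ne_zero _ hy
  exact hz.contMDiffOn.comp hf h0

theorem contMDiffOn_character (w : ℤ × ℤ) (g g' : SL3) :
    ContMDiffOn 𝓘(ℂ, C3) 𝓘(ℂ, ℂ) ω (fun x => character w (borelCocycle g g' x))
      (cell g ∩ cell g') := by
  have c := contMDiffOn_borelCocycle g g'
  have d := fun x (hx : x ∈ cell g ∩ cell g') => diag_ne_zero (borelCocycle_mem hx.1 hx.2)
  exact (contMDiffOn_zpow (c 0 0) (fun x hx => (d x hx).1) w.1).mul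
    (contMDiffOn_zpow ((c 0 0).mul (c 1 1))
      (fun x hx => mul_ne_zero (d x hx).1 (d x hx).2) w.2)

/-- The diagonal map with entries `c`. -/
def diagCLM {r : ℕ} (c : Fin r → ℂ) : (Fin r → ℂ) →L[ℂ] (Fin r → ℂ) :=
  ContinuousLinearMap.pi fun k => c k • ContinuousLinearMap.proj k

@[simp] theorem diagCLM_apply {r : ℕ} (c v : Fin r → ℂ) (k : Fin r) :
    diagCLM c v k = c k * v k := rfl

theorem contMDiffOn_diagCLM {r : ℕ} (w : Fin r → ℤ × ℤ) (g g' : SL3) :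
    ContMDiffOn 𝓘(ℂ, C3) 𝓘(ℂ, (Fin r → ℂ) →L[ℂ] (Fin r → ℂ)) ω
      (fun x => diagCLM fun k => character (w k) (borelCocycle g g' x)) (cell g ∩ cell g') := by
  have h : ContDiff ℂ ω (diagCLM (r := r)) := by
    have : (diagCLM (r := r)) = fun c => ∑ k, c k •
        (ContinuousLinearMap.pi fun l => if l = k then ContinuousLinearMap.proj k else 0 :
          (Fin r → ℂ) →L[ℂ] (Fin r → ℂ)) := by
      ext c v l
      simp [Finset.sum_apply, apply_ite, ite_apply]
    rw [this]
    fun_prop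
  exact h.contMDiff.comp_contMDiffOn
    (contMDiffOn_pi_space.2 fun k => contMDiffOn_character (w k) g g')

/-- The holomorphic vector bundle `⨁ₖ 𝒪_{α₁}(sₖ) ⊗ 𝒪_{α₂}(tₖ)`, where `w k = (sₖ, tₖ)`: the bundle
associated with `SL₃(ℂ) → X` and the representation of `B` on `ℂʳ` by the inverses of the
characters of weights `sₖ ϖ₁ + tₖ ϖ₂`. It is trivialized over `g U⁻` by the local sections. -/
def lineSum {r : ℕ} (w : Fin r → ℤ × ℤ) : HolBundle where
  rank := r
  ι := SL3
  core :=
    { baseSet := cell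
      isOpen_baseSet := isOpen_cell
      indexAt := Quotient.out
      mem_baseSet_at := mem_cell_out
      coordChange := fun g g' x => diagCLM fun k => character (w k) (borelCocycle g g' x)
      coordChange_self := by
        intro g x _ v
        ext k
        simp [borelCocycle, character]
      continuousOn_coordChange := fun g g' => (contMDiffOn_diagCLM w g g').continuousOn
      coordChange_comp := by
        rintro g g' g'' x ⟨⟨h, h'⟩, h''⟩ v
        ext k
        have : borelCocycle g g'' x = borelCocycle g g' x * borelCocycle g' g'' x := by
          simp [borelCocycle, mul_assoc]
        rw [this]
        simp only [diagCLM_apply,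
          character_mul _ (borelCocycle_mem h h') (borelCocycle_mem h' h'')]
        ring }
  holomorphic := ⟨contMDiffOn_diagCLM w⟩

/-! ### Differential forms in the charts `chart g` -/

/-- The Wirtinger derivative `∂f/∂z_j`. -/
def dz (j : Fin 3) (f : C3 → ℂ) (z : C3) : ℂ :=
  (1 / 2) * (fderiv ℝ f z (Pi.single j 1) - Complex.I * fderiv ℝ f z (Pi.single j Complex.I))

/-- The Wirtinger derivative `∂f/∂z̄_j`. -/
def dzbar (j : Fin 3) (f : C3 → ℂ) (z : C3) : ℂ :=
  (1 / 2) * (fderiv ℝ f z (Pi.single j 1) + Complex.I * fderiv ℝ f z (Pi.single j Complex.I))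

/-- Left translation by `u`, written in the coordinates of `chart g` on the source and of
`chart g'` on the target. For `u = 1` this is the change of coordinates. -/
def coordMap (u g g' : SL3) (z : C3) : C3 := chart g' (u • (chart g).symm z)

/-- The complex Jacobian matrix of `coordMap u g g'`, with entries `∂w_m/∂z_j` in row `m` and
column `j`. -/
def jac (u g g' : SL3) (z : C3) : Matrix (Fin 3) (Fin 3) ℂ :=
  LinearMap.toMatrix' (fderiv ℂ (coordMap u g g') z).toLinearMap

/-- A smooth real `(1,1)`-form on `X`. In `chart g` it is `√-1 ∑ coeff g z j k dz_j ∧ dz̄_k`. -/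
@[ext] structure RealForm11 where
  coeff : SL3 → C3 → Matrix (Fin 3) (Fin 3) ℂ
  isHermitian : ∀ g z, (coeff g z).IsHermitian
  smooth : ∀ g j k, ContDiff ℝ ∞ fun z => coeff g z j k
  compat : ∀ g g' z, (chart g).symm z ∈ (chart g').source →
    coeff g z = (jac 1 g g' z)ᵀ * coeff g' (coordMap 1 g g' z) * (jac 1 g g' z).map star

/-- A smooth real `1`-form on `X`. In `chart g` it is `η + η̄` with `η = ∑ coeff g z j dz_j`. -/
@[ext] structure RealOneForm where
  coeff : SL3 → C3 → Fin 3 → ℂ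
  smooth : ∀ g j, ContDiff ℝ ∞ fun z => coeff g z j
  compat : ∀ g g' z, (chart g).symm z ∈ (chart g').source →
    coeff g z = (jac 1 g g' z)ᵀ *ᵥ coeff g' (coordMap 1 g g' z)

/-- The coefficient of `dz_j ∧ dz̄_k` in the `(1,1)`-part of the exterior derivative. -/
def RealOneForm.d11 (a : RealOneForm) (g : SL3) (z : C3) (j k : Fin 3) : ℂ :=
  dz j (fun y => star (a.coeff g y k)) z - dzbar k (fun y => a.coeff g y j) z

/-- The coefficient of `dz_j ∧ dz_k` (for `j < k`) in the `(2,0)`-part of the exterior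
derivative; the `(0,2)`-part is its complex conjugate. -/
def RealOneForm.d20 (a : RealOneForm) (g : SL3) (z : C3) (j k : Fin 3) : ℂ :=
  dz j (fun y => a.coeff g y k) z - dz k (fun y => a.coeff g y j) z

/-- The form is positive and closed. For a real `(1,1)`-form, `dω = 0` amounts to `∂ω = 0`. -/
def RealForm11.IsKahler (ω₀ : RealForm11) : Prop :=
  (∀ g z, (ω₀.coeff g z).PosDef) ∧
  ∀ g z j k l, dz l (fun y => ω₀.coeff g y j k) z = dz j (fun y => ω₀.coeff g y l k) z

/-- Membership in `SU(3) ⊆ SL₃(ℂ)`. -/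
def IsSU3 (u : SL3) : Prop := (u : Matrix (Fin 3) (Fin 3) ℂ) ∈ Matrix.unitaryGroup (Fin 3) ℂ

/-- The form is equal to its pullbacks by the left translations by elements of `SU(3)`. -/
def RealForm11.IsInvariant (ω₀ : RealForm11) : Prop :=
  ∀ u, IsSU3 u → ∀ g g' z, u • (chart g).symm z ∈ (chart g').source →
    ω₀.coeff g z = (jac u g g' z)ᵀ * ω₀.coeff g' (coordMap u g g' z) * (jac u g g' z).map star

/-- The coefficient of `∏ₘ (√-1 dz_m ∧ dz̄_m)` in the wedge product of the three forms
`√-1 ∑ A_{jk} dz_j ∧ dz̄_k`, `√-1 ∑ B_{jk} dz_j ∧ dz̄_k`, `√-1 ∑ C_{jk} dz_j ∧ dz̄_k` with values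
in a ring (for instance, in the endomorphisms of a vector space). -/
def wedge3 {R : Type} [Ring R] (A B C : Fin 3 → Fin 3 → R) : R :=
  ∑ σ : Equiv.Perm (Fin 3), ∑ τ : Equiv.Perm (Fin 3),
    ((Equiv.Perm.sign σ * Equiv.Perm.sign τ : ℤˣ) : ℤ) •
      (A (σ 0) (τ 0) * B (σ 1) (τ 1) * C (σ 2) (τ 2))

/-- The integral over `X` of the `(3,3)`-form which is `f z ∏ₘ (√-1 dz_m ∧ dz̄_m)` in the chart
`chart 1`. The complement of the big cell has measure zero, and `√-1 dz_m ∧ dz̄_m` is twice the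
Lebesgue area form. -/
def integralX (f : C3 → ℂ) : ℂ := ∫ z : C3, 8 * f z

/-! ### Hermitian metrics and Chern connections -/

/-- A smooth Hermitian metric on `E`: over the trivializing set `i` it is `⟨v, w⟩ = vᴴ H w` with
`H = mat i x`. -/
structure HermitianMetric (E : HolBundle) where
  mat : E.ι → X → Matrix (Fin E.rank) (Fin E.rank) ℂ
  posDef : ∀ i, ∀ x ∈ E.core.baseSet i, (mat i x).PosDef
  smooth : ∀ i a b,
    ContMDiffOn 𝓘(ℝ, C3) 𝓘(ℝ, ℂ) ∞ (fun x => mat i x a b) (E.core.baseSet i)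
  compat : ∀ i j, ∀ x ∈ E.core.baseSet i ∩ E.core.baseSet j,
    mat i x = (LinearMap.toMatrix' (E.core.coordChange i j x).toLinearMap)ᴴ * mat j x *
      LinearMap.toMatrix' (E.core.coordChange i j x).toLinearMap

namespace HermitianMetric

variable {E : HolBundle} (h : HermitianMetric E) (ω₀ : RealForm11)

/-- The metric matrix over the trivializing set `i`, in the coordinates of `chart g`. -/
def localMat (i : E.ι) (g : SL3) (z : C3) : Matrix (Fin E.rank) (Fin E.rank) ℂ :=
  h.mat i ((chart g).symm z)

/-- The coefficient of `dz_j` in the connection form `H⁻¹ ∂H` of the Chern connection. -/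
def connection (i : E.ι) (g : SL3) (z : C3) (j : Fin 3) : Matrix (Fin E.rank) (Fin E.rank) ℂ :=
  (h.localMat i g z)⁻¹ * Matrix.of fun a b => dz j (fun y => h.localMat i g y a b) z

/-- The coefficient of `dz_j ∧ dz̄_k` in the curvature `F = ∂̄(H⁻¹ ∂H)` of the Chern connection. -/
def curvature (i : E.ι) (g : SL3) (z : C3) (j k : Fin 3) :
    Matrix (Fin E.rank) (Fin E.rank) ℂ :=
  Matrix.of fun a b => -dzbar k (fun y => h.connection i g y j a b) z

/-- The first Chern form `√-1/(2π) tr F = √-1 ∑ (tr F_{jk} / 2π) dz_j ∧ dz̄_k`. -/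
def chernForm (i : E.ι) (g : SL3) (z : C3) (j k : Fin 3) : ℂ :=
  (h.curvature i g z j k).trace / (2 * Real.pi)

/-- The endomorphism `√-1 Λ_ω F`. -/
def contraction (i : E.ι) (g : SL3) (z : C3) : Matrix (Fin E.rank) (Fin E.rank) ℂ :=
  ∑ j, ∑ k, (ω₀.coeff g z)⁻¹ k j • h.curvature i g z j k

/-- The Hermitian Yang–Mills equation `√-1 Λ_ω F = c 1`. -/
def IsHYM (c : ℝ) : Prop :=
  ∀ i g z, (chart g).symm z ∈ E.core.baseSet i →
    h.contraction ω₀ i g z = (c : ℂ) • (1 : Matrix (Fin E.rank) (Fin E.rank) ℂ)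

/-- The coefficients of the form
`ω ⊗ 1 - F/(2π) = √-1 ∑ (ω_{jk} 1 + (√-1/2π) F_{jk}) dz_j ∧ dz̄_k`. -/
def twistedForm (i : E.ι) (g : SL3) (z : C3) (j k : Fin 3) :
    Matrix (Fin E.rank) (Fin E.rank) ℂ :=
  ω₀.coeff g z j k • (1 : Matrix (Fin E.rank) (Fin E.rank) ℂ) +
    (Complex.I / (2 * Real.pi)) • h.curvature i g z j k

/-- The coefficient of `∏ₘ (√-1 dz_m ∧ dz̄_m)` in `(ω ⊗ 1 - F/(2π))³`. -/
def twistedCube (i : E.ι) (g : SL3) (z : C3) : Matrix (Fin E.rank) (Fin E.rank) ℂ :=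
  wedge3 (h.twistedForm ω₀ i g z) (h.twistedForm ω₀ i g z) (h.twistedForm ω₀ i g z)

/-- The imaginary part `(T - T*)/(2√-1)` of an endomorphism `T`, where `T* = H⁻¹ Tᴴ H` is the
adjoint for the metric with matrix `H`. -/
def imPart {r : ℕ} (H T : Matrix (Fin r) (Fin r) ℂ) : Matrix (Fin r) (Fin r) ℂ :=
  (1 / (2 * Complex.I)) • (T - H⁻¹ * Tᴴ * H)

/-- The equation `Im (e^{-√-1 θ} (ω ⊗ 1 - F/(2π))³) = 0`. -/
def IsDHYM (θ : ℝ) : Prop :=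
  ∀ i g z, (chart g).symm z ∈ E.core.baseSet i →
    imPart (h.localMat i g z) (Complex.exp (-Complex.I * θ) • h.twistedCube ω₀ i g z) = 0

/-- The number `∫_X tr (ω ⊗ 1 - F/(2π))³`. -/
def phaseIntegral : ℂ :=
  integralX fun z => (h.twistedCube ω₀ (E.core.indexAt ((chart 1).symm z)) 1 z).trace

/-- The degree `∫_X c₁(E) ∧ ω²`, computed with the first Chern form of the metric. -/
def degree : ℂ :=
  integralX fun z => wedge3 (h.chernForm (E.core.indexAt ((chart 1).symm z)) 1 z)
    (ω₀.coeff 1 z) (ω₀.coeff 1 z)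

end HermitianMetric

/-- The de Rham class of the form is the first Chern class of `E`: the form differs from the first
Chern form of a Hermitian metric on `E` by the exterior derivative of a real `1`-form. -/
def RealForm11.RepresentsC1 (ω₀ : RealForm11) (E : HolBundle) : Prop :=
  ∃ (h : HermitianMetric E) (a : RealOneForm), ∀ i g z, (chart g).symm z ∈ E.core.baseSet i →
    ∀ j k, Complex.I * (ω₀.coeff g z j k - h.chernForm i g z j k) = a.d11 g z j k ∧
      a.d20 g z j k = 0

/-! ### Slope stability -/

/-- `μ` is the slope `(∫_X c₁(E) ∧ ω²) / rank E` for the closed form `ω`. The degree may be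
computed with any Hermitian metric on `E`, since it depends only on `c₁(E)` and on `[ω]`. -/
def HasSlope (ω₀ : RealForm11) (E : HolBundle) (μ : ℝ) : Prop :=
  ∃ h : HermitianMetric E, (μ : ℂ) = h.degree ω₀ / E.rank

/-- A holomorphic homomorphism of vector bundles, given by its matrices in the trivializations. -/
structure HolHom (E E' : HolBundle) where
  toMap : E.ι → E'.ι → X → (Fin E.rank → ℂ) →L[ℂ] (Fin E'.rank → ℂ)
  holomorphic : ∀ i j, ContMDiffOn 𝓘(ℂ, C3) 𝓘(ℂ, (Fin E.rank → ℂ) →L[ℂ] (Fin E'.rank → ℂ)) ω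
    (toMap i j) (E.core.baseSet i ∩ E'.core.baseSet j)
  compat : ∀ i i' j j' x, x ∈ E.core.baseSet i → x ∈ E.core.baseSet i' →
    x ∈ E'.core.baseSet j → x ∈ E'.core.baseSet j' → ∀ v,
      toMap i' j' x (E.core.coordChange i i' x v) = E'.core.coordChange j j' x (toMap i j x v)

/-- `f` is injective on all fibres, so that it realizes `E` as a holomorphic subbundle of `E'`. -/
def HolHom.IsSubbundle {E E' : HolBundle} (f : HolHom E E') : Prop :=
  ∀ i j x, x ∈ E.core.baseSet i → x ∈ E'.core.baseSet j → Function.Injective (f.toMap i j x)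

/-- `μ(F) < μ(E)` for all holomorphic subbundles `0 ≠ F ⊊ E` of the nonzero bundle `E`. -/
def IsSlopeStable (ω₀ : RealForm11) (E : HolBundle) : Prop :=
  0 < E.rank ∧ ∀ (F : HolBundle) (f : HolHom F E), f.IsSubbundle → 0 < F.rank → F.rank < E.rank →
    ∀ μF μE, HasSlope ω₀ F μF → HasSlope ω₀ E μE → μF < μE

/-- `μ(F) ≤ μ(E)` for all holomorphic subbundles `0 ≠ F ⊊ E`. -/
def IsSlopeSemistable (ω₀ : RealForm11) (E : HolBundle) : Prop :=
  ∀ (F : HolBundle) (f : HolHom F E), f.IsSubbundle → 0 < F.rank → F.rank < E.rank →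
    ∀ μF μE, HasSlope ω₀ F μF → HasSlope ω₀ E μE → μF ≤ μE

/-- `E` is isomorphic to a direct sum of stable bundles of the same slope; an isomorphism from
`⨁ₖ F k` to `E` is a family of homomorphisms `F k → E` whose sum is bijective on all fibres. -/
def IsSlopePolystable (ω₀ : RealForm11) (E : HolBundle) : Prop :=
  ∃ (n : ℕ) (F : Fin n → HolBundle) (f : ∀ k, HolHom (F k) E) (μ : ℝ),
    (∀ k, IsSlopeStable ω₀ (F k) ∧ HasSlope ω₀ (F k) μ) ∧
    ∀ (i : ∀ k, (F k).ι) (j : E.ι) (x : X), (∀ k, x ∈ (F k).core.baseSet (i k)) →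
      x ∈ E.core.baseSet j →
      Function.Bijective fun v : (∀ k, Fin (F k).rank → ℂ) => ∑ k, (f k).toMap (i k) j x (v k)

/-- `E` is not slope-semistable. -/
def IsSlopeUnstable (ω₀ : RealForm11) (E : HolBundle) : Prop := ¬ IsSlopeSemistable ω₀ E

/-- The metric is invariant under the action of `SU(3)` on the homogeneous bundle `lineSum w`.
An element `u` maps the vector with coordinates `v` over `x` in the trivialization `g` to the one
with the same coordinates `v` over `u • x` in the trivialization `u * g`. -/
def IsInvariantMetric {r : ℕ} {w : Fin r → ℤ × ℤ} (h : HermitianMetric (lineSum w)) : Prop :=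
  ∀ u : SL3, IsSU3 u → ∀ g : SL3, ∀ x ∈ cell g, h.mat (u * g : SL3) (u • x) = h.mat g x

end FlagThreefold

end

noncomputable section

namespace FlagThreefold

/-! ### Wirtinger calculus -/

/-! The flag threefold is `SU(3)/T`, so an invariant form is determined by its value at the base
point, where `z 0`, `z 1`, `z 2` are the directions of the roots α₁, α₁+α₂, α₂. The first column of
a matrix represents the line of the flag and the last row of its inverse represents the plane. Their
squared norms N₁, N₂ give the invariant forms A = ∂∂̄ log N₁ and B = ∂∂̄ log N₂. In a unitary frame
sA + tB becomes diag(s, s+t, t) (`frameLaw_comb`); this rests on the Iwasawa decomposition and on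
one explicit Jacobian (`jac_eq_frameJac`).

The line bundle of weight (s, t) carries the invariant metric N₁^(-s) N₂^(-t), whose curvature has
coefficients sA + tB (`lineMetric_curvature`). The determinant of (A + B)/π is a constant times the
metric of weight (2, 2), so this form is the first Chern form of the tangent metric that it defines
(`tangentMetric_chernForm`): it is the required ω₀.

Relative to ω₀ the curvature has eigenvalues πs, π(s+t)/2, πt. Hence √-1ΛF acts on the summand by
3π(s+t)/2, its slope is 12(s+t), and the cube of ω₀ - F/2π is a positive multiple of the phase
(2+is)(2+it)(4+i(s+t)) times the invariant volume. For these diagonal metrics, Hermitian Yang–Mills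
asks that s+t be the same for all summands, and the deformed equation asks that all phases lie on
one real line through 0 (`lineMetric_isDHYM_iff`). The weights (1,2), (2,1) satisfy both conditions;
(1,3), (2,2) only the first; (2,6), (3,4), with phases -160 and -130, only the second. Line bundles
are stable, so equal slopes give polystability, and with unequal slopes the larger summand
destabilizes.

Uniqueness of ω₀: torus symmetry makes the matrix at the base point diagonal, closedness removes one
of the three remaining parameters (`RealForm11.IsInvariant.eq_comb`), and Stokes' theorem on the
projective lines through two coordinate axes fixes the coefficients of A and B (`eq_stdForm`). -/

/-- The real linear map `∑ (a_j dz_j + b_j dz̄_j)`. -/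
def wirtCLM (a b : Fin 3 → ℂ) : C3 →L[ℝ] ℂ :=
  ∑ j, (a j • (ContinuousLinearMap.proj (R := ℂ) (φ := fun _ : Fin 3 => ℂ) j).restrictScalars ℝ +
    b j • (Complex.conjCLE : ℂ →L[ℝ] ℂ).comp
      ((ContinuousLinearMap.proj (R := ℂ) (φ := fun _ : Fin 3 => ℂ) j).restrictScalars ℝ))

theorem wirtCLM_apply (a b : Fin 3 → ℂ) (v : C3) :
    wirtCLM a b v = ∑ j, (a j * v j + b j * star (v j)) := by
  simp [wirtCLM]

/-- `f` is real differentiable at `z`, with Wirtinger derivatives `a` and `b`. -/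
def HasWirt (f : C3 → ℂ) (a b : Fin 3 → ℂ) (z : C3) : Prop :=
  HasFDerivAt (𝕜 := ℝ) f (wirtCLM a b) z

theorem HasWirt.dz_eq {f : C3 → ℂ} {a b : Fin 3 → ℂ} {z : C3} (h : HasWirt f a b z) (j : Fin 3) :
    dz j f z = a j := by
  rw [dz, h.fderiv, wirtCLM_apply, wirtCLM_apply]
  fin_cases j <;> simp [Fin.sum_univ_three, Pi.single_apply] <;> ring_nf <;> simp <;> ring

theorem HasWirt.dzbar_eq {f : C3 → ℂ} {a b : Fin 3 → ℂ} {z : C3} (h : HasWirt f a b z)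
    (j : Fin 3) : dzbar j f z = b j := by
  rw [dzbar, h.fderiv, wirtCLM_apply, wirtCLM_apply]
  fin_cases j <;> simp [Fin.sum_univ_three, Pi.single_apply] <;> ring_nf <;> simp <;> ring

theorem hasWirt_of_hasFDerivAt {f : C3 → ℂ} {L : C3 →L[ℝ] ℂ} {a b : Fin 3 → ℂ} {z : C3}
    (h : HasFDerivAt (𝕜 := ℝ) f L z)
    (hL : ∀ v, L v = ∑ j, (a j * v j + b j * star (v j))) : HasWirt f a b z := by
  have : L = wirtCLM a b := by
    ext v
    rw [hL, wirtCLM_apply]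
  rwa [HasWirt, ← this]

/-- A real linear map on ℂ³ is determined by its values on e_j and i·e_j, and the two Wirtinger
derivatives are an invertible linear recombination of these values. -/
theorem hasWirt_of_differentiableAt {f : C3 → ℂ} {z : C3} (h : DifferentiableAt ℝ f z) :
    HasWirt f (fun j => dz j f z) (fun j => dzbar j f z) z := by
  refine hasWirt_of_hasFDerivAt h.hasFDerivAt fun v => ?_
  have hv : v = ∑ j, ((v j).re • (Pi.single j 1 : C3) + (v j).im • (Pi.single j Complex.I : C3)) := by
    ext m
    fin_cases m <;> simp [Fin.sum_univ_three, Pi.single_apply]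
  conv_lhs => rw [hv]
  simp only [map_sum, map_add, map_smul]
  refine Finset.sum_congr rfl fun j _ => ?_
  have e : v j = (v j).re + (v j).im * Complex.I := (Complex.re_add_im _).symm
  have e' : star (v j) = (v j).re - (v j).im * Complex.I := by
    apply Complex.ext <;> simp
  rw [e']
  nth_rewrite 3 [e]
  simp only [dz, dzbar, Complex.real_smul]
  linear_combination (fderiv ℝ f z (Pi.single j Complex.I) * (v j).im) * Complex.I_sq

theorem HasWirt.congr_deriv {f : C3 → ℂ} {a b a' b' : Fin 3 → ℂ} {z : C3} (h : HasWirt f a b z)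
    (ha : ∀ j, a' j = a j) (hb : ∀ j, b' j = b j) : HasWirt f a' b' z := by
  have : a' = a := funext ha
  have : b' = b := funext hb
  subst_vars; exact h

theorem dz_congr {f f' : C3 → ℂ} {z : C3} (e : f' =ᶠ[nhds z] f) (j : Fin 3) :
    dz j f' z = dz j f z := by simp only [dz, e.fderiv_eq]

theorem dzbar_congr {f f' : C3 → ℂ} {z : C3} (e : f' =ᶠ[nhds z] f) (j : Fin 3) :
    dzbar j f' z = dzbar j f z := by simp only [dzbar, e.fderiv_eq]

theorem hasWirt_const (c : ℂ) (z : C3) : HasWirt (fun _ => c) (fun _ => 0) (fun _ => 0) z :=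
  hasWirt_of_hasFDerivAt (hasFDerivAt_const c z) fun v => by simp

theorem hasWirt_coord (i : Fin 3) (z : C3) :
    HasWirt (fun y => y i) (fun j => if j = i then 1 else 0) (fun _ => 0) z :=
  hasWirt_of_hasFDerivAt (hasFDerivAt_apply i z) fun v => by simp

section rules
variable {f g : C3 → ℂ} {a b a' b' : Fin 3 → ℂ} {z : C3}

theorem HasWirt.add (hf : HasWirt f a b z) (hg : HasWirt g a' b' z) :
    HasWirt (fun y => f y + g y) (fun j => a j + a' j) (fun j => b j + b' j) z := by
  refine hasWirt_of_hasFDerivAt (HasFDerivAt.fun_add hf hg) fun v => ?_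
  simp only [add_apply, wirtCLM_apply, Fin.sum_univ_three]
  ring

theorem HasWirt.neg (hf : HasWirt f a b z) :
    HasWirt (fun y => -f y) (fun j => -a j) (fun j => -b j) z := by
  refine hasWirt_of_hasFDerivAt (HasFDerivAt.fun_neg hf) fun v => ?_
  simp only [neg_apply, wirtCLM_apply, Fin.sum_univ_three]
  ring

theorem HasWirt.sub (hf : HasWirt f a b z) (hg : HasWirt g a' b' z) :
    HasWirt (fun y => f y - g y) (fun j => a j - a' j) (fun j => b j - b' j) z := by
  simpa only [sub_eq_add_neg] using hf.add hg.neg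

theorem HasWirt.mul (hf : HasWirt f a b z) (hg : HasWirt g a' b' z) :
    HasWirt (fun y => f y * g y) (fun j => a j * g z + f z * a' j)
      (fun j => b j * g z + f z * b' j) z := by
  refine hasWirt_of_hasFDerivAt (HasFDerivAt.fun_mul hf hg) fun v => ?_
  simp only [add_apply, smul_apply, wirtCLM_apply,
    Fin.sum_univ_three, smul_eq_mul]
  ring

theorem HasWirt.const_mul (c : ℂ) (hf : HasWirt f a b z) :
    HasWirt (fun y => c * f y) (fun j => c * a j) (fun j => c * b j) z :=
  ((hasWirt_const c z).mul hf).congr_deriv (fun j => by ring) fun j => by ring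

theorem HasWirt.conj (hf : HasWirt f a b z) :
    HasWirt (fun y => star (f y)) (fun j => star (b j)) (fun j => star (a j)) z := by
  refine hasWirt_of_hasFDerivAt ((Complex.conjCLE : ℂ →L[ℝ] ℂ).hasFDerivAt.comp z hf) fun v => ?_
  simp [wirtCLM_apply, Fin.sum_univ_three]
  ring

theorem HasWirt.zpow (hf : HasWirt f a b z) (h0 : f z ≠ 0) (n : ℤ) :
    HasWirt (fun y => f y ^ n) (fun j => n * f z ^ n / f z * a j)
      (fun j => n * f z ^ n / f z * b j) z := by
  have h := (hasDerivAt_zpow n (f z) (Or.inl h0)).hasFDerivAt.restrictScalars ℝ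
  refine hasWirt_of_hasFDerivAt (h.comp z hf) fun v => ?_
  simp only [wirtCLM_apply, Fin.sum_univ_three, ContinuousLinearMap.comp_apply,
    ContinuousLinearMap.coe_restrictScalars', ContinuousLinearMap.toSpanSingleton_apply,
    smul_eq_mul, zpow_sub_one₀ h0]
  ring

theorem HasWirt.inv (hf : HasWirt f a b z) (h0 : f z ≠ 0) :
    HasWirt (fun y => (f y)⁻¹) (fun j => -(f z ^ 2)⁻¹ * a j) (fun j => -(f z ^ 2)⁻¹ * b j) z := by
  have h := hf.zpow h0 (-1)
  simp only [zpow_neg_one] at h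
  refine h.congr_deriv (fun j => ?_) fun j => ?_ <;> field_simp <;> simp

theorem HasWirt.div (hf : HasWirt f a b z) (hg : HasWirt g a' b' z) (h0 : g z ≠ 0) :
    HasWirt (fun y => f y / g y) (fun j => (a j * g z - f z * a' j) / g z ^ 2)
      (fun j => (b j * g z - f z * b' j) / g z ^ 2) z := by
  simp only [div_eq_mul_inv]
  refine (hf.mul (hg.inv h0)).congr_deriv (fun j => ?_) fun j => ?_ <;> field_simp <;> ring

end rules

theorem HasWirt.sum {ι : Type*} (s : Finset ι) {f : ι → C3 → ℂ} {a b : ι → Fin 3 → ℂ} {z : C3}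
    (h : ∀ i ∈ s, HasWirt (f i) (a i) (b i) z) :
    HasWirt (fun y => ∑ i ∈ s, f i y) (fun j => ∑ i ∈ s, a i j) (fun j => ∑ i ∈ s, b i j) z := by
  refine hasWirt_of_hasFDerivAt (HasFDerivAt.fun_sum h) fun v => ?_
  simp only [sum_apply, wirtCLM_apply, Finset.sum_add_distrib, Finset.sum_mul]
  congr 1 <;> exact Finset.sum_comm

theorem hasWirt_of_holomorphic {f : C3 → ℂ} {L : C3 →L[ℂ] ℂ} {z : C3} (h : HasFDerivAt f L z) :
    HasWirt f (fun j => L (Pi.single j 1)) (fun _ => 0) z := by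
  refine hasWirt_of_hasFDerivAt (h.restrictScalars ℝ) fun v => ?_
  have hv : v = ∑ j, v j • (Pi.single j 1 : C3) := by
    ext m
    simp [Pi.single_apply]
  conv_lhs => rw [hv]
  simp [mul_comm]

/-- The chain rule for the composition with a holomorphic map. -/
theorem HasWirt.comp_holomorphic {f : C3 → ℂ} {a b : Fin 3 → ℂ} {φ : C3 → C3} {L : C3 →L[ℂ] C3}
    {z : C3} (hf : HasWirt f a b (φ z)) (h : HasFDerivAt φ L z) :
    HasWirt (fun y => f (φ y)) (fun j => ∑ m, a m * L (Pi.single j 1) m)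
      (fun j => ∑ m, b m * star (L (Pi.single j 1) m)) z := by
  refine hasWirt_of_hasFDerivAt (HasFDerivAt.comp z hf (h.restrictScalars ℝ)) fun v => ?_
  have hv : L v = ∑ j, v j • L (Pi.single j 1) := by
    conv_lhs => rw [show v = ∑ j, v j • (Pi.single j 1 : C3) by
      ext m
      simp [Pi.single_apply]]
    simp
  simp only [ContinuousLinearMap.comp_apply, wirtCLM_apply, ContinuousLinearMap.coe_restrictScalars',
    hv, Fin.sum_univ_three, Pi.add_apply, Pi.smul_apply, smul_eq_mul, star_add, star_mul']
  ring

/-- Wirtinger derivatives of a Hermitian product of holomorphic vectors. -/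
theorem hasWirt_dotProduct_star {n : ℕ} {x y : C3 → Fin n → ℂ} {x' y' : Fin 3 → Fin n → ℂ} {z : C3}
    (hx : ∀ m, HasWirt (fun w => x w m) (fun j => x' j m) (fun _ => 0) z)
    (hy : ∀ m, HasWirt (fun w => y w m) (fun j => y' j m) (fun _ => 0) z) :
    HasWirt (fun w => x w ⬝ᵥ star (y w)) (fun j => x' j ⬝ᵥ star (y z))
      (fun j => x z ⬝ᵥ star (y' j)) z := by
  simp only [dotProduct, Pi.star_apply]
  exact (HasWirt.sum Finset.univ fun m _ => (hx m).mul (hy m).conj).congr_deriv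
    (fun j => by simp) fun j => by simp

/-! ### Fubini–Study forms of holomorphic vectors -/

/-- The coefficients of `∂∂̄ log ‖x‖²` for a holomorphic vector with value `x` and partial
derivatives `x' j`. -/
def fubiniStudy {n : ℕ} (x : Fin n → ℂ) (x' : Fin 3 → Fin n → ℂ) : Matrix (Fin 3) (Fin 3) ℂ :=
  Matrix.of fun j k => (x' j ⬝ᵥ star (x' k)) / (x ⬝ᵥ star x) -
    (x' j ⬝ᵥ star x) * (x ⬝ᵥ star (x' k)) / (x ⬝ᵥ star x) ^ 2

theorem dotProduct_star_ne_zero {n : ℕ} {x : Fin n → ℂ} (hx : x ≠ 0) : x ⬝ᵥ star x ≠ 0 := by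
  simpa using hx

theorem star_dotProduct_star {n : ℕ} (x y : Fin n → ℂ) : star (x ⬝ᵥ star y) = y ⬝ᵥ star x := by
  simp [dotProduct, mul_comm]

section
variable {n : ℕ} {x : C3 → Fin n → ℂ} {x' : C3 → Fin 3 → Fin n → ℂ}
  {x'' : Fin 3 → Fin 3 → Fin n → ℂ} {z : C3}

/-- The negative `∂̄`-derivative of the connection form of the metric `‖x‖⁻²`. -/
theorem hasWirt_logDeriv (hx : ∀ m, HasWirt (fun w => x w m) (fun j => x' z j m) (fun _ => 0) z)
    (hx' : ∀ j m, HasWirt (fun w => x' w j m) (fun l => x'' l j m) (fun _ => 0) z)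
    (h0 : x z ≠ 0) (j : Fin 3) :
    HasWirt (fun w => (x' w j ⬝ᵥ star (x w)) / (x w ⬝ᵥ star (x w)))
      (fun l => (x'' l j ⬝ᵥ star (x z)) / (x z ⬝ᵥ star (x z)) -
        (x' z j ⬝ᵥ star (x z)) * (x' z l ⬝ᵥ star (x z)) / (x z ⬝ᵥ star (x z)) ^ 2)
      (fun k => fubiniStudy (x z) (x' z) j k) z := by
  have hN := dotProduct_star_ne_zero h0
  refine ((hasWirt_dotProduct_star (hx' j) hx).div (hasWirt_dotProduct_star hx hx) hN).congr_deriv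
    (fun l => ?_) fun k => ?_
  · field_simp
  · simp only [fubiniStudy, Matrix.of_apply]
    field_simp

/-- Closedness only involves the ∂-derivatives, so the ∂̄-derivatives stay existential. The terms
are grouped by powers of the norm to exhibit the symmetry in j and l once the second derivatives are
symmetric. -/
theorem hasWirt_fubiniStudy
    (hx : ∀ m, HasWirt (fun w => x w m) (fun j => x' z j m) (fun _ => 0) z)
    (hx' : ∀ j m, HasWirt (fun w => x' w j m) (fun l => x'' l j m) (fun _ => 0) z)
    (h0 : x z ≠ 0) (j k : Fin 3) :
    ∃ b, HasWirt (fun w => fubiniStudy (x w) (x' w) j k)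
      (fun l => (x'' l j ⬝ᵥ star (x' z k)) / (x z ⬝ᵥ star (x z)) -
        ((x' z j ⬝ᵥ star (x' z k)) * (x' z l ⬝ᵥ star (x z)) +
          (x'' l j ⬝ᵥ star (x z)) * (x z ⬝ᵥ star (x' z k)) +
          (x' z j ⬝ᵥ star (x z)) * (x' z l ⬝ᵥ star (x' z k))) / (x z ⬝ᵥ star (x z)) ^ 2 +
        2 * (x' z j ⬝ᵥ star (x z)) * (x z ⬝ᵥ star (x' z k)) * (x' z l ⬝ᵥ star (x z)) /
          (x z ⬝ᵥ star (x z)) ^ 3) b z := by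
  have hN := dotProduct_star_ne_zero h0
  have n1 := hasWirt_dotProduct_star hx hx
  have h := ((hasWirt_dotProduct_star (hx' j) (hx' k)).div n1 hN).sub
    (((hasWirt_dotProduct_star (hx' j) hx).mul (hasWirt_dotProduct_star hx (hx' k))).div
      (n1.mul n1) (mul_ne_zero hN hN))
  simp only [← sq] at h
  refine ⟨_, h.congr_deriv (fun l => ?_) fun _ => rfl⟩
  field_simp
  ring

/-- `∂∂̄ log ‖x‖²` is closed. -/
theorem dz_fubiniStudy_comm
    (hx : ∀ m, HasWirt (fun w => x w m) (fun j => x' z j m) (fun _ => 0) z)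
    (hx' : ∀ j m, HasWirt (fun w => x' w j m) (fun l => x'' l j m) (fun _ => 0) z)
    (hs : ∀ l j, x'' l j = x'' j l) (h0 : x z ≠ 0) (j k l : Fin 3) :
    dz l (fun w => fubiniStudy (x w) (x' w) j k) z =
      dz j (fun w => fubiniStudy (x w) (x' w) l k) z := by
  obtain ⟨_, h⟩ := hasWirt_fubiniStudy hx hx' h0 j k
  obtain ⟨_, h'⟩ := hasWirt_fubiniStudy hx hx' h0 l k
  rw [h.dz_eq, h'.dz_eq, hs j l]
  ring

end

theorem isHermitian_fubiniStudy {n : ℕ} (x : Fin n → ℂ) (x' : Fin 3 → Fin n → ℂ) :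
    (fubiniStudy x x').IsHermitian := by
  ext j k
  simp only [fubiniStudy, Matrix.conjTranspose_apply, Matrix.of_apply, star_sub, star_div₀,
    star_mul', star_pow, star_dotProduct_star]
  ring

/-- Isometries do not change the Fubini–Study form. -/
theorem fubiniStudy_mulVec {n : ℕ} {u : Matrix (Fin n) (Fin n) ℂ} (hu : uᴴ * u = 1)
    (x : Fin n → ℂ) (x' : Fin 3 → Fin n → ℂ) :
    fubiniStudy (u *ᵥ x) (fun j => u *ᵥ x' j) = fubiniStudy x x' := by
  have key : ∀ v w : Fin n → ℂ, (u *ᵥ v) ⬝ᵥ star (u *ᵥ w) = v ⬝ᵥ star w := by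
    intro v w
    rw [Matrix.star_mulVec, dotProduct_comm, ← Matrix.dotProduct_mulVec, Matrix.mulVec_mulVec, hu,
      Matrix.one_mulVec, dotProduct_comm]
  simp only [fubiniStudy, key]

/-! ### The two projections to projective planes -/

/-- The first column of `g * lowerUnip z`. -/
def colVec (g : SL3) (z : C3) : Fin 3 → ℂ := g.1 *ᵥ ![1, z 0, z 1]

/-- The partial derivatives of `colVec`. -/
def colVec' (g : SL3) (_z : C3) (j : Fin 3) : Fin 3 → ℂ :=
  g.1 *ᵥ (![![0, 1, 0], ![0, 0, 1], 0] : Fin 3 → Fin 3 → ℂ) j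

/-- The last row of the inverse of `g * lowerUnip z`. -/
def rowVec (g : SL3) (z : C3) : Fin 3 → ℂ :=
  g⁻¹.1ᵀ *ᵥ ![z 0 * z 2 - z 1, -z 2, 1]

/-- The partial derivatives of `rowVec`. -/
def rowVec' (g : SL3) (z : C3) (j : Fin 3) : Fin 3 → ℂ :=
  g⁻¹.1ᵀ *ᵥ (![![z 2, 0, 0], ![-1, 0, 0], ![z 0, -1, 0]] : Fin 3 → Fin 3 → ℂ) j

/-- The second partial derivatives of `rowVec`. -/
def rowVec'' (g : SL3) (l j : Fin 3) : Fin 3 → ℂ :=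
  g⁻¹.1ᵀ *ᵥ (!![0, 0, ![1, 0, 0]; 0, 0, 0; ![1, 0, 0], 0, 0] :
    Matrix (Fin 3) (Fin 3) (Fin 3 → ℂ)) l j

theorem hasWirt_mulVec {n : ℕ} (A : Matrix (Fin n) (Fin n) ℂ) {v : C3 → Fin n → ℂ}
    {v' : Fin 3 → Fin n → ℂ} {z : C3}
    (hv : ∀ m, HasWirt (fun w => v w m) (fun j => v' j m) (fun _ => 0) z) (m : Fin n) :
    HasWirt (fun w => (A *ᵥ v w) m) (fun j => (A *ᵥ v' j) m) (fun _ => 0) z := by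
  simp only [Matrix.mulVec, dotProduct]
  exact (HasWirt.sum Finset.univ fun i _ => (hv i).const_mul (A m i)).congr_deriv
    (fun j => by simp) fun j => by simp

theorem hasWirt_colVec (g : SL3) (z : C3) (m : Fin 3) :
    HasWirt (fun w => colVec g w m) (fun j => colVec' g z j m) (fun _ => 0) z := by
  refine hasWirt_mulVec g.1 (fun m => ?_) m
  fin_cases m
  · exact (hasWirt_const 1 z).congr_deriv (fun j => by fin_cases j <;> rfl) fun j => rfl
  · exact (hasWirt_coord 0 z).congr_deriv (fun j => by fin_cases j <;> rfl) fun j => rfl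
  · exact (hasWirt_coord 1 z).congr_deriv (fun j => by fin_cases j <;> rfl) fun j => rfl

theorem hasWirt_colVec' (g : SL3) (z : C3) (j m : Fin 3) :
    HasWirt (fun w => colVec' g w j m) (fun l => (0 : Fin 3 → Fin 3 → Fin 3 → ℂ) l j m)
      (fun _ => 0) z := hasWirt_const _ z

theorem hasWirt_rowVec (g : SL3) (z : C3) (m : Fin 3) :
    HasWirt (fun w => rowVec g w m) (fun j => rowVec' g z j m) (fun _ => 0) z := by
  refine hasWirt_mulVec g⁻¹.1ᵀ (fun m => ?_) m
  have c := fun i => hasWirt_coord i z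
  fin_cases m
  · exact (((c 0).mul (c 2)).sub (c 1)).congr_deriv
      (fun j => by fin_cases j <;> simp) fun j => by simp
  · exact (c 2).neg.congr_deriv (fun j => by fin_cases j <;> simp) fun j => by simp
  · exact (hasWirt_const 1 z).congr_deriv (fun j => by fin_cases j <;> simp) fun j => by simp

theorem hasWirt_rowVec' (g : SL3) (z : C3) (j m : Fin 3) :
    HasWirt (fun w => rowVec' g w j m) (fun l => rowVec'' g l j m) (fun _ => 0) z := by
  refine hasWirt_mulVec g⁻¹.1ᵀ (v := fun w => (![![w 2, 0, 0], ![-1, 0, 0], ![w 0, -1, 0]] :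
    Fin 3 → Fin 3 → ℂ) j) (fun m => ?_) m
  have c := fun i => hasWirt_coord i z
  have k := fun a => hasWirt_const a z
  fin_cases j <;> fin_cases m
  · exact (c 2).congr_deriv (fun j => by fin_cases j <;> simp) fun j => by simp
  · exact (k 0).congr_deriv (fun j => by fin_cases j <;> simp) fun j => by simp
  · exact (k 0).congr_deriv (fun j => by fin_cases j <;> simp) fun j => by simp
  · exact (k (-1)).congr_deriv (fun j => by fin_cases j <;> simp) fun j => by simp
  · exact (k 0).congr_deriv (fun j => by fin_cases j <;> simp) fun j => by simp
  · exact (k 0).congr_deriv (fun j => by fin_cases j <;> simp) fun j => by simp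
  · exact (c 0).congr_deriv (fun j => by fin_cases j <;> simp) fun j => by simp
  · exact (k (-1)).congr_deriv (fun j => by fin_cases j <;> simp) fun j => by simp
  · exact (k 0).congr_deriv (fun j => by fin_cases j <;> simp) fun j => by simp

theorem rowVec''_comm (g : SL3) (l j : Fin 3) : rowVec'' g l j = rowVec'' g j l := by
  unfold rowVec''
  fin_cases l <;> fin_cases j <;> rfl

theorem mulVec_ne_zero_of_mul_eq_one {n : ℕ} {A B : Matrix (Fin n) (Fin n) ℂ} (h : B * A = 1)
    {v : Fin n → ℂ} (hv : v ≠ 0) : A *ᵥ v ≠ 0 := by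
  intro e
  apply hv
  have := congrArg (B *ᵥ ·) e
  simpa [Matrix.mulVec_mulVec, h] using this

theorem colVec_ne_zero (g : SL3) (z : C3) : colVec g z ≠ 0 := by
  refine mulVec_ne_zero_of_mul_eq_one (B := g⁻¹.1) ?_ fun h => ?_
  · rw [← Matrix.SpecialLinearGroup.coe_mul]; simp
  · simpa using congrFun h 0

theorem rowVec_ne_zero (g : SL3) (z : C3) : rowVec g z ≠ 0 := by
  refine mulVec_ne_zero_of_mul_eq_one (B := g.1ᵀ) ?_ fun h => ?_
  · rw [← Matrix.transpose_mul, ← Matrix.SpecialLinearGroup.coe_mul]; simp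
  · simpa using congrFun h 2

/-- The coefficients of the pullback of the Fubini–Study form of the plane of lines. -/
def formA (g : SL3) (z : C3) : Matrix (Fin 3) (Fin 3) ℂ := fubiniStudy (colVec g z) (colVec' g z)

/-- The coefficients of the pullback of the Fubini–Study form of the dual plane. -/
def formB (g : SL3) (z : C3) : Matrix (Fin 3) (Fin 3) ℂ := fubiniStudy (rowVec g z) (rowVec' g z)

theorem dz_formA_comm (g : SL3) (z : C3) (j k l : Fin 3) :
    dz l (fun w => formA g w j k) z = dz j (fun w => formA g w l k) z :=
  dz_fubiniStudy_comm (hasWirt_colVec g z) (hasWirt_colVec' g z) (fun _ _ => rfl)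
    (colVec_ne_zero g z) j k l

theorem dz_formB_comm (g : SL3) (z : C3) (j k l : Fin 3) :
    dz l (fun w => formB g w j k) z = dz j (fun w => formB g w l k) z :=
  dz_fubiniStudy_comm (hasWirt_rowVec g z) (hasWirt_rowVec' g z) (rowVec''_comm g)
    (rowVec_ne_zero g z) j k l

theorem contDiff_dotProduct_star {n : ℕ} {x y : C3 → Fin n → ℂ}
    (hx : ∀ m, ContDiff ℝ ∞ fun w => x w m) (hy : ∀ m, ContDiff ℝ ∞ fun w => y w m) :
    ContDiff ℝ ∞ fun w => x w ⬝ᵥ star (y w) := by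
  simp only [dotProduct, Pi.star_apply]
  exact ContDiff.sum fun m _ => (hx m).mul (Complex.conjCLE.contDiff.comp (hy m))

theorem contDiff_div_real {f g : C3 → ℂ} (hf : ContDiff ℝ ∞ f) (hg : ContDiff ℝ ∞ g)
    (h0 : ∀ w, g w ≠ 0) : ContDiff ℝ ∞ fun w => f w / g w := by
  simp only [div_eq_mul_inv]
  exact hf.mul (hg.inv h0)

theorem contDiff_fubiniStudy {n : ℕ} {x : C3 → Fin n → ℂ} {x' : C3 → Fin 3 → Fin n → ℂ}
    (hx : ∀ m, ContDiff ℝ ∞ fun w => x w m) (hx' : ∀ j m, ContDiff ℝ ∞ fun w => x' w j m)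
    (h0 : ∀ w, x w ≠ 0) (j k : Fin 3) : ContDiff ℝ ∞ fun w => fubiniStudy (x w) (x' w) j k := by
  have n0 := fun w => dotProduct_star_ne_zero (h0 w)
  have nn := contDiff_dotProduct_star hx hx
  exact (contDiff_div_real (contDiff_dotProduct_star (hx' j) (hx' k)) nn n0).sub
    (contDiff_div_real ((contDiff_dotProduct_star (hx' j) hx).mul
      (contDiff_dotProduct_star hx (hx' k))) (nn.pow 2) fun w => pow_ne_zero 2 (n0 w))

theorem contDiff_mulVec (A : Matrix (Fin 3) (Fin 3) ℂ) {v : C3 → Fin 3 → ℂ}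
    (hv : ∀ m, ContDiff ℝ ∞ fun w => v w m) (m : Fin 3) :
    ContDiff ℝ ∞ fun w => (A *ᵥ v w) m := by
  simp only [Matrix.mulVec, dotProduct]
  exact ContDiff.sum fun i _ => contDiff_const.mul (hv i)

theorem contDiff_colVec (g : SL3) (m : Fin 3) : ContDiff ℝ ∞ fun w => colVec g w m := by
  refine contDiff_mulVec g.1 (v := fun z => ![1, z 0, z 1]) (fun m => ?_) m
  fin_cases m <;> simp <;> fun_prop

theorem contDiff_rowVec (g : SL3) (m : Fin 3) : ContDiff ℝ ∞ fun w => rowVec g w m := by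
  refine contDiff_mulVec g⁻¹.1ᵀ (v := fun z => ![z 0 * z 2 - z 1, -z 2, 1]) (fun m => ?_) m
  fin_cases m <;> simp <;> fun_prop

theorem contDiff_colVec' (g : SL3) (j m : Fin 3) : ContDiff ℝ ∞ fun w => colVec' g w j m := by
  unfold colVec'
  exact contDiff_const

theorem contDiff_rowVec' (g : SL3) (j m : Fin 3) : ContDiff ℝ ∞ fun w => rowVec' g w j m := by
  refine contDiff_mulVec g⁻¹.1ᵀ (v := fun w => (![![w 2, 0, 0], ![-1, 0, 0], ![w 0, -1, 0]] :
    Fin 3 → Fin 3 → ℂ) j) (fun m => ?_) m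
  fin_cases j <;> fin_cases m <;> simp <;> fun_prop

theorem contDiff_formA (g : SL3) (j k : Fin 3) : ContDiff ℝ ∞ fun w => formA g w j k :=
  contDiff_fubiniStudy (x := colVec g) (x' := colVec' g) (contDiff_colVec g) (contDiff_colVec' g)
    (colVec_ne_zero g) j k

theorem contDiff_formB (g : SL3) (j k : Fin 3) : ContDiff ℝ ∞ fun w => formB g w j k :=
  contDiff_fubiniStudy (x := rowVec g) (x' := rowVec' g) (contDiff_rowVec g) (contDiff_rowVec' g)
    (rowVec_ne_zero g) j k

/-! ### Unitary frames -/

theorem isSU3_one : IsSU3 1 := by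
  simp [IsSU3, one_mem]

theorem IsSU3.mul {u v : SL3} (hu : IsSU3 u) (hv : IsSU3 v) : IsSU3 (u * v) := by
  rw [IsSU3, Matrix.SpecialLinearGroup.coe_mul]
  exact mul_mem hu hv

theorem IsSU3.conjTranspose_mul {u : SL3} (hu : IsSU3 u) : u.1ᴴ * u.1 = 1 :=
  Matrix.mem_unitaryGroup_iff'.1 hu

theorem IsSU3.mul_conjTranspose {u : SL3} (hu : IsSU3 u) : u.1 * u.1ᴴ = 1 :=
  Matrix.mem_unitaryGroup_iff.1 hu

theorem IsSU3.coe_inv {u : SL3} (hu : IsSU3 u) : u⁻¹.1 = u.1ᴴ := by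
  have h : u⁻¹.1 * u.1 = 1 := by rw [← Matrix.SpecialLinearGroup.coe_mul]; simp
  calc u⁻¹.1 = u⁻¹.1 * (u.1 * u.1ᴴ) := by rw [hu.mul_conjTranspose, mul_one]
    _ = u.1ᴴ := by rw [← mul_assoc, h, one_mul]

/-- The scalar is 1/‖x‖. Recording only that it is real and satisfies one algebraic equation turns
the unitarity check in the Iwasawa decomposition into polynomial identities. -/
theorem exists_normalizer {x : Fin 3 → ℂ} (hx : x ≠ 0) :
    ∃ α : ℂ, star α = α ∧ α ^ 2 * (x 0 * star (x 0) + x 1 * star (x 1) + x 2 * star (x 2)) = 1 := by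
  have e : x 0 * star (x 0) + x 1 * star (x 1) + x 2 * star (x 2) =
      ((Complex.normSq (x 0) + Complex.normSq (x 1) + Complex.normSq (x 2) : ℝ) : ℂ) := by
    simp [Complex.mul_conj]
  have h0 : x 0 * star (x 0) + x 1 * star (x 1) + x 2 * star (x 2) ≠ 0 := by
    simpa [dotProduct, Fin.sum_univ_three] using dotProduct_star_ne_zero hx
  set N := Complex.normSq (x 0) + Complex.normSq (x 1) + Complex.normSq (x 2) with hN
  have hN0 : 0 ≤ N := by
    have := Complex.normSq_nonneg
    rw [hN]; linarith [this (x 0), this (x 1), this (x 2)]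
  have hN1 : N ≠ 0 := fun h => h0 (by rw [e, h]; simp)
  refine ⟨((√N)⁻¹ : ℝ), by simp, ?_⟩
  rw [e]
  norm_cast
  rw [inv_pow, Real.sq_sqrt hN0, inv_mul_cancel₀ hN1]

/-- The Iwasawa decomposition. -/
theorem exists_isSU3_mul_mem_borel (M : SL3) : ∃ u, IsSU3 u ∧ u * M ∈ borel := by
  have hM : M⁻¹.1 * M.1 = 1 := by rw [← Matrix.SpecialLinearGroup.coe_mul]; simp
  have hM' : M.1 * M⁻¹.1 = 1 := by rw [← Matrix.SpecialLinearGroup.coe_mul]; simp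
  set p : Fin 3 → ℂ := fun i => M.1 i 0 with hp
  set q : Fin 3 → ℂ := fun i => M⁻¹.1 2 i with hq
  have hp0 : p ≠ 0 := by
    intro h
    have := congrFun (congrFun hM 0) 0
    rw [Matrix.mul_apply, Finset.sum_eq_zero fun i _ =>
      mul_eq_zero_of_right _ (congrFun h i)] at this
    simp at this
  have hq0 : q ≠ 0 := by
    intro h
    have := congrFun (congrFun hM 2) 2
    rw [Matrix.mul_apply, Finset.sum_eq_zero fun i _ =>
      mul_eq_zero_of_left (congrFun h i) _] at this
    simp at this
  obtain ⟨α, hα, hP⟩ := exists_normalizer hp0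
  obtain ⟨γ, hγ, hQ⟩ := exists_normalizer hq0
  have hO : q 0 * p 0 + q 1 * p 1 + q 2 * p 2 = 0 := by
    have := congrFun (congrFun hM 2) 0
    rwa [Matrix.mul_apply, Fin.sum_univ_three] at this
  have hR : q 0 * M.1 0 1 + q 1 * M.1 1 1 + q 2 * M.1 2 1 = 0 := by
    have := congrFun (congrFun hM 2) 1
    rwa [Matrix.mul_apply, Fin.sum_univ_three] at this
  have hO' : star (q 0) * star (p 0) + star (q 1) * star (p 1) + star (q 2) * star (p 2) = 0 := by
    simpa using congrArg star hO
  -- The conjugates become independent variables, so that `ring` and `linear_combination` treat them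
  -- as polynomial unknowns.
  generalize hp0' : star (p 0) = p0' at *
  generalize hp1' : star (p 1) = p1' at *
  generalize hp2' : star (p 2) = p2' at *
  generalize hq0' : star (q 0) = q0' at *
  generalize hq1' : star (q 1) = q1' at *
  generalize hq2' : star (q 2) = q2' at *
  have sp0 : star p0' = p 0 := by rw [← hp0', star_star]
  have sp1 : star p1' = p 1 := by rw [← hp1', star_star]
  have sp2 : star p2' = p 2 := by rw [← hp2', star_star]
  have sq0 : star q0' = q 0 := by rw [← hq0', star_star]
  have sq1 : star q1' = q 1 := by rw [← hq1', star_star]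
  have sq2 : star q2' = q 2 := by rw [← hq2', star_star]
  -- The rows are the normalized conjugate of the first column p of M, a normalized cross product of
  -- q̄ with p, and the normalized last row q of M⁻¹. The outer rows are orthogonal because q · p =
  -- 0. In U * M the last row annihilates the first two columns of M by the definition of q, and the
  -- middle row annihilates p because p is a factor of the cross product.
  let U : Matrix (Fin 3) (Fin 3) ℂ :=
    !![α * p0', α * p1', α * p2';
      α * γ * (q1' * p 2 - q2' * p 1), α * γ * (q2' * p 0 - q0' * p 2),
        α * γ * (q0' * p 1 - q1' * p 0);
      γ * q 0, γ * q 1, γ * q 2]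
  have hUdet : U.det = 1 := by
    rw [Matrix.det_fin_three]
    simp only [U, Matrix.cons_val', Matrix.cons_val_zero, Matrix.cons_val_one, Matrix.of_apply,
      Matrix.cons_val]
    -- Lagrange's identity: the squared norm of the cross product is |p|²|q|² minus the product of q
    -- · p with its conjugate.
    linear_combination (γ ^ 2 * (q 0 * q0' + q 1 * q1' + q 2 * q2')) * hP + hQ -
      α ^ 2 * γ ^ 2 * (q0' * p0' + q1' * p1' + q2' * p2') * hO
  have hU : U ∈ Matrix.unitaryGroup (Fin 3) ℂ := by
    rw [Matrix.mem_unitaryGroup_iff]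
    ext i j
    rw [Matrix.mul_apply, Fin.sum_univ_three]
    simp only [Matrix.star_apply]
    fin_cases i <;> fin_cases j <;>
    simp only [U, Matrix.cons_val', Matrix.cons_val_zero, Matrix.cons_val_one, Matrix.of_apply,
      Matrix.cons_val, star_mul', star_sub, hα, hγ, sp0, sp1, sp2, sq0, sq1, sq2, hp0', hp1', hp2',
      hq0', hq1', hq2', Fin.zero_eta, Fin.mk_one, Fin.reduceFinMk]
    · simp only [Matrix.one_apply_eq]
      linear_combination hP
    · rw [Matrix.one_apply_ne (by decide)]
      ring
    · rw [Matrix.one_apply_ne (by decide)]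
      linear_combination α * γ * hO'
    · rw [Matrix.one_apply_ne (by decide)]
      ring
    · simp only [Matrix.one_apply_eq]
      linear_combination (γ ^ 2 * (q 0 * q0' + q 1 * q1' + q 2 * q2')) * hP + hQ -
        α ^ 2 * γ ^ 2 * (q0' * p0' + q1' * p1' + q2' * p2') * hO
    · rw [Matrix.one_apply_ne (by decide)]
      ring
    · rw [Matrix.one_apply_ne (by decide)]
      linear_combination α * γ * hO
    · rw [Matrix.one_apply_ne (by decide)]
      ring
    · simp only [Matrix.one_apply_eq]
      linear_combination hQ
  let u : SL3 := ⟨U, hUdet⟩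
  have hu : u.1 = U := rfl
  refine ⟨u, hU, ?_, ?_, ?_⟩ <;>
    rw [Matrix.SpecialLinearGroup.coe_mul, Matrix.mul_apply, Fin.sum_univ_three, hu] <;>
    simp only [U, Matrix.cons_val', Matrix.cons_val_zero, Matrix.cons_val_one, Matrix.of_apply,
      Matrix.cons_val]
  · change α * γ * (q1' * p 2 - q2' * p 1) * p 0 + α * γ * (q2' * p 0 - q0' * p 2) * p 1 +
      α * γ * (q0' * p 1 - q1' * p 0) * p 2 = 0
    ring
  · change γ * q 0 * p 0 + γ * q 1 * p 1 + γ * q 2 * p 2 = 0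
    linear_combination γ * hO
  · linear_combination γ * hR

/-! ### Jacobians of coordinate maps -/

theorem coordMap_eq (u g g' : SL3) (z : C3) :
    coordMap u g g' z = cellCoord (g'⁻¹ * (u * (g * lowerUnip z))) := rfl

theorem smul_symm_mem_cell_iff (u g g' : SL3) (z : C3) :
    u • (chart g).symm z ∈ (chart g').source ↔ g'⁻¹ * (u * (g * lowerUnip z)) ∈ cellSet := Iff.rfl

theorem isOpen_overlap (u g g' : SL3) : IsOpen {z | u • (chart g).symm z ∈ (chart g').source} := by
  have : Continuous fun z => g'⁻¹ * (u * (g * lowerUnip z)) :=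
    continuous_const.mul (continuous_const.mul (continuous_const.mul continuous_lowerUnip))
  exact isOpen_cellSet.preimage this

theorem differentiableAt_coordMap {u g g' : SL3} {z : C3}
    (h : u • (chart g).symm z ∈ (chart g').source) :
    DifferentiableAt ℂ (coordMap u g g') z := by
  have e : coordMap u g g' = fun z => cellCoord (g'⁻¹ * u * g * lowerUnip z) := by
    funext z
    rw [coordMap_eq]
    simp only [mul_assoc]
  have hs : {z | u • (chart g).symm z ∈ (chart g').source} =
      {z | g'⁻¹ * u * g * lowerUnip z ∈ cellSet} := by
    ext z
    simp only [Set.mem_ofPred_eq, smul_symm_mem_cell_iff, mul_assoc]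
  have := contDiffOn_cellCoord (𝕜 := ℂ) (g'⁻¹ * u * g)
  rw [← e, ← hs] at this
  exact (this.contDiffAt ((isOpen_overlap u g g').mem_nhds h)).differentiableAt (by simp)

theorem jac_apply (u g g' : SL3) (z : C3) (m j : Fin 3) :
    jac u g g' z m j = fderiv ℂ (coordMap u g g') z (Pi.single j 1) m := by
  simp only [jac, LinearMap.toMatrix'_apply]
  rfl

theorem hasWirt_coordMap {u g g' : SL3} {z : C3}
    (h : u • (chart g).symm z ∈ (chart g').source) (m : Fin 3) :
    HasWirt (fun y => coordMap u g g' y m) (fun j => jac u g g' z m j) (fun _ => 0) z := by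
  have := (hasFDerivAt_pi'.1 (differentiableAt_coordMap h).hasFDerivAt) m
  exact (hasWirt_of_holomorphic this).congr_deriv (fun j => by simp [jac_apply]) fun _ => rfl

theorem jac_eq_of_hasWirt {u g g' : SL3} {z : C3}
    (h : u • (chart g).symm z ∈ (chart g').source) {J : Matrix (Fin 3) (Fin 3) ℂ}
    (hJ : ∀ m, ∃ b, HasWirt (fun y => coordMap u g g' y m) (J m) b z) : jac u g g' z = J := by
  ext m j
  obtain ⟨b, hb⟩ := hJ m
  rw [← (hasWirt_coordMap h m).dz_eq j, hb.dz_eq j]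

theorem coordMap_comp (u v g g' g'' : SL3) {z : C3}
    (h : v • (chart g).symm z ∈ (chart g').source) :
    coordMap u g' g'' (coordMap v g g' z) = coordMap (u * v) g g'' z := by
  rw [coordMap, coordMap, (chart g').left_inv h, coordMap, mul_smul]

theorem smul_symm_coordMap (u v g g' : SL3) {z : C3}
    (h : v • (chart g).symm z ∈ (chart g').source) :
    u • (chart g').symm (coordMap v g g' z) = (u * v) • (chart g).symm z := by
  rw [coordMap, (chart g').left_inv h, mul_smul]

theorem jac_comp (u v g g' g'' : SL3) {z : C3} (h : v • (chart g).symm z ∈ (chart g').source)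
    (h' : (u * v) • (chart g).symm z ∈ (chart g'').source) :
    jac (u * v) g g'' z = jac u g' g'' (coordMap v g g' z) * jac v g g' z := by
  have d1 := differentiableAt_coordMap h
  have d2 : DifferentiableAt ℂ (coordMap u g' g'') (coordMap v g g' z) :=
    differentiableAt_coordMap (by rwa [smul_symm_coordMap u v g g' h])
  have e : coordMap (u * v) g g'' =ᶠ[nhds z] coordMap u g' g'' ∘ coordMap v g g' := by
    filter_upwards [(isOpen_overlap v g g').mem_nhds h] with y hy
    exact (coordMap_comp u v g g' g'' hy).symm
  rw [jac, e.fderiv_eq, fderiv_comp z d2 d1]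
  simp only [jac]
  rw [← LinearMap.toMatrix'_comp]
  rfl

/-- The Jacobian matrix at `z` of `coordMap u g 1` when `u * (g * lowerUnip z) = b` is upper
triangular. -/
def frameJac (b : SL3) (z : C3) : Matrix (Fin 3) (Fin 3) ℂ :=
  !![(b 1 1 - z 2 * b 1 2) / b 0 0, b 1 2 / b 0 0, 0;
    -z 2 * b 2 2 / b 0 0, b 2 2 / b 0 0, 0;
    z 2 * b 0 1 * b 2 2 / (b 0 0 * b 1 1), -b 0 1 * b 2 2 / (b 0 0 * b 1 1), b 2 2 / b 1 1]

theorem borel_diag_prod {b : SL3} (hb : b ∈ borel) : b 0 0 * b 1 1 * b 2 2 = 1 := by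
  obtain ⟨h1, h2, h3⟩ := hb
  have := b.det_coe
  rw [Matrix.det_fin_three] at this
  simp only [h1, h2, h3] at this
  linear_combination this

theorem mem_cellSet_of_mem_borel {b : SL3} (hb : b ∈ borel) : b ∈ cellSet := by
  obtain ⟨h0, h1⟩ := diag_ne_zero hb
  refine ⟨h0, ?_⟩
  rw [minor2, hb.1]
  simp [h0, h1]

theorem cellCoord_of_mem_borel {b : SL3} (hb : b ∈ borel) : cellCoord b = 0 := by
  obtain ⟨h1, h2, h3⟩ := hb
  ext i
  fin_cases i <;> simp [cellCoord, h1, h2, h3]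

theorem mul_lowerUnip_apply (c : SL3) (y : C3) (i : Fin 3) :
    (c * lowerUnip y) i 0 = c i 0 + c i 1 * y 0 + c i 2 * y 1 ∧
    (c * lowerUnip y) i 1 = c i 1 + c i 2 * y 2 ∧ (c * lowerUnip y) i 2 = c i 2 := by
  rw [Matrix.SpecialLinearGroup.coe_mul]
  simp only [Matrix.mul_apply, Fin.sum_univ_three, coe_lowerUnip]
  simp

theorem hasWirt_mul_lowerUnip (c : SL3) (z : C3) (i : Fin 3) :
    HasWirt (fun y => (c * lowerUnip y) i 0) ![c i 1, c i 2, 0] 0 z ∧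
    HasWirt (fun y => (c * lowerUnip y) i 1) ![0, 0, c i 2] 0 z := by
  have k := fun i => hasWirt_coord i z
  constructor
  · simp only [fun y => (mul_lowerUnip_apply c y i).1]
    exact (((hasWirt_const _ z).add ((k 0).const_mul _)).add ((k 1).const_mul _)).congr_deriv
      (fun j => by fin_cases j <;> simp) fun j => by simp
  · simp only [fun y => (mul_lowerUnip_apply c y i).2.1]
    exact ((hasWirt_const _ z).add ((k 2).const_mul _)).congr_deriv
      (fun j => by fin_cases j <;> simp) fun j => by simp

/-- The target coordinates are quotients of entries and minors of `u * g * lowerUnip y`. At `y = z`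
this matrix is triangular, so most terms of the quotient rule vanish. -/
theorem jac_eq_frameJac {u g : SL3} {z : C3} (hb : u * (g * lowerUnip z) ∈ borel) :
    jac u g 1 z = frameJac (u * (g * lowerUnip z)) z := by
  obtain ⟨h0, h1⟩ := diag_ne_zero hb
  have hp := borel_diag_prod hb
  have hmem : u • (chart g).symm z ∈ (chart 1).source := by
    rw [smul_symm_mem_cell_iff, inv_one, one_mul]
    exact mem_cellSet_of_mem_borel hb
  obtain ⟨b1, b2, b3⟩ := hb
  refine jac_eq_of_hasWirt hmem fun m => ?_
  simp only [coordMap_eq, inv_one, one_mul]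
  set b := u * (g * lowerUnip z) with hbdef
  have e := fun i => mul_lowerUnip_apply (u * g) z i
  have w := fun i => hasWirt_mul_lowerUnip (u * g) z i
  simp only [mul_assoc] at e w
  rw [← hbdef] at e
  have c2 : ∀ i, (u * g) i 2 = b i 2 := fun i => (e i).2.2.symm
  -- The columns of `u * g` are recovered from those of b by undoing the unipotent factor.
  have c1 : ∀ i, (u * g) i 1 = b i 1 - z 2 * b i 2 := fun i => by
    rw [(e i).2.1, ← c2]; ring
  simp only [c1, c2] at w
  have hb22 : b 2 2 ≠ 0 := fun h => by simp [h] at hp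
  fin_cases m
  · refine ⟨_, ((w 1).1.div (w 0).1 h0).congr_deriv (fun j => ?_) fun _ => rfl⟩
    rw [← hbdef, b1]
    fin_cases j <;> simp [frameJac] <;> field_simp
  · refine ⟨_, ((w 2).1.div (w 0).1 h0).congr_deriv (fun j => ?_) fun _ => rfl⟩
    rw [← hbdef, b2]
    fin_cases j <;> simp [frameJac, b3] <;> field_simp
  · have hm2 : minor2 b ≠ 0 := by rw [minor2, b1]; simp [h0, h1]
    refine ⟨_, ((((w 0).1.mul (w 2).2).sub ((w 2).1.mul (w 0).2)).div
      (((w 0).1.mul (w 1).2).sub ((w 1).1.mul (w 0).2)) hm2).congr_deriv (fun j => ?_)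
      fun _ => rfl⟩
    rw [← hbdef, b1, b2, b3]
    fin_cases j <;> simp [frameJac] <;> field_simp

/-- Since b₀₀b₁₁b₂₂ = 1, the value is the inverse of the character of weight (2, 2). This is why the
anticanonical bundle of the flag threefold has weight (2, 2). -/
theorem det_frameJac {b : SL3} (hb : b ∈ borel) (z : C3) :
    (frameJac b z).det = (b 2 2 / b 0 0) ^ 2 := by
  obtain ⟨h0, h1⟩ := diag_ne_zero hb
  rw [Matrix.det_fin_three]
  simp [frameJac]
  field_simp
  ring

/-! ### Invariant forms in unitary frames -/

/-- The matrix of a Hermitian form after the substitution given by `J`. -/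
def pullHerm (J D : Matrix (Fin 3) (Fin 3) ℂ) : Matrix (Fin 3) (Fin 3) ℂ := Jᵀ * D * J.map star

theorem pullHerm_mul (J K D : Matrix (Fin 3) (Fin 3) ℂ) :
    pullHerm (J * K) D = pullHerm K (pullHerm J D) := by
  simp only [pullHerm, Matrix.transpose_mul, mul_assoc]
  congr 3
  ext i j
  simp [Matrix.mul_apply]

theorem pullHerm_add (J D D' : Matrix (Fin 3) (Fin 3) ℂ) :
    pullHerm J (D + D') = pullHerm J D + pullHerm J D' := by
  simp only [pullHerm, mul_add, add_mul]

theorem pullHerm_smul (J D : Matrix (Fin 3) (Fin 3) ℂ) (c : ℂ) :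
    pullHerm J (c • D) = c • pullHerm J D := by
  simp only [pullHerm, Matrix.mul_smul, Matrix.smul_mul]

theorem det_map_star (J : Matrix (Fin 3) (Fin 3) ℂ) : (J.map star).det = star J.det := by
  rw [← Matrix.det_conjTranspose, ← Matrix.det_transpose]
  rfl

theorem det_pullHerm (J D : Matrix (Fin 3) (Fin 3) ℂ) :
    (pullHerm J D).det = J.det * star J.det * D.det := by
  rw [pullHerm, Matrix.det_mul, Matrix.det_mul, Matrix.det_transpose, det_map_star]
  ring

theorem pullHerm_apply (J D : Matrix (Fin 3) (Fin 3) ℂ) (j k : Fin 3) :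
    pullHerm J D j k = ∑ l, (∑ m, J m j * D m l) * star (J l k) := by
  simp [pullHerm, Matrix.mul_apply]

theorem pullHerm_diagonal (J : Matrix (Fin 3) (Fin 3) ℂ) (d : Fin 3 → ℂ) (j k : Fin 3) :
    pullHerm J (Matrix.diagonal d) j k = ∑ m, d m * J m j * star (J m k) := by
  rw [pullHerm_apply]
  refine Finset.sum_congr rfl fun l _ => ?_
  simp [Matrix.diagonal_apply, mul_comm]

/-- `c` is obtained from the matrix `D` in every unitary frame. -/
def FrameLaw (c : SL3 → C3 → Matrix (Fin 3) (Fin 3) ℂ) (D : Matrix (Fin 3) (Fin 3) ℂ) : Prop :=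
  ∀ u g z, IsSU3 u → u * (g * lowerUnip z) ∈ borel →
    c g z = pullHerm (frameJac (u * (g * lowerUnip z)) z) D

/-- A unitary frame u at the image point gives the frame uv at the source point. Both sides are then
pulled back from the same D, and the chain rule compares the two Jacobians. -/
theorem FrameLaw.invariant {c : SL3 → C3 → Matrix (Fin 3) (Fin 3) ℂ}
    {D : Matrix (Fin 3) (Fin 3) ℂ} (h : FrameLaw c D) {v g g' : SL3} (hv : IsSU3 v) {z : C3}
    (hz : v • (chart g).symm z ∈ (chart g').source) :
    c g z = pullHerm (jac v g g' z) (c g' (coordMap v g g' z)) := by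
  obtain ⟨u, hu, hb⟩ := exists_isSU3_mul_mem_borel (g' * lowerUnip (coordMap v g g' z))
  have hmem : ∀ {a g z}, a * (g * lowerUnip z) ∈ borel → a • (chart g).symm z ∈ (chart 1).source :=
    fun {a g z} h => by
      rw [smul_symm_mem_cell_iff, inv_one, one_mul]
      exact mem_cellSet_of_mem_borel h
  -- The two matrices represent the same flag, hence differ by a right factor in `borel`.
  have hb' : u * v * (g * lowerUnip z) ∈ borel := by
    have e : (QuotientGroup.mk (g' * lowerUnip (coordMap v g g' z)) : X) =
        QuotientGroup.mk (v * (g * lowerUnip z)) := (chart g').left_inv hz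
    rw [QuotientGroup.eq] at e
    have := borel.mul_mem hb e
    convert this using 1
    group
  rw [h u g' _ hu hb, h (u * v) g z (hu.mul hv) hb', ← pullHerm_mul, ← jac_eq_frameJac hb,
    ← jac_eq_frameJac hb', jac_comp u v g g' 1 hz (hmem hb')]

/-- By Iwasawa some unitary u moves the given point to the base point, so invariance expresses the
form there through its matrix at the origin alone. -/
theorem RealForm11.IsInvariant.frameLaw {ω₀ : RealForm11} (h : ω₀.IsInvariant) :
    FrameLaw ω₀.coeff (ω₀.coeff 1 0) := by
  intro u g z hu hb
  have hmem : u • (chart g).symm z ∈ (chart 1).source := by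
    rw [smul_symm_mem_cell_iff, inv_one, one_mul]
    exact mem_cellSet_of_mem_borel hb
  have := h u hu g 1 z hmem
  rwa [jac_eq_frameJac hb, coordMap_eq, inv_one, one_mul, cellCoord_of_mem_borel hb] at this

theorem borel_eq_mul_lowerUnip_inv {u g : SL3} {z : C3} :
    u.1 * g.1 = (u * (g * lowerUnip z)).1 * !![1, 0, 0; -z 0, 1, 0; z 0 * z 2 - z 1, -z 2, 1] := by
  rw [Matrix.SpecialLinearGroup.coe_mul, Matrix.SpecialLinearGroup.coe_mul, coe_lowerUnip,
    mul_assoc, mul_assoc]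
  have : (!![1, 0, 0; z 0, 1, 0; z 1, z 2, 1] : Matrix (Fin 3) (Fin 3) ℂ) *
      !![1, 0, 0; -z 0, 1, 0; z 0 * z 2 - z 1, -z 2, 1] = 1 := by
    ext i j
    fin_cases i <;> fin_cases j <;> simp [Matrix.mul_apply, Fin.sum_univ_three]
    ring
  rw [this, mul_one]

section frame
variable {u g : SL3} {z : C3}

theorem mulVec_colVec (hb : u * (g * lowerUnip z) ∈ borel) :
    u.1 *ᵥ colVec g z = ![(u * (g * lowerUnip z)) 0 0, 0, 0] := by
  rw [colVec, Matrix.mulVec_mulVec, borel_eq_mul_lowerUnip_inv (z := z)]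
  obtain ⟨h1, h2, h3⟩ := hb
  generalize u * (g * lowerUnip z) = b at *
  ext i
  fin_cases i <;> simp [Matrix.mulVec, dotProduct, Fin.sum_univ_three, Matrix.mul_apply, h1, h2, h3]
    <;> ring

theorem mulVec_colVec' (hb : u * (g * lowerUnip z) ∈ borel) (j : Fin 3) :
    u.1 *ᵥ colVec' g z j = (![![(u * (g * lowerUnip z)) 0 1 - z 2 * (u * (g * lowerUnip z)) 0 2,
      (u * (g * lowerUnip z)) 1 1 - z 2 * (u * (g * lowerUnip z)) 1 2,
      - z 2 * (u * (g * lowerUnip z)) 2 2],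
      ![(u * (g * lowerUnip z)) 0 2, (u * (g * lowerUnip z)) 1 2, (u * (g * lowerUnip z)) 2 2],
      0] : Fin 3 → Fin 3 → ℂ) j := by
  rw [colVec', Matrix.mulVec_mulVec, borel_eq_mul_lowerUnip_inv (z := z)]
  obtain ⟨h1, h2, h3⟩ := hb
  generalize u * (g * lowerUnip z) = b at *
  ext i
  fin_cases j <;> fin_cases i <;>
    simp [Matrix.mulVec, dotProduct, Fin.sum_univ_three, Matrix.mul_apply, h1, h2, h3] <;> ring

/-- After applying the isometry u, the vector is a multiple of e₀. Only the components of the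
derivatives orthogonal to e₀ contribute; divided by b₀₀ they are rows 0 and 1 of `frameJac`. -/
theorem frameLaw_formA : FrameLaw formA (Matrix.diagonal ![1, 1, 0]) := by
  intro u g z hu hb
  rw [formA, ← fubiniStudy_mulVec hu.conjTranspose_mul, mulVec_colVec hb,
    funext (mulVec_colVec' hb)]
  obtain ⟨h0, h1⟩ := diag_ne_zero hb
  generalize u * (g * lowerUnip z) = b at *
  have h0' : (starRingEnd ℂ) (b 0 0) ≠ 0 := by simpa using h0
  ext j k
  rw [pullHerm_diagonal]
  fin_cases j <;> fin_cases k <;>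
    simp [fubiniStudy, dotProduct, Fin.sum_univ_three, frameJac] <;> field_simp <;> ring

/-- Multiplication of row vectors by `u⁻¹` for unitary `u` is an isometry. -/
theorem mulVec_rowVec_aux (v : Fin 3 → ℂ) : u⁻¹.1ᵀ *ᵥ (g⁻¹.1ᵀ *ᵥ v) =
    ((lowerUnip z).1 * (u * (g * lowerUnip z))⁻¹.1)ᵀ *ᵥ v := by
  have : g⁻¹.1 * u⁻¹.1 = (lowerUnip z).1 * (u * (g * lowerUnip z))⁻¹.1 := by
    rw [← Matrix.SpecialLinearGroup.coe_mul, ← Matrix.SpecialLinearGroup.coe_mul]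
    simp only [mul_inv_rev, mul_assoc, mul_inv_cancel_left]
  rw [Matrix.mulVec_mulVec, ← Matrix.transpose_mul, this]

theorem borel_coe_inv {b : SL3} (hb : b ∈ borel) :
    b⁻¹.1 = !![b 1 1 * b 2 2, -b 0 1 * b 2 2, b 0 1 * b 1 2 - b 0 2 * b 1 1;
      0, b 0 0 * b 2 2, -b 0 0 * b 1 2; 0, 0, b 0 0 * b 1 1] := by
  obtain ⟨h1, h2, h3⟩ := hb
  rw [Matrix.SpecialLinearGroup.coe_inv, Matrix.adjugate_fin_three]
  simp [h1, h2, h3]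

theorem mulVec_rowVec (hb : u * (g * lowerUnip z) ∈ borel) :
    u⁻¹.1ᵀ *ᵥ rowVec g z =
      ![0, 0, (u * (g * lowerUnip z)) 0 0 * (u * (g * lowerUnip z)) 1 1] := by
  rw [rowVec, mulVec_rowVec_aux (z := z), borel_coe_inv hb, coe_lowerUnip]
  generalize u * (g * lowerUnip z) = b at *
  ext i
  fin_cases i <;> simp [Matrix.mulVec, dotProduct, Fin.sum_univ_three]
    <;> ring

theorem mulVec_rowVec' (hb : u * (g * lowerUnip z) ∈ borel) (j : Fin 3) :
    u⁻¹.1ᵀ *ᵥ rowVec' g z j =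
      (![z 2 • (u * (g * lowerUnip z))⁻¹.1 0, -(u * (g * lowerUnip z))⁻¹.1 0,
        -(u * (g * lowerUnip z))⁻¹.1 1] : Fin 3 → Fin 3 → ℂ) j := by
  rw [rowVec', mulVec_rowVec_aux (z := z), borel_coe_inv hb, coe_lowerUnip]
  generalize u * (g * lowerUnip z) = b at *
  ext i
  fin_cases j <;> fin_cases i <;>
    simp [Matrix.mulVec, dotProduct, Fin.sum_univ_three] <;> ring

/-- The dual vector becomes a multiple of e₂, and the orthogonal components of its derivatives,
divided by b₀₀b₁₁, are rows 1 and 2 of `frameJac` up to sign. The root direction α₁+α₂ is therefore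
shared with `formA`. -/
theorem frameLaw_formB : FrameLaw formB (Matrix.diagonal ![0, 1, 1]) := by
  intro u g z hu hb
  have hu' : u⁻¹.1ᵀᴴ * u⁻¹.1ᵀ = 1 := by
    rw [hu.coe_inv]
    have := congrArg Matrix.transpose hu.conjTranspose_mul
    rw [Matrix.transpose_mul, Matrix.transpose_one] at this
    convert this using 2
    ext i j
    simp
  rw [formB, ← fubiniStudy_mulVec hu', mulVec_rowVec hb, funext (mulVec_rowVec' hb),
    borel_coe_inv hb]
  obtain ⟨h0, h1⟩ := diag_ne_zero hb
  have hp := borel_diag_prod hb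
  generalize u * (g * lowerUnip z) = b at *
  have h0' : (starRingEnd ℂ) (b 0 0) ≠ 0 := by simpa using h0
  have h1' : (starRingEnd ℂ) (b 1 1) ≠ 0 := by simpa using h1
  ext j k
  rw [pullHerm_diagonal]
  fin_cases j <;> fin_cases k <;>
    simp [fubiniStudy, dotProduct, Fin.sum_univ_three, frameJac] <;> field_simp <;> ring

end frame

/-! ### Norms, determinants and traces in unitary frames. -/

/-- The squared norm of `colVec`. -/
def colNorm (g : SL3) (z : C3) : ℂ := colVec g z ⬝ᵥ star (colVec g z)

/-- The squared norm of `rowVec`. -/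
def rowNorm (g : SL3) (z : C3) : ℂ := rowVec g z ⬝ᵥ star (rowVec g z)

theorem colNorm_ne_zero (g : SL3) (z : C3) : colNorm g z ≠ 0 :=
  dotProduct_star_ne_zero (colVec_ne_zero g z)

theorem rowNorm_ne_zero (g : SL3) (z : C3) : rowNorm g z ≠ 0 :=
  dotProduct_star_ne_zero (rowVec_ne_zero g z)

theorem mulVec_dotProduct_star {n : ℕ} {u : Matrix (Fin n) (Fin n) ℂ} (hu : uᴴ * u = 1)
    (x y : Fin n → ℂ) : (u *ᵥ x) ⬝ᵥ star (u *ᵥ y) = x ⬝ᵥ star y := by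
  rw [Matrix.star_mulVec, dotProduct_comm, ← Matrix.dotProduct_mulVec, Matrix.mulVec_mulVec, hu,
    Matrix.one_mulVec, dotProduct_comm]

theorem IsSU3.transpose_inv {u : SL3} (hu : IsSU3 u) : u⁻¹.1ᵀᴴ * u⁻¹.1ᵀ = 1 := by
  rw [hu.coe_inv]
  have := congrArg Matrix.transpose hu.conjTranspose_mul
  rw [Matrix.transpose_mul, Matrix.transpose_one] at this
  convert this using 2
  ext i j
  simp

theorem colNorm_frame {u g : SL3} {z : C3} (hu : IsSU3 u) (hb : u * (g * lowerUnip z) ∈ borel) :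
    colNorm g z = (u * (g * lowerUnip z)) 0 0 * star ((u * (g * lowerUnip z)) 0 0) := by
  rw [colNorm, ← mulVec_dotProduct_star hu.conjTranspose_mul, mulVec_colVec hb]
  simp [dotProduct, Fin.sum_univ_three]

theorem rowNorm_frame {u g : SL3} {z : C3} (hu : IsSU3 u) (hb : u * (g * lowerUnip z) ∈ borel) :
    rowNorm g z = ((u * (g * lowerUnip z)) 0 0 * (u * (g * lowerUnip z)) 1 1) *
      star ((u * (g * lowerUnip z)) 0 0 * (u * (g * lowerUnip z)) 1 1) := by
  rw [rowNorm, ← mulVec_dotProduct_star hu.transpose_inv, mulVec_rowVec hb]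
  simp [dotProduct, Fin.sum_univ_three]

/-- The squared absolute value of the Jacobian determinant in a unitary frame. -/
theorem normSq_det_frameJac {u g : SL3} {z : C3} (hu : IsSU3 u)
    (hb : u * (g * lowerUnip z) ∈ borel) :
    (frameJac (u * (g * lowerUnip z)) z).det * star (frameJac (u * (g * lowerUnip z)) z).det =
      (colNorm g z ^ 2 * rowNorm g z ^ 2)⁻¹ := by
  rw [colNorm_frame hu hb, rowNorm_frame hu hb, det_frameJac hb]
  obtain ⟨h0, h1⟩ := diag_ne_zero hb
  have hp := borel_diag_prod hb
  generalize u * (g * lowerUnip z) = b at *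
  have h2 : b 2 2 = (b 0 0 * b 1 1)⁻¹ := by
    field_simp
    linear_combination hp
  have h0' : (starRingEnd ℂ) (b 0 0) ≠ 0 := by simpa using h0
  have h1' : (starRingEnd ℂ) (b 1 1) ≠ 0 := by simpa using h1
  rw [h2]
  simp
  field_simp

theorem frameJac_det_ne_zero {b : SL3} (hb : b ∈ borel) (z : C3) : (frameJac b z).det ≠ 0 := by
  rw [det_frameJac hb]
  have hp := borel_diag_prod hb
  refine pow_ne_zero 2 (div_ne_zero (fun h => ?_) (diag_ne_zero hb).1)
  simp [h] at hp

theorem FrameLaw.det {c : SL3 → C3 → Matrix (Fin 3) (Fin 3) ℂ} {D : Matrix (Fin 3) (Fin 3) ℂ}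
    (h : FrameLaw c D) (g : SL3) (z : C3) :
    (c g z).det = (colNorm g z ^ 2 * rowNorm g z ^ 2)⁻¹ * D.det := by
  obtain ⟨u, hu, hb⟩ := exists_isSU3_mul_mem_borel (g * lowerUnip z)
  rw [h u g z hu hb, det_pullHerm, normSq_det_frameJac hu hb]

/-- Both matrices are transformed by the same Jacobian, so the product is conjugated and its trace
is unchanged: contractions of invariant forms are constant on the threefold. -/
theorem FrameLaw.trace_inv_mul {c c' : SL3 → C3 → Matrix (Fin 3) (Fin 3) ℂ}
    {D D' : Matrix (Fin 3) (Fin 3) ℂ} (h : FrameLaw c D) (h' : FrameLaw c' D') (g : SL3) (z : C3) :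
    ((c g z)⁻¹ * c' g z).trace = (D⁻¹ * D').trace := by
  obtain ⟨u, hu, hb⟩ := exists_isSU3_mul_mem_borel (g * lowerUnip z)
  have hJ := frameJac_det_ne_zero hb z
  rw [h u g z hu hb, h' u g z hu hb]
  generalize frameJac (u * (g * lowerUnip z)) z = J at *
  have hu1 : IsUnit (Jᵀ).det := by simpa using hJ
  have hu2 : IsUnit (J.map star).det := by
    rw [det_map_star]
    exact IsUnit.mk0 _ (star_ne_zero.2 hJ)
  rw [pullHerm, pullHerm, Matrix.mul_inv_rev, Matrix.mul_inv_rev]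
  have e : (J.map star)⁻¹ * (D⁻¹ * (Jᵀ)⁻¹) * (Jᵀ * D' * J.map star) =
      (J.map star)⁻¹ * (D⁻¹ * D') * J.map star := by
    calc _ = (J.map star)⁻¹ * (D⁻¹ * ((Jᵀ)⁻¹ * Jᵀ) * D') * J.map star := by
          simp only [mul_assoc]
      _ = _ := by rw [Matrix.nonsing_inv_mul _ hu1, mul_one]
  rw [e, Matrix.trace_mul_comm, ← mul_assoc, Matrix.mul_nonsing_inv _ hu2, one_mul]

theorem FrameLaw.posDef {c : SL3 → C3 → Matrix (Fin 3) (Fin 3) ℂ} {D : Matrix (Fin 3) (Fin 3) ℂ}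
    (h : FrameLaw c D) (hD : D.PosDef) (g : SL3) (z : C3) : (c g z).PosDef := by
  obtain ⟨u, hu, hb⟩ := exists_isSU3_mul_mem_borel (g * lowerUnip z)
  have hJ := frameJac_det_ne_zero hb z
  rw [h u g z hu hb]
  generalize frameJac (u * (g * lowerUnip z)) z = J at *
  have e : pullHerm J D = (J.map star)ᴴ * D * J.map star := by
    rw [pullHerm]
    congr 2
    ext i j
    simp
  rw [e]
  refine hD.conjTranspose_mul_mul_same (Matrix.mulVec_injective_of_isUnit ?_)
  rw [Matrix.isUnit_iff_isUnit_det, det_map_star]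
  exact IsUnit.mk0 _ (star_ne_zero.2 hJ)

theorem FrameLaw.add {c c' : SL3 → C3 → Matrix (Fin 3) (Fin 3) ℂ}
    {D D' : Matrix (Fin 3) (Fin 3) ℂ} (h : FrameLaw c D) (h' : FrameLaw c' D') :
    FrameLaw (fun g z => c g z + c' g z) (D + D') := by
  intro u g z hu hb
  change c g z + c' g z = _
  rw [pullHerm_add, h u g z hu hb, h' u g z hu hb]

theorem FrameLaw.smul {c : SL3 → C3 → Matrix (Fin 3) (Fin 3) ℂ} {D : Matrix (Fin 3) (Fin 3) ℂ}
    (h : FrameLaw c D) (a : ℂ) : FrameLaw (fun g z => a • c g z) (a • D) := by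
  intro u g z hu hb
  change a • c g z = _
  rw [pullHerm_smul, h u g z hu hb]

/-- The forms `s A + t B` in unitary frames. -/
theorem frameLaw_comb (s t : ℂ) : FrameLaw (fun g z => s • formA g z + t • formB g z)
    (Matrix.diagonal ![s, s + t, t]) := by
  convert (frameLaw_formA.smul s).add (frameLaw_formB.smul t) using 1
  ext i j
  fin_cases i <;> fin_cases j <;> simp

/-- The factors s, s+t, t are the pairings of the weight (s, t) with the three positive coroots. -/
theorem det_comb (s t : ℂ) (g : SL3) (z : C3) : (s • formA g z + t • formB g z).det =
    s * (s + t) * t * (colNorm g z ^ 2 * rowNorm g z ^ 2)⁻¹ := by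
  rw [(frameLaw_comb s t).det g z, Matrix.det_diagonal, Fin.prod_univ_three]
  simp
  ring

theorem trace_inv_comb_mul (s t : ℂ) (g : SL3) (z : C3) :
    (((1 : ℂ) • formA g z + (1 : ℂ) • formB g z)⁻¹ * (s • formA g z + t • formB g z)).trace =
      3 / 2 * (s + t) := by
  have := (frameLaw_comb 1 1).trace_inv_mul (frameLaw_comb s t) g z
  rw [this]
  have : (Matrix.diagonal ![(1 : ℂ), 1 + 1, 1])⁻¹ = Matrix.diagonal ![(1 : ℂ), 1 / 2, 1] := by
    refine Matrix.inv_eq_left_inv ?_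
    ext i j
    fin_cases i <;> fin_cases j <;> simp
    norm_num
  rw [this, Matrix.diagonal_mul_diagonal, Matrix.trace_diagonal, Fin.sum_univ_three]
  simp
  ring

/-! ### The invariant Kähler form -/

/-- The form `(√-1/π) ∂∂̄ (log N₁ + log N₂)`. -/
def stdForm : RealForm11 where
  coeff g z := ((Real.pi : ℂ)⁻¹) • formA g z + ((Real.pi : ℂ)⁻¹) • formB g z
  isHermitian g z := by
    have hp : IsSelfAdjoint ((Real.pi : ℂ)⁻¹) := by
      rw [isSelfAdjoint_iff]; simp
    have hA : (formA g z).IsHermitian := isHermitian_fubiniStudy _ _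
    have hB : (formB g z).IsHermitian := isHermitian_fubiniStudy _ _
    exact (hA.smul hp).add (hB.smul hp)
  smooth g j k :=
    (contDiff_const.mul (contDiff_formA g j k)).add (contDiff_const.mul (contDiff_formB g j k))
  compat g g' z h := by
    have := (frameLaw_comb (Real.pi : ℂ)⁻¹ (Real.pi : ℂ)⁻¹).invariant (v := 1) (g := g) (g' := g')
      (z := z) isSU3_one (by rwa [one_smul])
    exact this

theorem frameLaw_stdForm : FrameLaw stdForm.coeff
    (Matrix.diagonal ![(Real.pi : ℂ)⁻¹, (Real.pi : ℂ)⁻¹ + (Real.pi : ℂ)⁻¹, (Real.pi : ℂ)⁻¹]) :=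
  frameLaw_comb _ _

theorem stdForm_isInvariant : stdForm.IsInvariant := fun _ hu _ _ _ h =>
  frameLaw_stdForm.invariant hu h

theorem hasWirt_formA (g : SL3) (z : C3) (j k : Fin 3) : HasWirt (fun w => formA g w j k)
    (fun l => dz l (fun w => formA g w j k) z) (fun l => dzbar l (fun w => formA g w j k) z) z :=
  hasWirt_of_differentiableAt ((contDiff_formA g j k).differentiable (by simp) z)

theorem hasWirt_formB (g : SL3) (z : C3) (j k : Fin 3) : HasWirt (fun w => formB g w j k)
    (fun l => dz l (fun w => formB g w j k) z) (fun l => dzbar l (fun w => formB g w j k) z) z :=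
  hasWirt_of_differentiableAt ((contDiff_formB g j k).differentiable (by simp) z)

theorem stdForm_isKahler : stdForm.IsKahler := by
  constructor
  · refine fun g z => frameLaw_stdForm.posDef (Matrix.PosDef.diagonal fun i => ?_) g z
    have hpi : (0 : ℂ) < (Real.pi : ℂ)⁻¹ := by
      have : (0 : ℝ) < Real.pi⁻¹ := inv_pos.2 Real.pi_pos
      exact_mod_cast this
    fin_cases i
    · exact hpi
    · exact add_pos hpi hpi
    · exact hpi
  · intro g z j k l
    have h := fun j k => ((hasWirt_formA g z j k).const_mul (Real.pi : ℂ)⁻¹).add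
      ((hasWirt_formB g z j k).const_mul (Real.pi : ℂ)⁻¹)
    refine ((h j k).dz_eq l).trans (Eq.trans ?_ ((h l k).dz_eq j).symm)
    rw [dz_formA_comm, dz_formB_comm]

/-! ### Closed invariant forms -/

theorem colVec_one (z : C3) : colVec 1 z = ![1, z 0, z 1] := by
  simp [colVec]

theorem rowVec_one (z : C3) : rowVec 1 z = ![z 0 * z 2 - z 1, -z 2, 1] := by
  simp [rowVec]

/-- The diagonal element `diag(1, √-1, -√-1)` of `SU(3)`. -/
def torusElt : SL3 := ⟨Matrix.diagonal ![1, Complex.I, -Complex.I], by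
  simp [Matrix.det_diagonal, Fin.prod_univ_three]⟩

theorem coe_torusElt : torusElt.1 = Matrix.diagonal ![1, Complex.I, -Complex.I] := rfl

theorem isSU3_torusElt : IsSU3 torusElt := by
  rw [IsSU3, Matrix.mem_unitaryGroup_iff, coe_torusElt]
  ext i j
  fin_cases i <;> fin_cases j <;> simp [Matrix.mul_apply, Fin.sum_univ_three, Matrix.star_apply]

theorem lowerUnip_zero : lowerUnip 0 = 1 := by
  ext i j
  fin_cases i <;> fin_cases j <;> simp [coe_lowerUnip]

/-- The matrix of an invariant form at the base point is diagonal. -/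
theorem RealForm11.IsInvariant.coeff_one_zero {ω₀ : RealForm11} (h : ω₀.IsInvariant) :
    ∃ d : Fin 3 → ℂ, ω₀.coeff 1 0 = Matrix.diagonal d := by
  have hb : torusElt * (1 * lowerUnip 0) = torusElt := by rw [lowerUnip_zero]; simp
  have hm : torusElt ∈ borel := by
    refine ⟨?_, ?_, ?_⟩ <;> rw [coe_torusElt] <;> simp
  have := h.frameLaw torusElt 1 0 isSU3_torusElt (by rwa [hb])
  rw [hb] at this
  -- The torus element multiplies the coordinates by i, -i, -1. These are distinct of modulus one,
  -- so every off-diagonal entry equals itself times a number different from 1.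
  have hJ : frameJac torusElt 0 = Matrix.diagonal ![Complex.I, -Complex.I, -1] := by
    rw [frameJac, coe_torusElt]
    ext i j
    fin_cases i <;> fin_cases j <;> simp
  rw [hJ] at this
  generalize ω₀.coeff 1 0 = D at *
  have e : ∀ j k, D j k = ![Complex.I, -Complex.I, -1] j * D j k *
      star ((![Complex.I, -Complex.I, -1] : Fin 3 → ℂ) k) := by
    intro j k
    conv_lhs => rw [this]
    fin_cases j <;> fin_cases k <;> simp [pullHerm, Matrix.mul_apply, Fin.sum_univ_three]
  refine ⟨fun i => D i i, ?_⟩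
  ext j k
  by_cases hjk : j = k
  · rw [hjk, Matrix.diagonal_apply_eq]
  rw [Matrix.diagonal_apply_ne _ hjk]
  have := e j k
  have key : ∀ (c x : ℂ), c ≠ 1 → x = c * x → x = 0 := by
    intro c x hc hx
    have : (c - 1) * x = 0 := by linear_combination -hx
    exact (mul_eq_zero.1 this).resolve_left (sub_ne_zero.2 hc)
  refine key (![Complex.I, -Complex.I, -1] j * star ((![Complex.I, -Complex.I, -1] : Fin 3 → ℂ) k))
    _ ?_ (by linear_combination this)
  fin_cases j <;> fin_cases k <;> simp at hjk ⊢ <;> norm_num [Complex.ext_iff]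

/-- The vector `(-z₂, 1, 0)` spanning the contact form. -/
def contactVec (z : C3) : Fin 3 → ℂ := ![-z 2, 1, 0]

/-- Row 1 of `frameJac` is `contactVec` times b₂₂/b₀₀, and |b₂₂/b₀₀|² = 1/(N₁N₂). This isolates the
defect d₁ - d₀ - d₂ from being a combination of `formA` and `formB`, as the multiple of one explicit
rank-one form. -/
theorem pullHerm_diagonal_eq {u g : SL3} {z : C3} (hu : IsSU3 u)
    (hb : u * (g * lowerUnip z) ∈ borel) (d : Fin 3 → ℂ) (j k : Fin 3) :
    pullHerm (frameJac (u * (g * lowerUnip z)) z) (Matrix.diagonal d) j k =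
      d 0 * formA g z j k + d 2 * formB g z j k + (d 1 - d 0 - d 2) *
        (contactVec z j * star (contactVec z k) / (colNorm g z * rowNorm g z)) := by
  rw [frameLaw_formA u g z hu hb, frameLaw_formB u g z hu hb, colNorm_frame hu hb,
    rowNorm_frame hu hb]
  obtain ⟨h0, h1⟩ := diag_ne_zero hb
  have hp := borel_diag_prod hb
  generalize u * (g * lowerUnip z) = b at *
  have h2 : b 2 2 = (b 0 0 * b 1 1)⁻¹ := by
    field_simp
    linear_combination hp
  have h0' : star (b 0 0) ≠ 0 := by simpa using h0
  have h1' : star (b 1 1) ≠ 0 := by simpa using h1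
  have hJ : ∀ j, frameJac b z 1 j = contactVec z j * (b 2 2 / b 0 0) := by
    intro j
    fin_cases j <;> simp [frameJac, contactVec] <;> ring
  simp only [pullHerm_diagonal, Fin.sum_univ_three, hJ, h2]
  simp
  field_simp
  ring

/-- A closed invariant form is a combination of the two Fubini–Study forms. -/
theorem RealForm11.IsInvariant.eq_comb {ω₀ : RealForm11} (h : ω₀.IsInvariant) (hK : ω₀.IsKahler) :
    ∃ a c : ℂ, ∀ g z, ω₀.coeff g z = a • formA g z + c • formB g z := by
  obtain ⟨d, hd⟩ := h.coeff_one_zero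
  have e : ∀ g z j k, ω₀.coeff g z j k =
      d 0 * formA g z j k + d 2 * formB g z j k + (d 1 - d 0 - d 2) *
        (contactVec z j * star (contactVec z k) / (colNorm g z * rowNorm g z)) := by
    intro g z j k
    obtain ⟨u, hu, hb⟩ := exists_isSU3_mul_mem_borel (g * lowerUnip z)
    rw [h.frameLaw u g z hu hb, hd, pullHerm_diagonal_eq hu hb]
  refine ⟨d 0, d 2, ?_⟩
  suffices hs : d 1 - d 0 - d 2 = 0 by
    intro g z
    ext j k
    rw [e, hs]
    simp
  -- The norms have no first-order terms at the origin, so the only first-order contribution to the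
  -- contact term is that of -z₂.
  have hN : HasWirt (fun y => colNorm 1 y * rowNorm 1 y) 0 0 0 := by
    have h1 := (hasWirt_dotProduct_star (hasWirt_colVec 1 0) (hasWirt_colVec 1 0)).mul
      (hasWirt_dotProduct_star (hasWirt_rowVec 1 0) (hasWirt_rowVec 1 0))
    refine h1.congr_deriv (fun j => ?_) fun j => ?_ <;> fin_cases j <;>
      simp [colVec', rowVec', colVec_one, rowVec_one, dotProduct, Fin.sum_univ_three]
  have hN0 : colNorm 1 0 * rowNorm 1 0 ≠ 0 :=
    mul_ne_zero (colNorm_ne_zero 1 0) (rowNorm_ne_zero 1 0)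
  have hN1 : colNorm 1 0 * rowNorm 1 0 = 1 := by
    simp [colNorm, rowNorm, colVec_one, rowVec_one, dotProduct, Fin.sum_univ_three]
  have w1 : HasWirt (fun y : C3 => contactVec y 0 * star (contactVec y 1) /
      (colNorm 1 y * rowNorm 1 y)) (fun j => if j = 2 then -1 else 0) 0 0 := by
    refine (((hasWirt_coord 2 0).neg.mul (hasWirt_const 1 0).conj).div hN hN0).congr_deriv
      (fun j => ?_) fun j => ?_
    · simp only [Pi.zero_apply, hN1]
      split_ifs <;> simp
    · simp
  have w2 : HasWirt (fun y : C3 => contactVec y 2 * star (contactVec y 1) /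
      (colNorm 1 y * rowNorm 1 y)) 0 0 0 := by
    simp only [contactVec, Matrix.cons_val, zero_mul, zero_div]
    exact hasWirt_const 0 0
  -- Closedness compares ∂₂ of entry (0,1) with ∂₀ of entry (2,1). The closed forms A and B cancel,
  -- and the contact term contributes -(d₁ - d₀ - d₂) on one side and 0 on the other.
  have hc := hK.2 1 0 0 1 2
  simp only [e] at hc
  rw [((((hasWirt_formA 1 0 0 1).const_mul (d 0)).add
    ((hasWirt_formB 1 0 0 1).const_mul (d 2))).add (w1.const_mul (d 1 - d 0 - d 2))).dz_eq 2,
    ((((hasWirt_formA 1 0 2 1).const_mul (d 0)).add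
    ((hasWirt_formB 1 0 2 1).const_mul (d 2))).add (w2.const_mul (d 1 - d 0 - d 2))).dz_eq 0,
    dz_formA_comm 1 0 0 1 2, dz_formB_comm 1 0 0 1 2] at hc
  simp at hc
  linear_combination -hc

/-! ### Hermitian metrics on sums of homogeneous line bundles -/

theorem colVec_mul_lowerUnip (g : SL3) (z : C3) : colVec (g * lowerUnip z) 0 = colVec g z := by
  rw [colVec, colVec, Matrix.SpecialLinearGroup.coe_mul, ← Matrix.mulVec_mulVec, coe_lowerUnip]
  congr 1
  ext i
  fin_cases i <;> simp [Matrix.mulVec, dotProduct, Fin.sum_univ_three]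

theorem lowerUnip_inv (z : C3) :
    (lowerUnip z)⁻¹.1 = !![1, 0, 0; -z 0, 1, 0; z 0 * z 2 - z 1, -z 2, 1] := by
  rw [Matrix.SpecialLinearGroup.coe_inv, coe_lowerUnip, Matrix.adjugate_fin_three]
  ext i j
  fin_cases i <;> fin_cases j <;> simp

theorem rowVec_mul_lowerUnip (g : SL3) (z : C3) : rowVec (g * lowerUnip z) 0 = rowVec g z := by
  rw [rowVec, rowVec, mul_inv_rev, Matrix.SpecialLinearGroup.coe_mul, Matrix.transpose_mul,
    ← Matrix.mulVec_mulVec, lowerUnip_inv]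
  congr 1
  ext i
  fin_cases i <;> simp [Matrix.mulVec, dotProduct, Fin.sum_univ_three]

theorem colVec_mul_borel (a : SL3) {b : SL3} (hb : b ∈ borel) :
    colVec (a * b) 0 = b 0 0 • colVec a 0 := by
  rw [colVec, colVec, Matrix.SpecialLinearGroup.coe_mul, ← Matrix.mulVec_mulVec,
    ← Matrix.mulVec_smul]
  congr 1
  obtain ⟨h1, h2, h3⟩ := hb
  ext i
  fin_cases i <;> simp [Matrix.mulVec, dotProduct, Fin.sum_univ_three, h1, h2]

theorem rowVec_mul_borel (a : SL3) {b : SL3} (hb : b ∈ borel) :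
    rowVec (a * b) 0 = (b 0 0 * b 1 1) • rowVec a 0 := by
  rw [rowVec, rowVec, mul_inv_rev, Matrix.SpecialLinearGroup.coe_mul, Matrix.transpose_mul,
    ← Matrix.mulVec_mulVec, ← Matrix.mulVec_smul, borel_coe_inv hb]
  congr 1
  ext i
  fin_cases i <;> simp [Matrix.mulVec, dotProduct, Fin.sum_univ_three]

theorem smul_dotProduct_star_smul {n : ℕ} (c : ℂ) (v : Fin n → ℂ) :
    (c • v) ⬝ᵥ star (c • v) = c * star c * (v ⬝ᵥ star v) := by
  simp only [star_smul, smul_dotProduct, dotProduct_smul, smul_eq_mul]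
  ring

/-- The metric `N₁^(-s) N₂^(-t)`, where `w = (s, t)`, on the line over `z` in `chart g`. -/
def weight (w : ℤ × ℤ) (g : SL3) (z : C3) : ℂ := colNorm g z ^ (-w.1) * rowNorm g z ^ (-w.2)

theorem weight_mul_lowerUnip (w : ℤ × ℤ) (g : SL3) (z : C3) :
    weight w (g * lowerUnip z) 0 = weight w g z := by
  rw [weight, weight, colNorm, rowNorm, colVec_mul_lowerUnip, rowVec_mul_lowerUnip]
  rfl

theorem character_ne_zero (w : ℤ × ℤ) {b : SL3} (hb : b ∈ borel) : character w b ≠ 0 := by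
  obtain ⟨h0, h1⟩ := diag_ne_zero hb
  exact mul_ne_zero (zpow_ne_zero _ h0) (zpow_ne_zero _ (mul_ne_zero h0 h1))

/-- Under right multiplication by B the two vectors scale by the fundamental characters b₀₀ and
b₀₀b₁₁. The resulting rule is the compatibility required of a metric on the associated line bundle.
-/
theorem weight_mul_borel (w : ℤ × ℤ) (a : SL3) {b : SL3} (hb : b ∈ borel) :
    weight w a 0 = character w b * star (character w b) * weight w (a * b) 0 := by
  obtain ⟨h0, h1⟩ := diag_ne_zero hb
  have h0' : star (b 0 0) ≠ 0 := star_ne_zero.2 h0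
  have h1' : star (b 1 1) ≠ 0 := star_ne_zero.2 h1
  rw [weight, weight, colNorm, colNorm, rowNorm, rowNorm, colVec_mul_borel a hb,
    rowVec_mul_borel a hb, smul_dotProduct_star_smul, smul_dotProduct_star_smul, character]
  simp only [mul_zpow, star_mul', star_zpow₀, zpow_neg]
  field_simp

theorem weight_ne_zero (w : ℤ × ℤ) (g : SL3) (z : C3) : weight w g z ≠ 0 :=
  mul_ne_zero (zpow_ne_zero _ (colNorm_ne_zero g z)) (zpow_ne_zero _ (rowNorm_ne_zero g z))

theorem dotProduct_star_pos {n : ℕ} {x : Fin n → ℂ} (hx : x ≠ 0) : 0 < x ⬝ᵥ star x := by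
  simpa using hx

theorem colNorm_pos (g : SL3) (z : C3) : 0 < colNorm g z := dotProduct_star_pos (colVec_ne_zero g z)

theorem rowNorm_pos (g : SL3) (z : C3) : 0 < rowNorm g z := dotProduct_star_pos (rowVec_ne_zero g z)

theorem weight_pos (w : ℤ × ℤ) (g : SL3) (z : C3) : 0 < weight w g z :=
  mul_pos (zpow_pos (colNorm_pos g z) _) (zpow_pos (rowNorm_pos g z) _)

theorem contDiff_zpow_real {f : C3 → ℂ} (hf : ContDiff ℝ ∞ f) (h0 : ∀ z, f z ≠ 0) (n : ℤ) :
    ContDiff ℝ ∞ fun z => f z ^ n := by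
  cases n with
  | ofNat n => simpa using hf.pow n
  | negSucc n =>
    simp only [zpow_negSucc]
    exact (hf.pow (n + 1)).inv fun z => pow_ne_zero _ (h0 z)

theorem contDiff_colNorm (g : SL3) : ContDiff ℝ ∞ (colNorm g) :=
  contDiff_dotProduct_star (contDiff_colVec g) (contDiff_colVec g)

theorem contDiff_rowNorm (g : SL3) : ContDiff ℝ ∞ (rowNorm g) :=
  contDiff_dotProduct_star (contDiff_rowVec g) (contDiff_rowVec g)

theorem contDiff_weight (w : ℤ × ℤ) (g : SL3) : ContDiff ℝ ∞ (weight w g) :=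
  (contDiff_zpow_real (contDiff_colNorm g) (colNorm_ne_zero g) _).mul
    (contDiff_zpow_real (contDiff_rowNorm g) (rowNorm_ne_zero g) _)

theorem contMDiffOn_chart_real (g : SL3) :
    ContMDiffOn 𝓘(ℝ, C3) 𝓘(ℝ, C3) ω (chart g) (cell g) :=
  contMDiffOn_of_mem_maximalAtlas (IsManifold.subset_maximalAtlas ⟨g, rfl⟩)

theorem localSection_mul_borelCocycle (g g' : SL3) (x : X) :
    localSection g x * borelCocycle g g' x = localSection g' x := by
  rw [borelCocycle, mul_inv_cancel_left]

theorem weight_localSection (w : ℤ × ℤ) (g : SL3) (x : X) :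
    weight w (localSection g x) 0 = weight w g (chart g x) := weight_mul_lowerUnip w g _

theorem contMDiffOn_weight_localSection (w : ℤ × ℤ) (g : SL3) :
    ContMDiffOn 𝓘(ℝ, C3) 𝓘(ℝ, ℂ) ∞ (fun x => weight w (localSection g x) 0) (cell g) := by
  simp only [weight_localSection]
  exact (contDiff_weight w g).contMDiff.comp_contMDiffOn
    ((contMDiffOn_chart_real g).of_le (by exact_mod_cast le_top))

theorem contMDiffOn_diagonal_weight {r : ℕ} (w : Fin r → ℤ × ℤ) (g : SL3) (a b : Fin r) :
    ContMDiffOn 𝓘(ℝ, C3) 𝓘(ℝ, ℂ) ∞ (fun x => (Matrix.diagonal fun k =>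
      weight (w k) (localSection g x) 0) a b) (cell g) := by
  by_cases hab : a = b
  · subst hab
    simp only [Matrix.diagonal_apply_eq]
    exact contMDiffOn_weight_localSection (w a) g
  · simp only [Matrix.diagonal_apply_ne _ hab]
    exact contMDiffOn_const

theorem toMatrix'_diagCLM {r : ℕ} (c : Fin r → ℂ) :
    LinearMap.toMatrix' (diagCLM c).toLinearMap = Matrix.diagonal c := by
  ext a b
  simp [LinearMap.toMatrix'_apply, Matrix.diagonal_apply, Pi.single_apply]

theorem diagonal_weight_compat {r : ℕ} (w : Fin r → ℤ × ℤ) {i j : SL3} {x : X} (hi : x ∈ cell i)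
    (hj : x ∈ cell j) : (Matrix.diagonal fun k => weight (w k) (localSection i x) 0) =
      (LinearMap.toMatrix'
        (diagCLM fun k => character (w k) (borelCocycle i j x)).toLinearMap)ᴴ *
        (Matrix.diagonal fun k => weight (w k) (localSection j x) 0) *
      LinearMap.toMatrix' (diagCLM fun k => character (w k) (borelCocycle i j x)).toLinearMap := by
  rw [toMatrix'_diagCLM, Matrix.diagonal_conjTranspose, Matrix.diagonal_mul_diagonal,
    Matrix.diagonal_mul_diagonal]
  congr 1
  ext k
  rw [weight_mul_borel (w k) (localSection i x) (borelCocycle_mem hi hj),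
    localSection_mul_borelCocycle]
  simp only [Pi.star_apply]
  ring

/-- The standard Hermitian metric on a sum of homogeneous line bundles. -/
def lineMetric {r : ℕ} (w : Fin r → ℤ × ℤ) : HermitianMetric (lineSum w) where
  mat g x := Matrix.diagonal fun k => weight (w k) (localSection g x) 0
  posDef _ _ _ := Matrix.PosDef.diagonal fun _ => weight_pos _ _ _
  smooth g a b := contMDiffOn_diagonal_weight w g a b
  compat _ _ _ hx := diagonal_weight_compat w hx.1 hx.2

theorem colNorm_unitary_mul {u : SL3} (hu : IsSU3 u) (a : SL3) (z : C3) :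
    colNorm (u * a) z = colNorm a z := by
  have : colVec (u * a) z = u.1 *ᵥ colVec a z := by
    rw [colVec, colVec, Matrix.mulVec_mulVec, Matrix.SpecialLinearGroup.coe_mul]
  rw [colNorm, this, mulVec_dotProduct_star hu.conjTranspose_mul]
  rfl

theorem rowNorm_unitary_mul {u : SL3} (hu : IsSU3 u) (a : SL3) (z : C3) :
    rowNorm (u * a) z = rowNorm a z := by
  have : rowVec (u * a) z = u⁻¹.1ᵀ *ᵥ rowVec a z := by
    rw [rowVec, rowVec, Matrix.mulVec_mulVec, mul_inv_rev, Matrix.SpecialLinearGroup.coe_mul,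
      Matrix.transpose_mul]
  rw [rowNorm, this, mulVec_dotProduct_star hu.transpose_inv]
  rfl

theorem chart_smul (u g : SL3) (x : X) : chart (u * g) (u • x) = chart g x := by
  induction x using QuotientGroup.induction_on with
  | H a =>
    change cellCoord ((u * g)⁻¹ * (u * a)) = cellCoord (g⁻¹ * a)
    congr 1
    group

theorem lineMetric_isInvariant {r : ℕ} (w : Fin r → ℤ × ℤ) :
    IsInvariantMetric (lineMetric w) := by
  intro u hu g x _
  have e : localSection (u * g) (u • x) = u * localSection g x := by
    rw [localSection, localSection, chart_smul, mul_assoc]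
  change (Matrix.diagonal fun k => weight (w k) (localSection (u * g) (u • x)) 0) =
    Matrix.diagonal fun k => weight (w k) (localSection g x) 0
  simp only [e, weight, colNorm_unitary_mul hu, rowNorm_unitary_mul hu]

/-! ### Curvature -/

/-- The coefficient of `dz_j ∧ dz̄_k` in `∂̄∂ log f`. -/
def logCurv (f : C3 → ℂ) (z : C3) (j k : Fin 3) : ℂ := -dzbar k (fun y => dz j f y / f y) z

theorem hasWirt_weight (w : ℤ × ℤ) (g : SL3) (z : C3) :
    ∃ b, HasWirt (weight w g) (fun j => weight w g z *
      (-(w.1 * ((colVec' g z j ⬝ᵥ star (colVec g z)) / (colVec g z ⬝ᵥ star (colVec g z)))) -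
        w.2 * ((rowVec' g z j ⬝ᵥ star (rowVec g z)) / (rowVec g z ⬝ᵥ star (rowVec g z))))) b z := by
  have h := ((hasWirt_dotProduct_star (hasWirt_colVec g z) (hasWirt_colVec g z)).zpow
    (colNorm_ne_zero g z) (-w.1)).mul
    ((hasWirt_dotProduct_star (hasWirt_rowVec g z) (hasWirt_rowVec g z)).zpow
    (rowNorm_ne_zero g z) (-w.2))
  refine ⟨_, h.congr_deriv (fun j => ?_) fun _ => rfl⟩
  simp only [weight, colNorm, rowNorm]
  push_cast
  ring

theorem dz_div_of_eventuallyEq {w : ℤ × ℤ} {g : SL3} {f l : C3 → ℂ} {c : ℂ} (hc : c ≠ 0) {y : C3}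
    {a : Fin 3 → ℂ} (hl : HasWirt l a (fun _ => 0) y) (h0 : l y ≠ 0)
    (e : f =ᶠ[nhds y] fun y => c * (l y * star (l y) * weight w g y)) (j : Fin 3) :
    dz j f y / f y = a j / l y +
      (-(w.1 * ((colVec' g y j ⬝ᵥ star (colVec g y)) / (colVec g y ⬝ᵥ star (colVec g y)))) -
        w.2 * ((rowVec' g y j ⬝ᵥ star (rowVec g y)) / (rowVec g y ⬝ᵥ star (rowVec g y)))) := by
  obtain ⟨b, hw⟩ := hasWirt_weight w g y
  have h0' : star (l y) ≠ 0 := star_ne_zero.2 h0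
  have hW := weight_ne_zero w g y
  rw [dz_congr e, e.eq_of_nhds, (((hl.mul hl.conj).mul hw).const_mul c).dz_eq j]
  generalize -(w.1 * ((colVec' g y j ⬝ᵥ star (colVec g y)) /
    (colVec g y ⬝ᵥ star (colVec g y)))) - w.2 * ((rowVec' g y j ⬝ᵥ star (rowVec g y)) /
      (rowVec g y ⬝ᵥ star (rowVec g y))) = q
  simp only [star_zero, mul_zero, add_zero]
  field_simp

/-- A nonvanishing holomorphic factor l contributes ∂l/l to the connection, which ∂̄ annihilates, so
the curvature does not depend on the trivialization. The constant c accommodates the determinant of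
the tangent metric. -/
theorem logCurv_of_eventuallyEq {w : ℤ × ℤ} {g : SL3} {f l : C3 → ℂ} {c : ℂ} (hc : c ≠ 0) {z : C3}
    (hl : ContDiffAt ℂ ω l z) (h0 : l z ≠ 0)
    (e : f =ᶠ[nhds z] fun y => c * (l y * star (l y) * weight w g y)) (j k : Fin 3) :
    logCurv f z j k = w.1 * formA g z j k + w.2 * formB g z j k := by
  have hd : ContDiffAt ℂ 1 (fderiv ℂ l) z := hl.fderiv_right (by exact le_top)
  have ev : ∀ᶠ y in nhds z, DifferentiableAt ℂ l y ∧ l y ≠ 0 := by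
    refine (((hl.of_le (m := 1) le_top).eventually (by simp)).mono fun y hy =>
      hy.differentiableAt (by simp)).and (hl.continuousAt.eventually_ne h0)
  have key : (fun y => dz j f y / f y) =ᶠ[nhds z] fun y =>
      fderiv ℂ l y (Pi.single j 1) / l y +
      (-(w.1 * ((colVec' g y j ⬝ᵥ star (colVec g y)) / (colVec g y ⬝ᵥ star (colVec g y)))) -
        w.2 * ((rowVec' g y j ⬝ᵥ star (rowVec g y)) / (rowVec g y ⬝ᵥ star (rowVec g y)))) := by
    filter_upwards [ev, e.eventually_nhds] with y hy hy'
    exact dz_div_of_eventuallyEq hc (hasWirt_of_holomorphic hy.1.hasFDerivAt) hy.2 hy' j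
  have h1 : DifferentiableAt ℂ (fun y => fderiv ℂ l y (Pi.single j 1) / l y) z := by
    simp only [div_eq_mul_inv]
    exact ((hd.differentiableAt (by simp)).clm_apply (differentiableAt_const _)).mul
      (ev.self_of_nhds.1.inv h0)
  have h2 := (((hasWirt_logDeriv (x := colVec g) (x' := colVec' g) (hasWirt_colVec g z)
    (hasWirt_colVec' g z) (colVec_ne_zero g z) j).const_mul (w.1 : ℂ)).neg).sub
    ((hasWirt_logDeriv (x := rowVec g) (x' := rowVec' g) (hasWirt_rowVec g z) (hasWirt_rowVec' g z)
      (rowVec_ne_zero g z) j).const_mul (w.2 : ℂ))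
  rw [logCurv, dzbar_congr key, ((hasWirt_of_holomorphic h1.hasFDerivAt).add h2).dzbar_eq k]
  simp only [formA, formB]
  ring

theorem contDiffAt_character (w : ℤ × ℤ) {i g : SL3} {z : C3} (h : (chart g).symm z ∈ cell i) :
    ContDiffAt ℂ ω (fun y => character w (borelCocycle i g ((chart g).symm y))) z := by
  have h1 := contMDiffOn_character w i g
  have h2 : ContMDiffOn 𝓘(ℂ, C3) 𝓘(ℂ, C3) ω (chart g).symm (chart g).target :=
    contMDiffOn_symm_of_mem_maximalAtlas (IsManifold.subset_maximalAtlas ⟨g, rfl⟩)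
  have h3 : ContMDiffAt 𝓘(ℂ, C3) 𝓘(ℂ, C3) ω (chart g).symm z :=
    h2.contMDiffAt ((chart g).open_target.mem_nhds (Set.mem_univ z))
  have hx : (chart g).symm z ∈ cell g := (chart g).map_target (Set.mem_univ z)
  have h4 := h1.contMDiffAt (((isOpen_cell i).inter (isOpen_cell g)).mem_nhds ⟨h, hx⟩)
  exact (ContMDiffAt.comp z h4 h3).contDiffAt

theorem logCurv_weight_localSection (w : ℤ × ℤ) {i g : SL3} {z : C3}
    (h : (chart g).symm z ∈ cell i) {c : ℂ} (hc : c ≠ 0) (j k : Fin 3) :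
    logCurv (fun y => c * weight w (localSection i ((chart g).symm y)) 0) z j k =
      w.1 * formA g z j k + w.2 * formB g z j k := by
  have hx : ∀ y, (chart g).symm y ∈ cell g := fun y => (chart g).map_target (Set.mem_univ y)
  refine logCurv_of_eventuallyEq hc (contDiffAt_character w h)
    (character_ne_zero w (borelCocycle_mem h (hx z))) ?_ j k
  filter_upwards [(isOpen_overlap 1 g i).mem_nhds (by rwa [Set.mem_ofPred_eq, one_smul])] with y hy
  have hy' : (chart g).symm y ∈ cell i := by rwa [one_smul] at hy
  rw [weight_mul_borel w _ (borelCocycle_mem hy' (hx y)), localSection_mul_borelCocycle,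
    weight_localSection, (chart g).right_inv (Set.mem_univ y)]

section lineMetric
variable {r : ℕ} (w : Fin r → ℤ × ℤ)

theorem lineMetric_localMat (i g : SL3) (z : C3) : (lineMetric w).localMat i g z =
    Matrix.diagonal fun k => weight (w k) (localSection i ((chart g).symm z)) 0 := rfl

theorem lineMetric_connection (i g : SL3) (z : C3) (j : Fin 3) :
    (lineMetric w).connection i g z j = Matrix.diagonal fun k =>
      dz j (fun y => weight (w k) (localSection i ((chart g).symm y)) 0) z /
        weight (w k) (localSection i ((chart g).symm z)) 0 := by
  have e : (Matrix.of fun a b => dz j (fun y => (lineMetric w).localMat i g y a b) z :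
      Matrix (Fin r) (Fin r) ℂ) = Matrix.diagonal fun k =>
        dz j (fun y => weight (w k) (localSection i ((chart g).symm y)) 0) z := by
    ext a b
    simp only [lineMetric_localMat, Matrix.of_apply]
    by_cases hab : a = b
    · subst hab
      simp only [Matrix.diagonal_apply_eq]
    · simp only [Matrix.diagonal_apply_ne _ hab]
      exact (hasWirt_const 0 z).dz_eq j
  have einv : ((lineMetric w).localMat i g z)⁻¹ = Matrix.diagonal fun k =>
      (weight (w k) (localSection i ((chart g).symm z)) 0)⁻¹ := by
    refine Matrix.inv_eq_left_inv ?_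
    rw [lineMetric_localMat]
    refine (Matrix.diagonal_mul_diagonal _ _).trans ?_
    simp only [inv_mul_cancel₀ (weight_ne_zero _ _ _)]
    exact Matrix.diagonal_one
  refine (congrArg₂ (fun M N : Matrix (Fin r) (Fin r) ℂ => M * N) einv e).trans ?_
  rw [Matrix.diagonal_mul_diagonal]
  congr 1
  ext k
  rw [div_eq_inv_mul]

theorem lineMetric_curvature {i g : SL3} {z : C3} (h : (chart g).symm z ∈ cell i) (j k : Fin 3) :
    (lineMetric w).curvature i g z j k = Matrix.diagonal fun a =>
      (w a).1 * formA g z j k + (w a).2 * formB g z j k := by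
  have e : ∀ a b, (lineMetric w).curvature i g z j k a b =
      -dzbar k (fun y => (lineMetric w).connection i g y j a b) z := fun _ _ => rfl
  refine Matrix.ext (m := Fin r) (n := Fin r) fun a b => (e a b).trans ?_
  simp only [lineMetric_connection]
  by_cases hab : a = b
  · subst hab
    rw [Matrix.diagonal_apply_eq, ← logCurv_weight_localSection (w a) h one_ne_zero j k, logCurv]
    simp only [one_mul, Matrix.diagonal_apply_eq]
  · simp only [Matrix.diagonal_apply_ne _ hab]
    rw [(hasWirt_const 0 z).dzbar_eq k, neg_zero]

end lineMetric

/-! ### Contractions and wedge products -/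

theorem sum_perm_fin_three {M : Type*} [AddCommMonoid M] (f : Equiv.Perm (Fin 3) → M) :
    ∑ σ, f σ = f 1 + f (Equiv.swap 0 1) + f (Equiv.swap 0 2) + f (Equiv.swap 1 2) +
      f (Equiv.swap 0 1 * Equiv.swap 1 2) + f (Equiv.swap 1 2 * Equiv.swap 0 1) := by
  have : (Finset.univ : Finset (Equiv.Perm (Fin 3))) = {1, Equiv.swap 0 1, Equiv.swap 0 2,
      Equiv.swap 1 2, Equiv.swap 0 1 * Equiv.swap 1 2, Equiv.swap 1 2 * Equiv.swap 0 1} := by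
    decide
  rw [this]
  iterate 5 rw [Finset.sum_insert (by decide)]
  rw [Finset.sum_singleton]
  simp only [add_assoc]

/-- The double sum is the polarization of 6 det. With two equal arguments it is twice the derivative
of the determinant, which Jacobi's formula expresses by the adjugate. -/
theorem wedge3_scalar (P Q : Matrix (Fin 3) (Fin 3) ℂ) :
    wedge3 P Q Q = 2 * (Q.adjugate * P).trace := by
  have s : ∀ i j : Fin 3, i ≠ j → Equiv.Perm.sign (Equiv.swap i j) = -1 :=
    fun i j h => Equiv.Perm.sign_swap h
  simp only [wedge3, sum_perm_fin_three, Equiv.Perm.sign_mul, Equiv.Perm.sign_one,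
    s 0 1 (by decide), s 0 2 (by decide), s 1 2 (by decide), Equiv.Perm.mul_apply,
    Equiv.Perm.one_apply]
  have e1 : ∀ i : Fin 3, Equiv.swap (0 : Fin 3) 1 i = ![1, 0, 2] i := by decide
  have e2 : ∀ i : Fin 3, Equiv.swap (0 : Fin 3) 2 i = ![2, 1, 0] i := by decide
  have e3 : ∀ i : Fin 3, Equiv.swap (1 : Fin 3) 2 i = ![0, 2, 1] i := by decide
  simp only [e1, e2, e3, Matrix.cons_val, Matrix.trace_fin_three, Matrix.mul_apply,
    Fin.sum_univ_three, Matrix.adjugate_fin_three, Matrix.of_apply, Matrix.cons_val']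
  simp
  ring

theorem wedge3_self (M : Matrix (Fin 3) (Fin 3) ℂ) : wedge3 M M M = 6 * M.det := by
  rw [wedge3_scalar, Matrix.adjugate_mul, Matrix.trace_smul, Matrix.trace_one]
  simp
  ring

theorem wedge3_eq_trace_inv (P : Matrix (Fin 3) (Fin 3) ℂ) {Q : Matrix (Fin 3) (Fin 3) ℂ}
    (hQ : Q.det ≠ 0) : wedge3 P Q Q = 2 * Q.det * (Q⁻¹ * P).trace := by
  rw [wedge3_scalar, Matrix.inv_def, Matrix.smul_mul, Matrix.trace_smul, Ring.inverse_eq_inv',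
    smul_eq_mul]
  field_simp

/-- Applied to the ring homomorphism onto diagonal matrices, this reduces the cube of an
endomorphism-valued form to scalar cubes, one for each summand. -/
theorem map_wedge3 {R S : Type} [Ring R] [Ring S] (f : R →+* S) (A B C : Fin 3 → Fin 3 → R) :
    f (wedge3 A B C) =
      wedge3 (fun j k => f (A j k)) (fun j k => f (B j k)) fun j k => f (C j k) := by
  simp only [wedge3, map_sum, map_zsmul, map_mul]

theorem wedge3_diagonal {r : ℕ} (A : Fin r → Fin 3 → Fin 3 → ℂ) :
    wedge3 (fun j k => Matrix.diagonal fun a => A a j k)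
      (fun j k => Matrix.diagonal fun a => A a j k)
      (fun j k => (Matrix.diagonal fun a => A a j k : Matrix (Fin r) (Fin r) ℂ)) =
    Matrix.diagonal fun a => wedge3 (A a) (A a) (A a) := by
  have h := map_wedge3 (Matrix.diagonalRingHom (Fin r) ℂ) (fun j k a => A a j k)
    (fun j k a => A a j k) fun j k a => A a j k
  have hd : ∀ x, Matrix.diagonalRingHom (Fin r) ℂ x = Matrix.diagonal x := fun _ => rfl
  simp only [hd] at h
  rw [← h]
  congr 1

/-- The density of the invariant volume on the big cell. -/
def density (g : SL3) (z : C3) : ℂ := (colNorm g z ^ 2 * rowNorm g z ^ 2)⁻¹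

theorem stdForm_coeff (g : SL3) (z : C3) : stdForm.coeff g z =
    ((Real.pi : ℂ)⁻¹) • formA g z + ((Real.pi : ℂ)⁻¹) • formB g z := rfl

theorem pi_ne_zero' : (Real.pi : ℂ) ≠ 0 := by exact_mod_cast Real.pi_ne_zero

theorem density_ne_zero (g : SL3) (z : C3) : density g z ≠ 0 :=
  inv_ne_zero (mul_ne_zero (pow_ne_zero 2 (colNorm_ne_zero g z))
    (pow_ne_zero 2 (rowNorm_ne_zero g z)))

theorem det_stdForm (g : SL3) (z : C3) :
    (stdForm.coeff g z).det = 2 / (Real.pi : ℂ) ^ 3 * density g z := by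
  rw [stdForm_coeff, det_comb, density]
  have := pi_ne_zero'
  field_simp
  ring

theorem det_stdForm_ne_zero (g : SL3) (z : C3) : (stdForm.coeff g z).det ≠ 0 := by
  rw [det_stdForm]
  exact mul_ne_zero (div_ne_zero two_ne_zero (pow_ne_zero 3 pi_ne_zero')) (density_ne_zero g z)

theorem trace_inv_stdForm_mul (s t : ℂ) (g : SL3) (z : C3) :
    ((stdForm.coeff g z)⁻¹ * (s • formA g z + t • formB g z)).trace =
      3 * Real.pi / 2 * (s + t) := by
  have e : stdForm.coeff g z =
      (Real.pi : ℂ)⁻¹ • ((1 : ℂ) • formA g z + (1 : ℂ) • formB g z) := by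
    rw [stdForm_coeff]
    simp [smul_add]
  have hd : IsUnit ((1 : ℂ) • formA g z + (1 : ℂ) • formB g z).det := by
    have := det_stdForm_ne_zero g z
    rw [e, Matrix.det_smul] at this
    exact IsUnit.mk0 _ (right_ne_zero_of_mul this)
  have h : (stdForm.coeff g z)⁻¹ =
      (Real.pi : ℂ) • ((1 : ℂ) • formA g z + (1 : ℂ) • formB g z)⁻¹ := by
    refine Matrix.inv_eq_left_inv ?_
    rw [e, Matrix.smul_mul, Matrix.mul_smul, Matrix.nonsing_inv_mul _ hd, smul_smul,
      mul_inv_cancel₀ pi_ne_zero', one_smul]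
  rw [h, Matrix.smul_mul, Matrix.trace_smul, trace_inv_comb_mul, smul_eq_mul]
  ring

section lineMetric
variable {r : ℕ} (w : Fin r → ℤ × ℤ) {i g : SL3} {z : C3}

/-- Relative to `stdForm` the summand of weight (s, t) has curvature eigenvalues πs, π(s+t)/2 and
πt; the diagonal entry is their sum. -/
theorem lineMetric_contraction (h : (chart g).symm z ∈ cell i) :
    (lineMetric w).contraction stdForm i g z = Matrix.diagonal fun a =>
      (3 * Real.pi / 2 * ((w a).1 + (w a).2) : ℂ) := by
  refine Eq.trans (b := ∑ j, ∑ k, (stdForm.coeff g z)⁻¹ k j • Matrix.diagonal fun a =>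
      ((w a).1 * formA g z j k + (w a).2 * formB g z j k : ℂ)) ?_ ?_
  · refine Finset.sum_congr rfl fun j _ => Finset.sum_congr rfl fun k _ => ?_
    exact congrArg (fun M : Matrix (Fin r) (Fin r) ℂ => (stdForm.coeff g z)⁻¹ k j • M)
      (lineMetric_curvature w h j k)
  · ext a b
    simp only [Matrix.sum_apply, Matrix.smul_apply]
    by_cases hab : a = b
    · subst hab
      simp only [Matrix.diagonal_apply_eq]
      rw [← trace_inv_stdForm_mul _ _ g z, Finset.sum_comm]
      simp [Matrix.trace, Matrix.mul_apply]
    · simp only [Matrix.diagonal_apply_ne _ hab]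
      simp

/-- On each summand the twisted form is (1/2π)((2+is)A + (2+it)B), whose cube is 6 times its
determinant; the constant is 6/(2π)³. -/
theorem lineMetric_twistedCube (h : (chart g).symm z ∈ cell i) :
    (lineMetric w).twistedCube stdForm i g z = Matrix.diagonal fun a =>
      (3 / (4 * Real.pi ^ 3) * ((2 + (w a).1 * Complex.I) * (2 + (w a).2 * Complex.I) *
        (4 + ((w a).1 + (w a).2) * Complex.I)) * density g z : ℂ) := by
  have e : (lineMetric w).twistedForm stdForm i g z = fun j k => Matrix.diagonal fun a =>
      ((1 / (2 * Real.pi) * (2 + (w a).1 * Complex.I)) • formA g z +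
        (1 / (2 * Real.pi) * (2 + (w a).2 * Complex.I)) • formB g z) j k := by
    funext j k
    refine Eq.trans (congrArg (fun M : Matrix (Fin r) (Fin r) ℂ =>
      stdForm.coeff g z j k • (1 : Matrix (Fin r) (Fin r) ℂ) + (Complex.I / (2 * Real.pi)) • M)
      (lineMetric_curvature w h j k)) ?_
    rw [stdForm_coeff]
    have := pi_ne_zero'
    ext a b
    by_cases hab : a = b
    · subst hab
      simp
      field_simp
      ring
    · simp [hab]
  refine (congrArg (fun M : Fin 3 → Fin 3 → Matrix (Fin r) (Fin r) ℂ => wedge3 M M M) e).trans ?_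
  refine (wedge3_diagonal fun a => ((1 / (2 * Real.pi) * (2 + (w a).1 * Complex.I)) • formA g z +
        (1 / (2 * Real.pi) * (2 + (w a).2 * Complex.I)) • formB g z)).trans ?_
  congr 1
  funext a
  have := pi_ne_zero'
  rw [wedge3_self, det_comb, density]
  field_simp
  ring

theorem lineMetric_degree_integrand (h : (chart g).symm z ∈ cell i) :
    wedge3 ((lineMetric w).chernForm i g z) (stdForm.coeff g z) (stdForm.coeff g z) =
      3 / (Real.pi : ℂ) ^ 3 * (∑ a, ((w a).1 + (w a).2 : ℂ)) * density g z := by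
  have e : (lineMetric w).chernForm i g z =
      ((∑ a, ((w a).1 : ℂ)) / (2 * Real.pi)) • formA g z +
        ((∑ a, ((w a).2 : ℂ)) / (2 * Real.pi)) • formB g z := by
    funext j k
    refine Eq.trans (congrArg (fun M : Matrix (Fin r) (Fin r) ℂ => M.trace / (2 * Real.pi : ℂ))
      (lineMetric_curvature w h j k)) ?_
    simp only [Matrix.trace_diagonal, Finset.sum_add_distrib, ← Finset.sum_mul, Matrix.add_apply,
      Matrix.smul_apply, smul_eq_mul]
    ring
  rw [e, wedge3_eq_trace_inv _ (det_stdForm_ne_zero g z), trace_inv_stdForm_mul, det_stdForm,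
    Finset.sum_add_distrib]
  have := pi_ne_zero'
  field_simp

end lineMetric

theorem imPart_diagonal {r : ℕ} (d t : Fin r → ℂ) (hd : ∀ a, d a ≠ 0) :
    HermitianMetric.imPart (Matrix.diagonal d) (Matrix.diagonal t) =
      Matrix.diagonal fun a => ((t a).im : ℂ) := by
  have e : (Matrix.diagonal d)⁻¹ = Matrix.diagonal fun a => (d a)⁻¹ := by
    refine Matrix.inv_eq_left_inv ?_
    rw [Matrix.diagonal_mul_diagonal]
    simp only [inv_mul_cancel₀ (hd _)]
    exact Matrix.diagonal_one
  rw [HermitianMetric.imPart, e, Matrix.diagonal_conjTranspose, Matrix.diagonal_mul_diagonal,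
    Matrix.diagonal_mul_diagonal]
  ext a b
  by_cases hab : a = b
  · subst hab
    have := hd a
    simp only [Matrix.smul_apply, Matrix.sub_apply, Matrix.diagonal_apply_eq, Pi.star_apply,
      smul_eq_mul]
    rw [mul_right_comm, inv_mul_cancel₀ this, one_mul]
    change 1 / (2 * Complex.I) * (t a - (starRingEnd ℂ) (t a)) = _
    rw [Complex.sub_conj]
    field_simp [Complex.I_ne_zero]
    push_cast
    ring
  · simp [hab]

open MeasureTheory

/-! ### The volume of the big cell -/

theorem integral_Ioi_mul_inv_pow {a b : ℝ} (ha : 0 < a) (hb : 0 < b) (n : ℕ) :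
    ∫ r in Set.Ioi (0 : ℝ), r * ((a * r ^ 2 + b) ^ (n + 2))⁻¹ =
      1 / (2 * (n + 1) * a * b ^ (n + 1)) := by
  have pos : ∀ r : ℝ, 0 < a * r ^ 2 + b := fun r => by positivity
  have hderiv : ∀ r ∈ Set.Ici (0 : ℝ),
      HasDerivAt (fun r : ℝ => -(1 / (2 * (n + 1) * a)) * ((a * r ^ 2 + b) ^ (n + 1))⁻¹)
        (r * ((a * r ^ 2 + b) ^ (n + 2))⁻¹) r := by
    intro r _
    have h1 : HasDerivAt (fun r : ℝ => a * r ^ 2 + b) (a * (2 * r)) r := by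
      simpa using ((hasDerivAt_pow 2 r).const_mul a).add_const b
    have h2 := ((h1.pow (n + 1)).inv (pow_ne_zero _ (pos r).ne')).const_mul (-(1 / (2 * (n + 1) * a)))
    refine h2.congr_deriv ?_
    have := (pos r).ne'
    simp only [Nat.add_sub_cancel, Pi.pow_apply]
    push_cast
    field_simp
    ring
  have hlim : Filter.Tendsto
      (fun r : ℝ => -(1 / (2 * (n + 1) * a)) * ((a * r ^ 2 + b) ^ (n + 1))⁻¹)
      Filter.atTop (nhds 0) := by
    have h1 : Filter.Tendsto (fun r : ℝ => a * r ^ 2 + b) Filter.atTop Filter.atTop :=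
      Filter.tendsto_atTop_add_const_right _ _
        ((Filter.tendsto_pow_atTop two_ne_zero).const_mul_atTop ha)
    have h2 := ((Filter.tendsto_pow_atTop (n := n + 1) (by simp)).comp h1).inv_tendsto_atTop
    simpa using h2.const_mul (-(1 / (2 * ((n : ℝ) + 1) * a)))
  rw [integral_Ioi_of_hasDerivAt_of_nonneg' hderiv
    (fun r hr => mul_nonneg (le_of_lt hr) (inv_nonneg.2 (pow_pos (pos r) _).le)) hlim]
  simp
  field_simp

theorem integral_inv_pow_normSq {a b : ℝ} (ha : 0 < a) (hb : 0 < b) (n : ℕ) :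
    ∫ z : ℂ, ((a * ‖z‖ ^ 2 + b) ^ (n + 2))⁻¹ = Real.pi / ((n + 1) * a * b ^ (n + 1)) := by
  rw [← Complex.integral_comp_polarCoord_symm]
  simp only [Complex.norm_polarCoord_symm, sq_abs, smul_eq_mul]
  have := setIntegral_prod_mul (μ := (volume : Measure ℝ)) (ν := (volume : Measure ℝ))
    (fun r : ℝ => r * ((a * r ^ 2 + b) ^ (n + 2))⁻¹) (fun _ => (1 : ℝ)) (Set.Ioi 0)
    (Set.Ioo (-Real.pi) Real.pi)
  simp only [mul_one] at this
  rw [show polarCoord.target = Set.Ioi (0 : ℝ) ×ˢ Set.Ioo (-Real.pi) Real.pi from rfl,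
    show (volume : Measure (ℝ × ℝ)) = volume.prod volume from rfl, this,
    integral_Ioi_mul_inv_pow ha hb]
  simp only [integral_const, MeasurableSet.univ, measureReal_restrict_apply, Set.univ_inter,
    Real.volume_real_Ioo, smul_eq_mul, mul_one]
  rw [max_eq_left (by linarith [Real.pi_pos])]
  field_simp
  ring

/-- The formula for the integral is proved without integrability, and it is positive, whereas the
integral of a non-integrable function is 0 by convention. -/
theorem integrable_inv_pow_normSq {a b : ℝ} (ha : 0 < a) (hb : 0 < b) (n : ℕ) :
    Integrable fun z : ℂ => ((a * ‖z‖ ^ 2 + b) ^ (n + 2))⁻¹ := by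
  by_contra h
  have h1 := integral_undef h
  rw [integral_inv_pow_normSq ha hb] at h1
  have := Real.pi_pos
  have : 0 < Real.pi / ((n + 1) * a * b ^ (n + 1)) := by positivity
  exact this.ne' h1

/-- Fubini's theorem for nonnegative continuous functions with integrable fibre integrals. -/
theorem integral_prod_of_nonneg {α β : Type*} [MeasureSpace α]
    [MeasureSpace β] [SFinite (volume : Measure α)] [SFinite (volume : Measure β)]
    {f : α × β → ℝ} (hf : AEStronglyMeasurable f (volume.prod volume)) (h0 : ∀ p, 0 ≤ f p)
    (h1 : ∀ y, Integrable fun x => f (x, y)) {G : β → ℝ} (hG : ∀ y, ∫ x, f (x, y) = G y)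
    (h2 : Integrable G) : ∫ p, f p = ∫ y, G y := by
  have hi : Integrable f (volume.prod volume) := by
    refine (integrable_prod_iff' hf).2 ⟨Filter.Eventually.of_forall h1, ?_⟩
    simp only [Real.norm_of_nonneg (h0 _), hG]
    exact h2
  rw [show (volume : Measure (α × β)) = volume.prod volume from rfl, integral_prod_symm f hi]
  simp only [hG]

/-- The density of the invariant volume as a function of `(z₂, (z₁, z₀))`. -/
def realDensity (z : ℂ × (ℂ × ℂ)) : ℝ :=
  ((1 + ‖z.2.2‖ ^ 2 + ‖z.2.1‖ ^ 2) ^ 2 *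
    (1 + ‖z.1‖ ^ 2 + ‖z.2.2 * z.1 - z.2.1‖ ^ 2) ^ 2)⁻¹

/-- As a function of z₂ the norm of the row vector is a quadratic polynomial. Completing the square
and translating brings the fibre integral to the rotationally symmetric case. -/
theorem complete_square (x y z : ℂ) : 1 + ‖z‖ ^ 2 + ‖x * z - y‖ ^ 2 =
    (1 + ‖x‖ ^ 2) * ‖z - star x * y / (1 + ‖x‖ ^ 2 : ℝ)‖ ^ 2 +
      (1 + ‖x‖ ^ 2 + ‖y‖ ^ 2) / (1 + ‖x‖ ^ 2) := by
  have ha : (1 + ‖x‖ ^ 2 : ℝ) ≠ 0 := by positivity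
  have e : ‖z - star x * y / (1 + ‖x‖ ^ 2 : ℝ)‖ ^ 2 =
      ‖(1 + ‖x‖ ^ 2 : ℝ) * z - star x * y‖ ^ 2 / (1 + ‖x‖ ^ 2) ^ 2 := by
    have : z - star x * y / (1 + ‖x‖ ^ 2 : ℝ) =
        ((1 + ‖x‖ ^ 2 : ℝ) * z - star x * y) / (1 + ‖x‖ ^ 2 : ℝ) := by
      have : ((1 + ‖x‖ ^ 2 : ℝ) : ℂ) ≠ 0 := by exact_mod_cast ha
      field_simp
    rw [this, norm_div, div_pow, Complex.norm_real, Real.norm_of_nonneg (by positivity)]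
  rw [e]
  have hx := ha
  simp only [Complex.sq_norm, Complex.normSq_apply] at hx ⊢
  simp
  field_simp
  ring

theorem integral_fibre_realDensity (p : ℂ × ℂ) :
    (Integrable fun z => realDensity (z, p)) ∧
      ∫ z, realDensity (z, p) = Real.pi * ((1 * ‖p.1‖ ^ 2 + (1 + ‖p.2‖ ^ 2)) ^ (1 + 2))⁻¹ := by
  obtain ⟨y, x⟩ := p
  have ha : (0 : ℝ) < 1 + ‖x‖ ^ 2 := by positivity
  have hn : (0 : ℝ) < 1 + ‖x‖ ^ 2 + ‖y‖ ^ 2 := by positivity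
  have e : (fun z => realDensity (z, (y, x))) = fun z : ℂ =>
      ((1 + ‖x‖ ^ 2 + ‖y‖ ^ 2) ^ 2)⁻¹ * (fun z : ℂ => (((1 + ‖x‖ ^ 2) * ‖z‖ ^ 2 +
        (1 + ‖x‖ ^ 2 + ‖y‖ ^ 2) / (1 + ‖x‖ ^ 2)) ^ (0 + 2))⁻¹)
          (z - star x * y / (1 + ‖x‖ ^ 2 : ℝ)) := by
    funext z
    rw [realDensity, complete_square x y z, mul_inv]
  have hi := integrable_inv_pow_normSq ha (div_pos hn ha) 0
  rw [e]
  constructor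
  · exact (hi.comp_sub_right _).const_mul _
  -- With a = 1+|x|² and n = a+|y|², the constant term is n/a, so the fibre integral is π / (n² · a
  -- · (n/a)) = π/n³.
  · rw [integral_const_mul, integral_sub_right_eq_self (fun z : ℂ => (((1 + ‖x‖ ^ 2) * ‖z‖ ^ 2 +
        (1 + ‖x‖ ^ 2 + ‖y‖ ^ 2) / (1 + ‖x‖ ^ 2)) ^ (0 + 2))⁻¹),
      integral_inv_pow_normSq ha (div_pos hn ha)]
    have e3 : 1 * ‖y‖ ^ 2 + (1 + ‖x‖ ^ 2) = 1 + ‖x‖ ^ 2 + ‖y‖ ^ 2 := by ring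
    simp only [e3]
    norm_num
    field_simp

theorem integral_realDensity : ∫ z, realDensity z = Real.pi ^ 3 / 2 := by
  have ha : ∀ x : ℂ, (0 : ℝ) < 1 + ‖x‖ ^ 2 := fun x => by positivity
  have hG1 : ∀ x : ℂ, ∫ y : ℂ, Real.pi * ((1 * ‖y‖ ^ 2 + (1 + ‖x‖ ^ 2)) ^ (1 + 2))⁻¹ =
      Real.pi ^ 2 / 2 * ((1 * ‖x‖ ^ 2 + 1) ^ (0 + 2))⁻¹ := by
    intro x
    rw [integral_const_mul, integral_inv_pow_normSq one_pos (ha x)]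
    have := (ha x).ne'
    rw [one_mul, add_comm (‖x‖ ^ 2)]
    push_cast
    field_simp
    ring
  have c1 : Continuous fun p : ℂ × ℂ =>
      Real.pi * ((1 * ‖p.1‖ ^ 2 + (1 + ‖p.2‖ ^ 2)) ^ (1 + 2))⁻¹ := by
    refine continuous_const.mul (Continuous.inv₀ (by fun_prop) fun p => ?_)
    positivity
  have c2 : Continuous realDensity := by
    unfold realDensity
    refine Continuous.inv₀ (by fun_prop) fun p => ?_
    positivity
  have i1 : ∀ x : ℂ, Integrable fun y : ℂ =>
      Real.pi * ((1 * ‖y‖ ^ 2 + (1 + ‖x‖ ^ 2)) ^ (1 + 2))⁻¹ := fun x =>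
    (integrable_inv_pow_normSq one_pos (ha x) 1).const_mul _
  have i2 : Integrable fun x : ℂ => Real.pi ^ 2 / 2 * ((1 * ‖x‖ ^ 2 + 1) ^ (0 + 2))⁻¹ :=
    (integrable_inv_pow_normSq one_pos one_pos 0).const_mul _
  have n1 : ∀ p : ℂ × ℂ, 0 ≤ Real.pi * ((1 * ‖p.1‖ ^ 2 + (1 + ‖p.2‖ ^ 2)) ^ (1 + 2))⁻¹ := by
    intro p
    positivity
  have i3 : Integrable (fun p : ℂ × ℂ =>
      Real.pi * ((1 * ‖p.1‖ ^ 2 + (1 + ‖p.2‖ ^ 2)) ^ (1 + 2))⁻¹) (volume.prod volume) := by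
    refine (integrable_prod_iff' c1.aestronglyMeasurable).2 ⟨Filter.Eventually.of_forall i1, ?_⟩
    simp only [Real.norm_of_nonneg (n1 (_, _)), hG1]
    exact i2
  -- The variables are integrated in the order z₂, z₁, z₀, each integration contributing a factor π
  -- and the second one also a factor 1/2.
  rw [integral_prod_of_nonneg c2.aestronglyMeasurable
    (fun p => by unfold realDensity; positivity) (fun p => (integral_fibre_realDensity p).1)
    (fun p => (integral_fibre_realDensity p).2) i3,
    integral_prod_of_nonneg c1.aestronglyMeasurable n1 i1 hG1 i2, integral_const_mul,
    integral_inv_pow_normSq one_pos one_pos]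
  norm_num
  ring

theorem density_one_eq (z : C3) : density 1 z = (realDensity (z 2, (z 1, z 0)) : ℂ) := by
  rw [density, colNorm, rowNorm, colVec_one, rowVec_one, realDensity]
  simp only [Complex.sq_norm]
  push_cast
  simp only [Complex.normSq_eq_conj_mul_self]
  simp [dotProduct, Fin.sum_univ_three]
  ring

theorem integral_density : ∫ z : C3, density 1 z = (Real.pi : ℂ) ^ 3 / 2 := by
  simp only [density_one_eq]
  rw [integral_complex_ofReal]
  have e1 := (volume_preserving_piFinSuccAbove (fun _ : Fin 3 => ℂ) 2).integral_comp'
    (g := fun p : ℂ × (Fin 2 → ℂ) => realDensity (p.1, (p.2 1, p.2 0)))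
  have e2 := ((MeasurePreserving.id (volume : Measure ℂ)).prod
    ((volume_preserving_finTwoArrow ℂ))).integral_comp
      ((MeasurableEquiv.refl ℂ).prodCongr MeasurableEquiv.finTwoArrow).measurableEmbedding
    (fun p : ℂ × (ℂ × ℂ) => realDensity (p.1, (p.2.2, p.2.1)))
  have e3 := ((MeasurePreserving.id (volume : Measure ℂ)).prod
    (Measure.measurePreserving_swap (μ := (volume : Measure ℂ)) (ν := (volume : Measure ℂ)))).integral_comp
      ((MeasurableEquiv.refl ℂ).prodCongr MeasurableEquiv.prodComm).measurableEmbedding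
    realDensity
  have : ∫ z : C3, realDensity (z 2, (z 1, z 0)) = Real.pi ^ 3 / 2 := by
    rw [← integral_realDensity]
    exact e1.trans (e2.trans e3)
  rw [this]
  push_cast
  ring

/-! ### Hermitian Yang–Mills and deformed Hermitian Yang–Mills equations -/

theorem smul_diagonal {r : ℕ} (c : ℂ) (d : Fin r → ℂ) :
    c • Matrix.diagonal d = Matrix.diagonal fun a => c * d a := by
  ext a b
  by_cases hab : a = b
  · subst hab
    simp
  · simp [hab]

theorem smul_one_apply_self {r : ℕ} (c : ℂ) (a : Fin r) :
    (c • (1 : Matrix (Fin r) (Fin r) ℂ)) a a = c := by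
  simp

section lineMetric
variable {r : ℕ} (w : Fin r → ℤ × ℤ)

/-- With slope 12n, the prescribed constant (π/8)·12n is exactly the common eigenvalue 3πn/2 of the
contraction. -/
theorem lineMetric_isHYM {n : ℤ} (h : ∀ a, (w a).1 + (w a).2 = n) {μ : ℝ} (hμ : μ = 12 * n) :
    (lineMetric w).IsHYM stdForm (Real.pi / 8 * μ) := by
  intro i g z hz
  refine (lineMetric_contraction w hz).trans ?_
  have e : (fun a => (3 * Real.pi / 2 * ((w a).1 + (w a).2) : ℂ)) =
      fun _ : Fin r => ((Real.pi / 8 * μ : ℝ) : ℂ) := by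
    funext a
    rw [← Int.cast_add, h a, hμ]
    push_cast
    ring
  rw [e, Matrix.smul_one_eq_diagonal]
  rfl

theorem lineMetric_not_isHYM {a b : Fin r} (h : (w a).1 + (w a).2 ≠ (w b).1 + (w b).2) (c : ℝ) :
    ¬ (lineMetric w).IsHYM stdForm c := by
  intro hc
  have h1 : (chart 1).symm (0 : C3) ∈ cell 1 := (chart 1).map_target (Set.mem_univ _)
  have e := (lineMetric_contraction w h1).symm.trans (hc (1 : SL3) 1 0 h1)
  have key : ∀ a, (3 * Real.pi / 2 * ((w a).1 + (w a).2) : ℂ) = c := by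
    intro a
    have := congrFun (congrFun e a) a
    rw [Matrix.diagonal_apply_eq] at this
    exact this.trans (smul_one_apply_self (c : ℂ) a)
  have h2 := (key a).trans (key b).symm
  have h3 : (3 * Real.pi / 2 : ℂ) ≠ 0 := by
    have := pi_ne_zero'
    simp [this]
  have h4 := mul_left_cancel₀ h3 h2
  exact h (by exact_mod_cast h4)

/-- The phase factor of the line bundle of weight `w`. -/
def phase (w : ℤ × ℤ) : ℂ :=
  (2 + w.1 * Complex.I) * (2 + w.2 * Complex.I) * (4 + (w.1 + w.2) * Complex.I)

theorem mem_cell_indexAt (x : X) : x ∈ cell ((lineSum w).core.indexAt x) :=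
  (lineSum w).core.mem_baseSet_at x

theorem lineMetric_phaseIntegral :
    (lineMetric w).phaseIntegral stdForm = 3 * ∑ a, phase (w a) := by
  have e : ∀ z, ((lineMetric w).twistedCube stdForm
      ((lineSum w).core.indexAt ((chart 1).symm z)) 1 z).trace =
      3 / (4 * Real.pi ^ 3) * (∑ a, phase (w a)) * density 1 z := by
    intro z
    refine (congrArg Matrix.trace
      (lineMetric_twistedCube w (mem_cell_indexAt w ((chart 1).symm z)))).trans ?_
    refine (Matrix.trace_diagonal _).trans ?_
    rw [Finset.mul_sum, Finset.sum_mul]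
    rfl
  rw [HermitianMetric.phaseIntegral, integralX]
  simp only [e]
  -- The factor is 8 · 3/(4π³) · π³/2 = 3.
  rw [integral_const_mul, integral_const_mul, integral_density]
  have := pi_ne_zero'
  field_simp
  ring

theorem lineMetric_degree :
    (lineMetric w).degree stdForm = 12 * ∑ a, ((w a).1 + (w a).2 : ℂ) := by
  have e : ∀ z, wedge3 ((lineMetric w).chernForm ((lineSum w).core.indexAt ((chart 1).symm z)) 1 z)
      (stdForm.coeff 1 z) (stdForm.coeff 1 z) =
      3 / (Real.pi : ℂ) ^ 3 * (∑ a, ((w a).1 + (w a).2 : ℂ)) * density 1 z := fun z =>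
    lineMetric_degree_integrand w (mem_cell_indexAt w ((chart 1).symm z))
  rw [HermitianMetric.degree, integralX]
  simp only [e]
  -- The factor is 8 · 3/π³ · π³/2 = 12.
  rw [integral_const_mul, integral_const_mul, integral_density]
  have := pi_ne_zero'
  field_simp
  ring

theorem hasSlope_lineSum (hr : r ≠ 0) {μ : ℝ} (hμ : μ * r = 12 * ∑ a, ((w a).1 + (w a).2 : ℝ)) :
    HasSlope stdForm (lineSum w) μ := by
  refine ⟨lineMetric w, ?_⟩
  rw [lineMetric_degree]
  have : ((lineSum w).rank : ℂ) = r := rfl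
  rw [this, eq_div_iff (by exact_mod_cast hr)]
  exact_mod_cast hμ

theorem density_one_zero : density 1 0 = 1 := by
  rw [density, colNorm, rowNorm, colVec_one, rowVec_one]
  simp [dotProduct, Fin.sum_univ_three]

theorem density_real (g : SL3) (z : C3) : ∃ d : ℝ, density g z = d := by
  have h : 0 < density g z :=
    inv_pos.2 (mul_pos (pow_pos (colNorm_pos g z) 2) (pow_pos (rowNorm_pos g z) 2))
  exact ⟨(density g z).re, Complex.ext rfl (Complex.pos_iff.1 h).2.symm⟩

theorem imPart_lineMetric {i g : SL3} {z : C3} (h : (chart g).symm z ∈ cell i) (θ : ℝ) :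
    HermitianMetric.imPart ((lineMetric w).localMat i g z)
      (Complex.exp (-Complex.I * θ) • (lineMetric w).twistedCube stdForm i g z) =
    Matrix.diagonal fun a => ((Complex.exp (-Complex.I * θ) *
      (3 / (4 * Real.pi ^ 3) * phase (w a) * density g z)).im : ℂ) := by
  refine Eq.trans (congrArg₂ HermitianMetric.imPart (lineMetric_localMat w i g z)
    (congrArg _ (lineMetric_twistedCube w h))) ?_
  have e := imPart_diagonal (fun k => weight (w k) (localSection i ((chart g).symm z)) 0)
    (fun a => Complex.exp (-Complex.I * θ) * (3 / (4 * Real.pi ^ 3) * phase (w a) * density g z))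
    fun _ => weight_ne_zero _ _ _
  refine Eq.trans (congrArg (HermitianMetric.imPart (r := r) _)
    ((smul_diagonal (r := r) _ _).trans ?_)) e
  rfl

/-- The position on the threefold enters the cube only through the real density, so the equation
reduces to one condition on each phase. Conversely that condition is read off at the origin, where
the density is 1. -/
theorem lineMetric_isDHYM_iff (θ : ℝ) : (lineMetric w).IsDHYM stdForm θ ↔
    ∀ a, (Complex.exp (-Complex.I * θ) * phase (w a)).im = 0 := by
  have hp := Real.pi_pos
  have e : ∀ {a} {d : ℝ}, (Complex.exp (-Complex.I * θ) *
      (3 / (4 * Real.pi ^ 3) * phase (w a) * d)).im =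
      3 / (4 * Real.pi ^ 3) * d * (Complex.exp (-Complex.I * θ) * phase (w a)).im := by
    intro a d
    have : Complex.exp (-Complex.I * θ) * (3 / (4 * Real.pi ^ 3) * phase (w a) * d) =
        ((3 / (4 * Real.pi ^ 3) * d : ℝ) : ℂ) * (Complex.exp (-Complex.I * θ) * phase (w a)) := by
      push_cast
      ring
    rw [this, Complex.im_ofReal_mul]
  constructor
  · intro h a
    have h1 : (chart 1).symm (0 : C3) ∈ cell 1 := (chart 1).map_target (Set.mem_univ _)
    have h2 := (imPart_lineMetric w h1 θ).symm.trans (h (1 : SL3) 1 0 h1)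
    have h3 := (Matrix.diagonal_apply_eq (n := Fin r) _ a).symm.trans (congrFun (congrFun h2 a) a)
    change _ = (0 : ℂ) at h3
    rw [density_one_zero, ← Complex.ofReal_one, e] at h3
    have h4 : (3 / (4 * Real.pi ^ 3) * 1 * (Complex.exp (-Complex.I * θ) * phase (w a)).im : ℝ) = 0 := by
      exact_mod_cast h3
    have h5 : 3 / (4 * Real.pi ^ 3) * 1 ≠ 0 := by positivity
    exact (mul_eq_zero.1 h4).resolve_left h5
  · intro h i g z hz
    refine (imPart_lineMetric w hz θ).trans ?_
    obtain ⟨d, hd⟩ := density_real g z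
    refine (congrArg (Matrix.diagonal (n := Fin r)) (funext fun a => ?_)).trans
      (Matrix.diagonal_zero (n := Fin r) (α := ℂ))
    rw [hd, e, h, mul_zero, Complex.ofReal_zero]

end lineMetric

theorem exp_neg_arg_mul (c : ℂ) : Complex.exp (-Complex.I * c.arg) * c = ‖c‖ := by
  nth_rewrite 2 [← Complex.norm_mul_exp_arg_mul_I c]
  rw [mul_left_comm, ← Complex.exp_add]
  ring_nf
  simp

/-! ### The first Chern form of a rank three metric -/

theorem ContDiffAt.dz {f : C3 → ℂ} {z : C3} (h : ContDiffAt ℝ ∞ f z) (j : Fin 3) :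
    ContDiffAt ℝ ∞ (dz j f) z := by
  have h1 : ContDiffAt ℝ ∞ (fderiv ℝ f) z := h.fderiv_right (by simp)
  exact contDiffAt_const.mul ((h1.clm_apply contDiffAt_const).sub
    (contDiffAt_const.mul (h1.clm_apply contDiffAt_const)))

theorem ContDiffAt.dzbar {f : C3 → ℂ} {z : C3} (h : ContDiffAt ℝ ∞ f z) (j : Fin 3) :
    ContDiffAt ℝ ∞ (dzbar j f) z := by
  have h1 : ContDiffAt ℝ ∞ (fderiv ℝ f) z := h.fderiv_right (by simp)
  exact contDiffAt_const.mul ((h1.clm_apply contDiffAt_const).add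
    (contDiffAt_const.mul (h1.clm_apply contDiffAt_const)))

theorem contDiffAt_div_real {f g : C3 → ℂ} {z : C3} (hf : ContDiffAt ℝ ∞ f z)
    (hg : ContDiffAt ℝ ∞ g z) (h0 : g z ≠ 0) : ContDiffAt ℝ ∞ (fun w => f w / g w) z := by
  simp only [div_eq_mul_inv]
  exact hf.mul (hg.inv h0)

section
variable {M : C3 → Matrix (Fin 3) (Fin 3) ℂ} {z : C3}

theorem contDiffAt_det (hM : ∀ a b, ContDiffAt ℝ ∞ (fun y => M y a b) z) :
    ContDiffAt ℝ ∞ (fun y => (M y).det) z := by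
  simp only [Matrix.det_fin_three]
  exact ((((((hM 0 0).mul (hM 1 1)).mul (hM 2 2)).sub (((hM 0 0).mul (hM 1 2)).mul (hM 2 1))).sub
    (((hM 0 1).mul (hM 1 0)).mul (hM 2 2))).add (((hM 0 1).mul (hM 1 2)).mul (hM 2 0))).add
    (((hM 0 2).mul (hM 1 0)).mul (hM 2 1)) |>.sub (((hM 0 2).mul (hM 1 1)).mul (hM 2 0))

theorem contDiffAt_inv_apply (hM : ∀ a b, ContDiffAt ℝ ∞ (fun y => M y a b) z)
    (h0 : (M z).det ≠ 0) (a b : Fin 3) : ContDiffAt ℝ ∞ (fun y => (M y)⁻¹ a b) z := by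
  simp only [Matrix.inv_def, Matrix.smul_apply, Ring.inverse_eq_inv', smul_eq_mul]
  refine ((contDiffAt_det hM).inv h0).mul ?_
  simp only [Matrix.adjugate_fin_three]
  fin_cases a <;> fin_cases b <;> simp
  all_goals
    first
    | exact ((hM _ _).mul (hM _ _)).sub ((hM _ _).mul (hM _ _))
    | exact ((hM _ _).mul (hM _ _)).neg.add ((hM _ _).mul (hM _ _))

/-- Jacobi's formula. -/
theorem trace_inv_mul_dz (hM : ∀ a b, DifferentiableAt ℝ (fun y => M y a b) z) (j : Fin 3) :
    ((M z)⁻¹ * Matrix.of fun a b => dz j (fun y => M y a b) z).trace =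
      dz j (fun y => (M y).det) z / (M z).det := by
  have w := fun a b => hasWirt_of_differentiableAt (hM a b)
  have hd : dz j (fun y => (M y).det) z =
      ((M z).adjugate * Matrix.of fun a b => dz j (fun y => M y a b) z).trace := by
    simp only [Matrix.det_fin_three]
    rw [((((((((w 0 0).mul (w 1 1)).mul (w 2 2)).sub (((w 0 0).mul (w 1 2)).mul (w 2 1))).sub
      (((w 0 1).mul (w 1 0)).mul (w 2 2))).add (((w 0 1).mul (w 1 2)).mul (w 2 0))).add
      (((w 0 2).mul (w 1 0)).mul (w 2 1))).sub (((w 0 2).mul (w 1 1)).mul (w 2 0))).dz_eq j]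
    simp only [Matrix.trace_fin_three, Matrix.mul_apply, Fin.sum_univ_three, Matrix.adjugate_fin_three,
      Matrix.of_apply, Matrix.cons_val', Matrix.cons_val]
    ring
  rw [hd, Matrix.inv_def, Matrix.smul_mul, Matrix.trace_smul, Ring.inverse_eq_inv', smul_eq_mul,
    div_eq_inv_mul]

/-- Trace commutes with ∂̄, and by Jacobi's formula the trace of H⁻¹∂H is ∂ log det H. The first
Chern form therefore depends only on the determinant of the metric. -/
theorem trace_curvature_eq_logCurv (hM : ∀ᶠ y in nhds z, ∀ a b, ContDiffAt ℝ ∞ (fun y => M y a b) y)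
    (h0 : (M z).det ≠ 0) (j k : Fin 3) :
    (Matrix.of fun a b => -dzbar k (fun y => ((M y)⁻¹ *
      Matrix.of fun a b => dz j (fun y' => M y' a b) y) a b) z).trace =
      logCurv (fun y => (M y).det) z j k := by
  have hMz := hM.self_of_nhds
  have hdiff : ∀ a b, DifferentiableAt ℝ (fun y => ((M y)⁻¹ *
      Matrix.of fun a b => dz j (fun y' => M y' a b) y) a b) z := by
    intro a b
    simp only [Matrix.mul_apply, Matrix.of_apply]
    exact (ContDiffAt.sum fun c _ => (contDiffAt_inv_apply hMz h0 a c).mul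
      (ContDiffAt.dz (hMz c b) j)).differentiableAt (by simp)
  have w := fun a => hasWirt_of_differentiableAt (hdiff a a)
  have h1 := (HasWirt.sum Finset.univ fun a _ => w a).dzbar_eq k
  have ev : (fun y => dz j (fun y => (M y).det) y / (M y).det) =ᶠ[nhds z] fun y =>
      ∑ a, ((M y)⁻¹ * Matrix.of fun a b => dz j (fun y' => M y' a b) y) a a := by
    filter_upwards [hM] with y hy
    exact (trace_inv_mul_dz (fun a b => (hy a b).differentiableAt (by simp)) j).symm
  rw [logCurv, dzbar_congr ev, h1, Matrix.trace, ← Finset.sum_neg_distrib]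
  rfl

end

theorem contDiffAt_localMat (h : HermitianMetric tangentHolBundle) (i : atlas C3 X) {g : SL3}
    {z : C3} (hz : (chart g).symm z ∈ tangentHolBundle.core.baseSet i) (a b : Fin 3) :
    ContDiffAt ℝ ∞ (fun y => h.localMat i g y a b) z := by
  have h1 : ContMDiffOn 𝓘(ℝ, C3) 𝓘(ℝ, C3) ω (chart g).symm (chart g).target :=
    contMDiffOn_symm_of_mem_maximalAtlas (IsManifold.subset_maximalAtlas ⟨g, rfl⟩)
  have h2 : ContMDiffOn 𝓘(ℝ, C3) 𝓘(ℝ, C3) ∞ (chart g).symm (chart g).target :=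
    h1.of_le (by exact_mod_cast le_top)
  have h3 : ContMDiffAt 𝓘(ℝ, C3) 𝓘(ℝ, C3) ∞ (chart g).symm z :=
    h2.contMDiffAt ((chart g).open_target.mem_nhds (Set.mem_univ z))
  have h4 := (h.smooth i a b).contMDiffAt
    ((tangentHolBundle.core.isOpen_baseSet i).mem_nhds hz)
  exact (ContMDiffAt.comp z h4 h3).contDiffAt

theorem eventually_mem_baseSet (i : atlas C3 X) {g : SL3}
    {z : C3} (hz : (chart g).symm z ∈ tangentHolBundle.core.baseSet i) :
    ∀ᶠ y in nhds z, (chart g).symm y ∈ tangentHolBundle.core.baseSet i :=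
  ((chart g).continuousAt_symm (Set.mem_univ z)).preimage_mem_nhds
    ((tangentHolBundle.core.isOpen_baseSet i).mem_nhds hz)

theorem det_localMat_pos (h : HermitianMetric tangentHolBundle) (i : atlas C3 X) {g : SL3}
    {z : C3} (hz : (chart g).symm z ∈ tangentHolBundle.core.baseSet i) :
    0 < (h.localMat i g z).det := (h.posDef i _ hz).det_pos

theorem chernForm_eq_logCurv (h : HermitianMetric tangentHolBundle) (i : atlas C3 X) {g : SL3}
    {z : C3} (hz : (chart g).symm z ∈ tangentHolBundle.core.baseSet i) (j k : Fin 3) :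
    h.chernForm i g z j k = logCurv (fun y => (h.localMat i g y).det) z j k / (2 * Real.pi) := by
  have := trace_curvature_eq_logCurv (M := fun y => h.localMat i g y) (z := z)
    ((eventually_mem_baseSet i hz).mono fun y hy => contDiffAt_localMat h i hy)
    (det_localMat_pos h i hz).ne' j k
  exact congrArg (fun t : ℂ => t / (2 * Real.pi)) this

/-! ### The Kähler form represents the first Chern class -/

theorem tangent_coordChange (i j : atlas C3 X) {g g' : SL3} (hi : i.1 = chart g)
    (hj : j.1 = chart g') (x : X) :
    LinearMap.toMatrix' (tangentHolBundle.core.coordChange i j x).toLinearMap =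
      jac 1 g g' (chart g x) := by
  have e : tangentHolBundle.core.coordChange i j x = fderiv ℂ (coordMap 1 g g') (chart g x) := by
    have e1 : tangentHolBundle.core.coordChange i j x =
      fderivWithin ℂ (j.1.extend 𝓘(ℂ, C3) ∘ (i.1.extend 𝓘(ℂ, C3)).symm) (Set.range 𝓘(ℂ, C3))
        (i.1.extend 𝓘(ℂ, C3) x) := rfl
    rw [e1, hi, hj]
    have e2 : coordMap 1 g g' = chart g' ∘ (chart g).symm := by
      funext z
      rw [coordMap, one_smul]
      rfl
    rw [e2]
    simp
    rfl
  exact congrArg (fun L : (Fin 3 → ℂ) →L[ℂ] (Fin 3 → ℂ) => LinearMap.toMatrix' L.toLinearMap) e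

/-- The index of a chart in the atlas. -/
def chartIndex (i : atlas C3 X) : SL3 := Classical.choose i.2

theorem chart_chartIndex (i : atlas C3 X) : chart (chartIndex i) = i.1 := Classical.choose_spec i.2

theorem mem_baseSet_iff (i : atlas C3 X) {g : SL3} (hi : i.1 = chart g) (x : X) :
    x ∈ tangentHolBundle.core.baseSet i ↔ x ∈ cell g := by
  change x ∈ i.1.source ↔ _
  rw [hi]
  rfl

/-- The transpose reconciles two conventions: a form coefficient carries the conjugate on its second
index, the metric vᴴHw on its first. -/
theorem stdForm_transpose_compat {g g' : SL3} {x : X} (hx : x ∈ cell g) (hx' : x ∈ cell g') :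
    (stdForm.coeff g (chart g x))ᵀ = (jac 1 g g' (chart g x))ᴴ *
      (stdForm.coeff g' (chart g' x))ᵀ * jac 1 g g' (chart g x) := by
  have e : (chart g).symm (chart g x) = x := (chart g).left_inv hx
  have := stdForm.compat g g' (chart g x) (by rw [e]; exact hx')
  rw [this, coordMap, one_smul, e, Matrix.transpose_mul, Matrix.transpose_mul,
    Matrix.transpose_transpose, mul_assoc]
  rfl

/-- The Hermitian metric on the tangent bundle given by the Kähler form. -/
def tangentMetric : HermitianMetric tangentHolBundle where
  mat i x := (stdForm.coeff (chartIndex i) (chart (chartIndex i) x))ᵀ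
  posDef i x _ := (stdForm_isKahler.1 _ _).transpose
  smooth i a b := by
    have hs : tangentHolBundle.core.baseSet i = cell (chartIndex i) :=
      Set.ext fun x => mem_baseSet_iff i (chart_chartIndex i).symm x
    rw [hs]
    exact (stdForm.smooth (chartIndex i) b a).contMDiff.comp_contMDiffOn
      ((contMDiffOn_chart_real (chartIndex i)).of_le (by exact_mod_cast le_top))
  compat i j x hx := by
    have e := tangent_coordChange i j (chart_chartIndex i).symm (chart_chartIndex j).symm x
    refine Eq.trans ?_ (congrArg (fun M : Matrix (Fin 3) (Fin 3) ℂ => Mᴴ *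
      (stdForm.coeff (chartIndex j) (chart (chartIndex j) x))ᵀ * M) e).symm
    exact stdForm_transpose_compat ((mem_baseSet_iff i (chart_chartIndex i).symm x).1 hx.1)
      ((mem_baseSet_iff j (chart_chartIndex j).symm x).1 hx.2)

theorem density_eq_weight (g : SL3) (z : C3) : density g z = weight (2, 2) g z := by
  rw [density, weight]
  simp only [mul_inv, zpow_neg]
  norm_cast

/-- This is the Kähler–Einstein property. The determinant is a constant times the metric of weight
(2, 2), so the Chern form is (2A + 2B)/2π, which is the Kähler form itself. -/
theorem tangentMetric_chernForm (i : atlas C3 X) {g : SL3} {z : C3}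
    (hz : (chart g).symm z ∈ tangentHolBundle.core.baseSet i) (j k : Fin 3) :
    tangentMetric.chernForm i g z j k = stdForm.coeff g z j k := by
  have hc : (chart g).symm z ∈ cell (chartIndex i) :=
    (mem_baseSet_iff i (chart_chartIndex i).symm _).1 hz
  have e : (fun y => (tangentMetric.localMat i g y).det) = fun y => 2 / (Real.pi : ℂ) ^ 3 *
      weight (2, 2) (localSection (chartIndex i) ((chart g).symm y)) 0 := by
    funext y
    refine (Matrix.det_transpose (n := Fin 3) _).trans ?_
    rw [det_stdForm, weight_localSection, density_eq_weight]
  have hc0 : 2 / (Real.pi : ℂ) ^ 3 ≠ 0 := div_ne_zero two_ne_zero (pow_ne_zero 3 pi_ne_zero')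
  rw [chernForm_eq_logCurv _ i hz, e, logCurv_weight_localSection (2, 2) hc hc0, stdForm_coeff]
  have := pi_ne_zero'
  simp
  field_simp

theorem stdForm_representsC1 : stdForm.RepresentsC1 tangentHolBundle := by
  -- The two forms agree pointwise, so the zero 1-form serves as primitive.
  refine ⟨tangentMetric, ⟨0, fun _ _ => contDiff_const, fun _ _ _ _ => by simp⟩, ?_⟩
  intro i g z hz j k
  rw [tangentMetric_chernForm i hz]
  have h0 := hasWirt_const 0 z
  constructor
  · rw [RealOneForm.d11]
    simp [h0.dz_eq, h0.dzbar_eq]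
  · rw [RealOneForm.d20]
    simp [h0.dz_eq]

/-! ### Stokes' theorem on projective lines -/

/-- The closed square with centre `0` and half side `R`. -/
def square (R : ℝ) : Set ℂ := Set.Icc (-R) R ×ℂ Set.Icc (-R) R

theorem isCompact_square (R : ℝ) : IsCompact (square R) := isCompact_Icc.reProdIm isCompact_Icc

theorem integral_square {R : ℝ} (hR : 0 ≤ R) {f : ℂ → ℂ} (hf : Continuous f) :
    ∫ z in square R, f z = ∫ x : ℝ in (-R)..R, ∫ y : ℝ in (-R)..R, f (x + y * Complex.I) := by
  have h : -R ≤ R := by linarith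
  have e : Complex.measurableEquivRealProd.symm ⁻¹' square R =
      Set.Icc (-R) R ×ˢ Set.Icc (-R) R := by
    ext p
    simp only [square, Set.mem_preimage, Complex.mem_reProdIm, Set.mem_prod]
    rfl
  have e2 : ∀ p : ℝ × ℝ, Complex.measurableEquivRealProd.symm p = p.1 + p.2 * Complex.I := by
    intro p
    apply Complex.ext <;> simp
  rw [← Complex.volume_preserving_equiv_real_prod.symm.setIntegral_preimage_emb
    Complex.measurableEquivRealProd.symm.measurableEmbedding, e]
  simp only [e2]
  rw [show (volume : Measure (ℝ × ℝ)) = volume.prod volume from rfl, setIntegral_prod]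
  · simp only [intervalIntegral.integral_of_le h, integral_Icc_eq_integral_Ioc]
  · refine ContinuousOn.integrableOn_compact (isCompact_Icc.prod isCompact_Icc) ?_
    exact (hf.comp (by fun_prop)).continuousOn

/-- Green's theorem for functions with quadratic decay. -/
theorem norm_integral_square_le {F : ℂ → ℂ} (hF : ContDiff ℝ 1 F) {C : ℝ}
    (hC : ∀ z, 1 ≤ ‖z‖ → ‖F z‖ ≤ C / ‖z‖ ^ 2) {R : ℝ} (hR : 1 ≤ R) :
    ‖∫ z in square R, (Complex.I • fderiv ℝ F z 1 - fderiv ℝ F z Complex.I)‖ ≤ 8 * C / R := by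
  have hR0 : 0 < R := by linarith
  have hcont : Continuous fun z => Complex.I • fderiv ℝ F z 1 - fderiv ℝ F z Complex.I := by
    have := hF.continuous_fderiv (by simp)
    fun_prop
  have hC0 : 0 ≤ C := by
    have := (norm_nonneg _).trans (hC 1 (by simp))
    simpa using this
  have green := Complex.integral_boundary_rect_of_differentiableOn_real F (-R - R * Complex.I)
    (R + R * Complex.I) (hF.differentiable (by simp)).differentiableOn
    (hcont.continuousOn.integrableOn_compact (isCompact_uIcc.reProdIm isCompact_uIcc))
  simp only [Complex.sub_re, Complex.neg_re, Complex.ofReal_re, Complex.mul_re, Complex.I_re,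
    mul_zero, Complex.ofReal_im, Complex.I_im, mul_one, sub_self, sub_zero, Complex.add_re,
    add_zero, Complex.sub_im, Complex.neg_im, Complex.mul_im, Complex.add_im, zero_add, neg_zero,
    zero_sub] at green
  rw [integral_square hR0.le hcont, ← green]
  have bound : ∀ z : ℂ, R ≤ ‖z‖ → ‖F z‖ ≤ C / R ^ 2 := by
    intro z hz
    refine (hC z (hR.trans hz)).trans ?_
    gcongr
  have im_le : ∀ (x y : ℝ), |y| = R → R ≤ ‖(x : ℂ) + y * Complex.I‖ := by
    intro x y hy
    have := Complex.abs_im_le_norm ((x : ℂ) + y * Complex.I)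
    simpa [hy] using this
  have re_le : ∀ (x y : ℝ), |x| = R → R ≤ ‖(x : ℂ) + y * Complex.I‖ := by
    intro x y hx
    have := Complex.abs_re_le_norm ((x : ℂ) + y * Complex.I)
    simpa [hx] using this
  have absR : |R| = R := abs_of_pos hR0
  -- Each side has length 2R, and |F| ≤ C/R² on it; the four sides together give 8C/R.
  have side : ∀ f : ℝ → ℂ, (∀ x, ‖f x‖ ≤ C / R ^ 2) →
      ‖∫ x : ℝ in (-R)..R, f x‖ ≤ 2 * C / R := by
    intro f hf
    refine (intervalIntegral.norm_integral_le_of_norm_le_const fun x _ => hf x).trans (le_of_eq ?_)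
    rw [sub_neg_eq_add, abs_of_pos (by linarith)]
    field_simp
    ring
  have s1 := side (fun x => F (x + (-R : ℝ) * Complex.I)) fun x =>
    bound _ (im_le x (-R) (by rw [abs_neg, absR]))
  have s2 := side (fun x => F (x + R * Complex.I)) fun x => bound _ (im_le x R absR)
  have s3 := side (fun y => F (R + y * Complex.I)) fun y => bound _ (re_le R y absR)
  have s4 := side (fun y => F ((-R : ℝ) + y * Complex.I)) fun y =>
    bound _ (re_le (-R) y (by rw [abs_neg, absR]))
  refine (norm_sub_le _ _).trans ?_
  refine (add_le_add_left ((norm_add_le _ _).trans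
    (add_le_add_left (norm_sub_le _ _) _)) _).trans ?_
  simp only [norm_smul, Complex.norm_I, one_mul]
  have : 8 * C / R = 2 * C / R + 2 * C / R + 2 * C / R + 2 * C / R := by ring
  rw [this]
  exact add_le_add (add_le_add (add_le_add s1 s2) s3) s4

/-- If `κ / (1 + |z|²)²` is a combination of `∂̄`-derivatives of functions with quadratic decay and
of their conjugates, then `κ = 0`. -/
theorem eq_zero_of_integral_square_le {κ : ℂ} {K : ℝ}
    (h : ∀ R : ℝ, 1 ≤ R → ‖∫ z in square R, κ * (((1 + ‖z‖ ^ 2) ^ 2)⁻¹ : ℝ)‖ ≤ K / R) : κ = 0 := by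
  have hcont : Continuous fun z : ℂ => ((1 + ‖z‖ ^ 2) ^ 2)⁻¹ := by
    refine Continuous.inv₀ (by fun_prop) fun z => ?_
    positivity
  set m := ∫ z in square 1, ((1 + ‖z‖ ^ 2) ^ 2)⁻¹ with hm
  have hint : ∀ R, IntegrableOn (fun z : ℂ => ((1 + ‖z‖ ^ 2) ^ 2)⁻¹) (square R) := fun R =>
    hcont.continuousOn.integrableOn_compact (isCompact_square R)
  have hm0 : 0 < m := by
    rw [hm, setIntegral_pos_iff_support_of_nonneg_ae
      (Filter.Eventually.of_forall fun z => by positivity) (hint 1)]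
    have hsupp : Function.support (fun z : ℂ => ((1 + ‖z‖ ^ 2) ^ 2)⁻¹) = Set.univ := by
      ext z
      simp only [Function.mem_support, Set.mem_univ, iff_true]
      positivity
    rw [hsupp, Set.univ_inter]
    refine lt_of_lt_of_le ?_ (measure_mono (s := Metric.ball 0 1) ?_)
    · exact Metric.measure_ball_pos _ _ one_pos
    · intro z hz
      have hz' : ‖z‖ < 1 := by simpa using hz
      have h1 := abs_le.1 ((Complex.abs_re_le_norm z).trans hz'.le)
      have h2 := abs_le.1 ((Complex.abs_im_le_norm z).trans hz'.le)
      exact ⟨h1, h2⟩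
  -- The integrand is positive and the squares increase, so the mass of the unit square bounds the
  -- others from below, while the hypothesis forces decay as R grows.
  have hle : ∀ R : ℝ, 1 ≤ R → ‖κ‖ * m ≤ K / R := by
    intro R hR
    refine le_trans ?_ (h R hR)
    rw [integral_const_mul, norm_mul, integral_complex_ofReal, Complex.norm_real]
    gcongr
    refine le_trans ?_ (le_abs_self _)
    refine setIntegral_mono_set (hint R) (Filter.Eventually.of_forall fun z => by positivity) ?_
    refine LE.le.eventuallyLE fun z hz => ?_
    exact ⟨Set.Icc_subset_Icc (by linarith) hR hz.1, Set.Icc_subset_Icc (by linarith) hR hz.2⟩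
  have hlim : Filter.Tendsto (fun R : ℝ => K / R) Filter.atTop (nhds 0) :=
    tendsto_const_nhds.div_atTop Filter.tendsto_id
  have h0 : ‖κ‖ * m ≤ 0 := ge_of_tendsto hlim
    ((Filter.eventually_ge_atTop 1).mono fun R hR => hle R hR)
  have : ‖κ‖ = 0 := by
    by_contra hne
    have : 0 < ‖κ‖ * m := mul_pos (lt_of_le_of_ne (norm_nonneg _) (Ne.symm hne)) hm0
    linarith
  exact norm_eq_zero.1 this

/-! ### Reflections -/

/-- The reflection `t⁻¹` exchanges `0` and `∞` on the `m`-th coordinate axis. -/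
structure IsReflection (t : SL3) (m : Fin 3) : Prop where
  mem : ∀ ζ : ℂ, ζ ≠ 0 → (chart 1).symm (Pi.single m ζ) ∈ (chart t⁻¹).source
  coord : ∀ ζ : ℂ, ζ ≠ 0 → coordMap 1 1 t⁻¹ (Pi.single m ζ) = Pi.single m (-ζ⁻¹)
  jac : ∀ ζ : ℂ, ζ ≠ 0 → ∀ l, jac 1 1 t⁻¹ (Pi.single m ζ) l m = if l = m then (ζ ^ 2)⁻¹ else 0

theorem coordMap_one_inv (t : SL3) (z : C3) : coordMap 1 1 t⁻¹ z = cellCoord (t * lowerUnip z) := by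
  rw [coordMap_eq, inv_inv, one_mul, one_mul]

theorem mem_source_inv (t : SL3) (z : C3) :
    (chart 1).symm z ∈ (chart t⁻¹).source ↔ t * lowerUnip z ∈ cellSet := by
  have := smul_symm_mem_cell_iff 1 1 t⁻¹ z
  rwa [one_smul, inv_inv, one_mul, one_mul] at this

/-- The reflection in the first simple root. -/
def reflOne : SL3 := ⟨!![0, 1, 0; -1, 0, 0; 0, 0, 1], by simp [Matrix.det_fin_three]⟩

/-- The reflection in the second simple root. -/
def reflTwo : SL3 := ⟨!![1, 0, 0; 0, 0, 1; 0, -1, 0], by simp [Matrix.det_fin_three]⟩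

theorem reflOne_mul (z : C3) : (reflOne * lowerUnip z).1 = !![z 0, 1, 0; -1, 0, 0; z 1, z 2, 1] := by
  rw [Matrix.SpecialLinearGroup.coe_mul, coe_lowerUnip, reflOne]
  ext i j
  fin_cases i <;> fin_cases j <;> simp [Matrix.mul_apply, Fin.sum_univ_three]

theorem reflTwo_mul (z : C3) :
    (reflTwo * lowerUnip z).1 = !![1, 0, 0; z 1, z 2, 1; -z 0, -1, 0] := by
  rw [Matrix.SpecialLinearGroup.coe_mul, coe_lowerUnip, reflTwo]
  ext i j
  fin_cases i <;> fin_cases j <;> simp [Matrix.mul_apply, Fin.sum_univ_three]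

theorem cellCoord_reflOne (z : C3) :
    cellCoord (reflOne * lowerUnip z) = ![-1 / z 0, z 1 / z 0, z 0 * z 2 - z 1] := by
  rw [cellCoord, minor2, reflOne_mul]
  ext i
  fin_cases i <;> simp

theorem cellCoord_reflTwo (z : C3) :
    cellCoord (reflTwo * lowerUnip z) = ![z 1, -z 0, -1 / z 2] := by
  rw [cellCoord, minor2, reflTwo_mul]
  ext i
  fin_cases i <;> simp

theorem isReflection_reflOne : IsReflection reflOne 0 := by
  have hmem : ∀ ζ : ℂ, ζ ≠ 0 → (chart 1).symm (Pi.single 0 ζ) ∈ (chart reflOne⁻¹).source := by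
    intro ζ hζ
    rw [mem_source_inv, cellSet, Set.mem_ofPred_eq, minor1, minor2, reflOne_mul]
    simp [hζ]
  refine ⟨hmem, fun ζ hζ => ?_, fun ζ hζ l => ?_⟩
  · rw [coordMap_one_inv, cellCoord_reflOne]
    ext i
    fin_cases i <;> simp [neg_div]
  · rw [← (hasWirt_coordMap (u := 1) (by rw [one_smul]; exact hmem ζ hζ) l).dz_eq 0]
    simp only [coordMap_one_inv, cellCoord_reflOne]
    have k := fun i => hasWirt_coord i (Pi.single 0 ζ : C3)
    have h0 : (Pi.single 0 ζ : C3) 0 ≠ 0 := by simpa using hζ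
    fin_cases l
    · exact (((hasWirt_const (-1) _).div (k 0) h0).dz_eq 0).trans (by simp)
    · exact (((k 1).div (k 0) h0).dz_eq 0).trans (by simp)
    · exact ((((k 0).mul (k 2)).sub (k 1)).dz_eq 0).trans (by simp)

theorem isReflection_reflTwo : IsReflection reflTwo 2 := by
  have hmem : ∀ ζ : ℂ, ζ ≠ 0 → (chart 1).symm (Pi.single 2 ζ) ∈ (chart reflTwo⁻¹).source := by
    intro ζ hζ
    rw [mem_source_inv, cellSet, Set.mem_ofPred_eq, minor1, minor2, reflTwo_mul]
    simp [hζ]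
  refine ⟨hmem, fun ζ hζ => ?_, fun ζ hζ l => ?_⟩
  · rw [coordMap_one_inv, cellCoord_reflTwo]
    ext i
    fin_cases i <;> simp [neg_div]
  · rw [← (hasWirt_coordMap (u := 1) (by rw [one_smul]; exact hmem ζ hζ) l).dz_eq 2]
    simp only [coordMap_one_inv, cellCoord_reflTwo]
    have k := fun i => hasWirt_coord i (Pi.single 2 ζ : C3)
    have h0 : (Pi.single 2 ζ : C3) 2 ≠ 0 := by simpa using hζ
    fin_cases l
    · exact ((k 1).dz_eq 2).trans (by simp)
    · exact ((k 0).neg.dz_eq 2).trans (by simp)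
    · exact (((hasWirt_const (-1) _).div (k 2) h0).dz_eq 2).trans (by simp)

/-- The `∂̄`-derivative of a `1`-form along a coordinate axis has small integrals over large
squares. -/
theorem RealOneForm.exists_norm_integral_le (b : RealOneForm) {t : SL3} {m : Fin 3}
    (ht : IsReflection t m) : ∃ K, ∀ R : ℝ, 1 ≤ R →
      ‖∫ ζ in square R, dzbar m (fun y => b.coeff 1 y m) (Pi.single m ζ)‖ ≤ K / R := by
  have hsingle : ContDiff ℝ ∞ fun ζ : ℂ => (Pi.single m ζ : C3) :=
    (ContinuousLinearMap.single ℝ (fun _ : Fin 3 => ℂ) m).contDiff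
  have hF : ContDiff ℝ ∞ fun ζ : ℂ => b.coeff 1 (Pi.single m ζ) m :=
    (b.smooth 1 m).comp hsingle
  have hG : Continuous fun ζ : ℂ => b.coeff t⁻¹ (Pi.single m ζ) m :=
    ((b.smooth t⁻¹ m).comp hsingle).continuous
  obtain ⟨C, hC⟩ := (isCompact_closedBall (0 : ℂ) 1).exists_bound_of_continuousOn hG.continuousOn
  -- In the reflected chart the point ζ has coordinate -1/ζ, and the coefficient along the axis
  -- changes by the factor ζ⁻². For |ζ| ≥ 1 the reflected coefficient is evaluated in the closed
  -- unit disc, where it is bounded by C.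
  have hdecay : ∀ ζ : ℂ, 1 ≤ ‖ζ‖ → ‖b.coeff 1 (Pi.single m ζ) m‖ ≤ C / ‖ζ‖ ^ 2 := by
    intro ζ hζ
    have hζ0 : ζ ≠ 0 := fun h => by simp [h] at hζ; linarith
    have e := congrFun (b.compat 1 t⁻¹ (Pi.single m ζ) (ht.mem ζ hζ0)) m
    rw [ht.coord ζ hζ0, Matrix.mulVec, dotProduct] at e
    simp only [Matrix.transpose_apply, ht.jac ζ hζ0, ite_mul, zero_mul, Finset.sum_ite_eq',
      Finset.mem_univ, if_true] at e
    rw [e, norm_mul, norm_inv, norm_pow, ← div_eq_inv_mul]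
    gcongr
    refine hC _ ?_
    rw [mem_closedBall_zero_iff, norm_neg, norm_inv]
    exact inv_le_one_of_one_le₀ hζ
  refine ⟨8 * C / 2, fun R hR => ?_⟩
  have h := norm_integral_square_le (hF.of_le (by exact_mod_cast le_top)) hdecay hR
  have e : ∀ ζ : ℂ, Complex.I • fderiv ℝ (fun ζ : ℂ => b.coeff 1 (Pi.single m ζ) m) ζ 1 -
      fderiv ℝ (fun ζ : ℂ => b.coeff 1 (Pi.single m ζ) m) ζ Complex.I =
      2 * Complex.I * dzbar m (fun y => b.coeff 1 y m) (Pi.single m ζ) := by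
    intro ζ
    have h1 : HasFDerivAt (fun ζ : ℂ => (Pi.single m ζ : C3))
        (ContinuousLinearMap.single ℝ (fun _ : Fin 3 => ℂ) m) ζ :=
      (ContinuousLinearMap.single ℝ (fun _ : Fin 3 => ℂ) m).hasFDerivAt
    have h2 := (((b.smooth 1 m).differentiable (by simp)) (Pi.single m ζ)).hasFDerivAt
    have h3 : HasFDerivAt (fun ζ : ℂ => b.coeff 1 (Pi.single m ζ) m) _ ζ :=
      HasFDerivAt.comp ζ h2 h1
    rw [h3.fderiv, dzbar]
    simp only [ContinuousLinearMap.comp_apply, ContinuousLinearMap.single_apply, smul_eq_mul]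
    linear_combination (-fderiv ℝ (fun y => b.coeff 1 y m) (Pi.single m ζ)
      (Pi.single m Complex.I)) * Complex.I_sq
  simp only [e] at h
  rw [integral_const_mul, norm_mul, norm_mul, Complex.norm_I, mul_one, Complex.norm_ofNat] at h
  have : 8 * C / 2 / R = 8 * C / R / 2 := by ring
  rw [this, le_div_iff₀ two_pos]
  linarith

/-! ### Comparison of Chern forms -/

/-- The chart centred at `g B` as an element of the atlas. -/
def atlasIndex (g : SL3) : atlas C3 X := ⟨chart g, g, rfl⟩

theorem symm_mem_atlasIndex (g : SL3) (z : C3) :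
    (chart g).symm z ∈ tangentHolBundle.core.baseSet (atlasIndex g) :=
  (mem_baseSet_iff (atlasIndex g) rfl _).2 ((chart g).map_target (Set.mem_univ z))

/-- The determinant of a metric on the tangent bundle in the coordinate frame. -/
def detMetric (h : HermitianMetric tangentHolBundle) (g : SL3) (z : C3) : ℂ :=
  (h.localMat (atlasIndex g) g z).det

section
variable (h h' : HermitianMetric tangentHolBundle) (g g' : SL3)

theorem detMetric_ne_zero (z : C3) : detMetric h g z ≠ 0 :=
  (det_localMat_pos h (atlasIndex g) (symm_mem_atlasIndex g z)).ne'

theorem contDiff_detMetric : ContDiff ℝ ∞ (detMetric h g) :=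
  contDiff_iff_contDiffAt.2 fun z => contDiffAt_det (M := h.localMat (atlasIndex g) g)
    (contDiffAt_localMat h (atlasIndex g) (symm_mem_atlasIndex g z))

variable {g g'} in
theorem detMetric_eq {z : C3} (hz : (chart g).symm z ∈ (chart g').source) :
    detMetric h g z = star (jac 1 g g' z).det * detMetric h g' (coordMap 1 g g' z) *
      (jac 1 g g' z).det := by
  have hg : (chart g).symm z ∈ (chart g).source := (chart g).map_target (Set.mem_univ z)
  have e := h.compat (atlasIndex g) (atlasIndex g') ((chart g).symm z)
    ⟨symm_mem_atlasIndex g z, (mem_baseSet_iff (atlasIndex g') rfl _).2 hz⟩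
  have e1 := tangent_coordChange (atlasIndex g) (atlasIndex g') (g := g) (g' := g') rfl rfl
    ((chart g).symm z)
  rw [(chart g).right_inv (Set.mem_univ z)] at e1
  have e2 : h.localMat (atlasIndex g') g' (coordMap 1 g g' z) =
      h.mat (atlasIndex g') ((chart g).symm z) := by
    change h.mat (atlasIndex g') ((chart g').symm (coordMap 1 g g' z)) = _
    rw [coordMap, one_smul, (chart g').left_inv hz]
  let N : Matrix (Fin 3) (Fin 3) ℂ := h.mat (atlasIndex g') ((chart g).symm z)
  have e3 := congrArg (Matrix.det (n := Fin 3)) (e.trans (congrArg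
    (fun M : Matrix (Fin 3) (Fin 3) ℂ => Mᴴ * N * M) e1))
  rw [Matrix.det_mul, Matrix.det_mul, Matrix.det_conjTranspose] at e3
  rw [detMetric, detMetric, e2]
  exact e3

/-- The ratio of the volume forms of two metrics. -/
def detRatio (z : C3) : ℂ := detMetric h g z / detMetric h' g z

theorem detRatio_ne_zero (z : C3) : detRatio h h' g z ≠ 0 :=
  div_ne_zero (detMetric_ne_zero h g z) (detMetric_ne_zero h' g z)

theorem contDiff_detRatio : ContDiff ℝ ∞ (detRatio h h' g) :=
  contDiff_div_real (contDiff_detMetric h g) (contDiff_detMetric h' g) (detMetric_ne_zero h' g)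

-- The Jacobian factors cancel in the quotient, so the local ratios are one global function. Hence ∂
-- log of it is globally defined.
variable {g g'} in
theorem detRatio_eq {z : C3} (hz : (chart g).symm z ∈ (chart g').source) :
    detRatio h h' g z = detRatio h h' g' (coordMap 1 g g' z) := by
  have h0 := detMetric_ne_zero h g z
  have h1 := detMetric_ne_zero h' g' (coordMap 1 g g' z)
  rw [detMetric_eq h hz] at h0
  rw [detRatio, detRatio, detMetric_eq h hz, detMetric_eq h' hz]
  have h2 := right_ne_zero_of_mul h0
  have h3 := left_ne_zero_of_mul (left_ne_zero_of_mul h0)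
  field_simp

/-- The real `1`-form whose `(1,0)`-part is `∂ log` of the ratio of the volume forms. -/
def dlogRatio : RealOneForm where
  coeff g z j := dz j (detRatio h h' g) z / detRatio h h' g z
  smooth g j := contDiff_iff_contDiffAt.2 fun z =>
    contDiffAt_div_real (ContDiffAt.dz (contDiff_detRatio h h' g).contDiffAt j)
      (contDiff_detRatio h h' g).contDiffAt (detRatio_ne_zero h h' g z)
  compat g g' z hz := by
    have hz' : (1 : SL3) • (chart g).symm z ∈ (chart g').source := by rwa [one_smul]
    have ev : detRatio h h' g =ᶠ[nhds z] fun y => detRatio h h' g' (coordMap 1 g g' y) := by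
      filter_upwards [(isOpen_overlap 1 g g').mem_nhds hz'] with y hy
      exact detRatio_eq h h' (by rwa [one_smul] at hy)
    have hd := hasWirt_of_differentiableAt
      ((contDiff_detRatio h h' g').differentiable (by simp) (coordMap 1 g g' z))
    funext j
    rw [dz_congr ev, ev.eq_of_nhds,
      (hd.comp_holomorphic (differentiableAt_coordMap hz').hasFDerivAt).dz_eq j]
    simp only [Matrix.mulVec, dotProduct, Matrix.transpose_apply, jac_apply, Finset.sum_div]
    refine Finset.sum_congr rfl fun m _ => ?_
    ring

theorem logCurv_sub_logCurv (z : C3) (j k : Fin 3) :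
    logCurv (detMetric h g) z j k - logCurv (detMetric h' g) z j k =
      -dzbar k (fun y => (dlogRatio h h').coeff g y j) z := by
  have c := fun h => contDiff_detMetric h g
  have n := fun h => detMetric_ne_zero h g
  have w := fun h => hasWirt_of_differentiableAt ((contDiffAt_div_real
    (ContDiffAt.dz (c h).contDiffAt j) (c h).contDiffAt (n h z)).differentiableAt (by simp))
  have e : (fun y => (dlogRatio h h').coeff g y j) = fun y =>
      dz j (detMetric h g) y / detMetric h g y - dz j (detMetric h' g) y / detMetric h' g y := by
    funext y
    have d := fun h => hasWirt_of_differentiableAt ((c h).differentiable (by simp) y)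
    change dz j (fun y => detMetric h g y / detMetric h' g y) y /
      (detMetric h g y / detMetric h' g y) = _
    rw [((d h).div (d h') (n h' y)).dz_eq j]
    have h1 := n h y
    have h2 := n h' y
    field_simp
  rw [e, ((w h).sub (w h')).dzbar_eq k, logCurv, logCurv]
  ring

/-- The difference has a global primitive. This transfers an arbitrary witness metric in
`RepresentsC1` to the explicit `tangentMetric`. -/
theorem chernForm_sub_chernForm (z : C3) (j k : Fin 3) :
    h.chernForm (atlasIndex g) g z j k - h'.chernForm (atlasIndex g) g z j k =
      -dzbar k (fun y => (dlogRatio h h').coeff g y j) z / (2 * Real.pi) := by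
  rw [chernForm_eq_logCurv h _ (symm_mem_atlasIndex g z),
    chernForm_eq_logCurv h' _ (symm_mem_atlasIndex g z), ← logCurv_sub_logCurv, sub_div]
  rfl

end

/-! ### Uniqueness of the invariant form in its class -/

theorem RealOneForm.continuous_dzbar_axis (b : RealOneForm) (m : Fin 3) :
    Continuous fun ζ : ℂ => dzbar m (fun y => b.coeff 1 y m) (Pi.single m ζ) := by
  have h1 : ContDiff ℝ ∞ (dzbar m fun y => b.coeff 1 y m) :=
    contDiff_iff_contDiffAt.2 fun z => ContDiffAt.dzbar (b.smooth 1 m).contDiffAt m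
  exact h1.continuous.comp (ContinuousLinearMap.single ℝ (fun _ : Fin 3 => ℂ) m).continuous

/-- The three terms are the ways in which primitives enter: through ∂̄ of the logarithmic ratio, and
through both halves of the (1,1)-part of d of a real 1-form. Each has integral O(1/R) over the
square of half side R, unlike the fixed positive density. -/
theorem eq_zero_of_eq_exact {t : SL3} {m : Fin 3} (ht : IsReflection t m) {κ : ℂ}
    (a b : RealOneForm) (p q s : ℂ)
    (h : ∀ ζ : ℂ, κ * (((1 + ‖ζ‖ ^ 2) ^ 2)⁻¹ : ℝ) =
      p * dzbar m (fun y => a.coeff 1 y m) (Pi.single m ζ) +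
      q * star (dzbar m (fun y => b.coeff 1 y m) (Pi.single m ζ)) +
      s * dzbar m (fun y => b.coeff 1 y m) (Pi.single m ζ)) : κ = 0 := by
  obtain ⟨K, hK⟩ := a.exists_norm_integral_le ht
  obtain ⟨L, hL⟩ := b.exists_norm_integral_le ht
  have ca := a.continuous_dzbar_axis m
  have cb := b.continuous_dzbar_axis m
  refine eq_zero_of_integral_square_le (K := ‖p‖ * K + ‖q‖ * L + ‖s‖ * L) fun R hR => ?_
  have int : ∀ {f : ℂ → ℂ}, Continuous f → IntegrableOn f (square R) := fun hf =>
    hf.continuousOn.integrableOn_compact (isCompact_square R)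
  simp only [h]
  have i1 := int (ca.const_mul p)
  have i2 := int ((continuous_star.comp cb).const_mul q)
  have i3 := int (cb.const_mul s)
  refine (congrArg norm ((integral_add (i1.add i2) i3).trans
    (congrArg (· + _) (integral_add i1 i2)))).trans_le ?_
  rw [integral_const_mul, integral_const_mul, integral_const_mul]
  simp only [Function.comp_def]
  have hs : ∫ ζ in square R, star (dzbar m (fun y => b.coeff 1 y m) (Pi.single m ζ)) =
      star (∫ ζ in square R, dzbar m (fun y => b.coeff 1 y m) (Pi.single m ζ)) := integral_conj
  rw [hs]
  refine (norm_add_le _ _).trans ((add_le_add_left (norm_add_le _ _) _).trans ?_)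
  rw [norm_mul, norm_mul, norm_mul, norm_star]
  have h1 := mul_le_mul_of_nonneg_left (hK R hR) (norm_nonneg p)
  have h2 := mul_le_mul_of_nonneg_left (hL R hR) (norm_nonneg q)
  have h3 := mul_le_mul_of_nonneg_left (hL R hR) (norm_nonneg s)
  have e : (‖p‖ * K + ‖q‖ * L + ‖s‖ * L) / R = ‖p‖ * (K / R) + ‖q‖ * (L / R) + ‖s‖ * (L / R) := by
    ring
  rw [e]
  exact add_le_add (add_le_add h1 h2) h3

/-- The axis is a projective line on which the line of the flag moves and the plane stays fixed. It
sees the Fubini–Study form of the first plane and nothing of the dual one. -/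
theorem formA_axis (ζ : ℂ) : formA 1 (Pi.single 0 ζ) 0 0 = (((1 + ‖ζ‖ ^ 2) ^ 2)⁻¹ : ℝ) ∧
    formB 1 (Pi.single 0 ζ) 0 0 = 0 := by
  have h0 : (1 + ζ * (starRingEnd ℂ) ζ : ℂ) ≠ 0 := by
    rw [Complex.mul_conj, ← Complex.ofReal_one, ← Complex.ofReal_add]
    have := Complex.normSq_nonneg ζ
    exact_mod_cast (by linarith : 1 + Complex.normSq ζ ≠ 0)
  constructor
  · rw [formA, colVec_one, Complex.sq_norm]
    push_cast
    rw [← Complex.mul_conj]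
    simp [fubiniStudy, colVec', dotProduct, Fin.sum_univ_three]
    generalize (starRingEnd ℂ) ζ = c at h0 ⊢
    field_simp
    ring
  · rw [formB, rowVec_one]
    simp [fubiniStudy, rowVec', dotProduct, Fin.sum_univ_three]

theorem formB_axis (ζ : ℂ) : formB 1 (Pi.single 2 ζ) 2 2 = (((1 + ‖ζ‖ ^ 2) ^ 2)⁻¹ : ℝ) ∧
    formA 1 (Pi.single 2 ζ) 2 2 = 0 := by
  have h0 : (1 + ζ * (starRingEnd ℂ) ζ : ℂ) ≠ 0 := by
    rw [Complex.mul_conj, ← Complex.ofReal_one, ← Complex.ofReal_add]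
    have := Complex.normSq_nonneg ζ
    exact_mod_cast (by linarith : 1 + Complex.normSq ζ ≠ 0)
  constructor
  · rw [formB, rowVec_one, Complex.sq_norm]
    push_cast
    rw [← Complex.mul_conj]
    simp [fubiniStudy, rowVec', dotProduct, Fin.sum_univ_three]
    generalize (starRingEnd ℂ) ζ = c at h0 ⊢
    have h1 : ζ * c + 1 ≠ 0 := by rwa [add_comm]
    field_simp
    ring
  · rw [formA, colVec_one]
    simp [fubiniStudy, colVec', dotProduct]

/-- Two closed invariant forms in the same class differ by a combination of `formA` and `formB` that
is exact. The two axes are dual to these forms, so both coefficients of the difference vanish. -/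
theorem eq_stdForm {ω₀ : RealForm11} (hK : ω₀.IsKahler) (hI : ω₀.IsInvariant)
    (hC : ω₀.RepresentsC1 tangentHolBundle) : ω₀ = stdForm := by
  obtain ⟨a, c, hac⟩ := hI.eq_comb hK
  obtain ⟨h, b, hb⟩ := hC
  have key : ∀ (m : Fin 3) (z : C3), ω₀.coeff 1 z m m - stdForm.coeff 1 z m m =
      -1 / (2 * Real.pi) * dzbar m (fun y => (dlogRatio h tangentMetric).coeff 1 y m) z +
      -Complex.I * star (dzbar m (fun y => b.coeff 1 y m) z) +
      Complex.I * dzbar m (fun y => b.coeff 1 y m) z := by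
    intro m z
    have e1 := (hb (atlasIndex 1) 1 z (symm_mem_atlasIndex 1 z) m m).1
    have e2 := chernForm_sub_chernForm h tangentMetric 1 z m m
    rw [tangentMetric_chernForm _ (symm_mem_atlasIndex 1 z)] at e2
    have e3 := (hasWirt_of_differentiableAt ((b.smooth 1 m).differentiable (by simp) z)).conj.dz_eq m
    rw [RealOneForm.d11, e3] at e1
    have e4 : ω₀.coeff 1 z m m - h.chernForm (atlasIndex 1) 1 z m m =
        -Complex.I * (Complex.I * (ω₀.coeff 1 z m m - h.chernForm (atlasIndex 1) 1 z m m)) := by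
      rw [← mul_assoc, neg_mul, Complex.I_mul_I, neg_neg, one_mul]
    rw [e1] at e4
    linear_combination e4 + e2
  have ha : a - (Real.pi : ℂ)⁻¹ = 0 := by
    refine eq_zero_of_eq_exact isReflection_reflOne (dlogRatio h tangentMetric) b
      (-1 / (2 * Real.pi)) (-Complex.I) Complex.I fun ζ => ?_
    rw [← key 0 (Pi.single 0 ζ), hac, stdForm_coeff]
    simp only [Matrix.add_apply, Matrix.smul_apply, (formA_axis ζ).1, (formA_axis ζ).2, smul_eq_mul]
    ring
  have hc : c - (Real.pi : ℂ)⁻¹ = 0 := by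
    refine eq_zero_of_eq_exact isReflection_reflTwo (dlogRatio h tangentMetric) b
      (-1 / (2 * Real.pi)) (-Complex.I) Complex.I fun ζ => ?_
    rw [← key 2 (Pi.single 2 ζ), hac, stdForm_coeff]
    simp only [Matrix.add_apply, Matrix.smul_apply, (formB_axis ζ).1, (formB_axis ζ).2, smul_eq_mul]
    ring
  refine RealForm11.ext (funext fun g => funext fun z => ?_)
  rw [hac, sub_eq_zero.1 ha, sub_eq_zero.1 hc, stdForm_coeff]

/-! ### Summands of sums of line bundles -/

/-- The inclusion of a summand. -/
def summand {r : ℕ} (w : Fin r → ℤ × ℤ) (k : Fin r) :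
    HolHom (lineSum fun _ : Fin 1 => w k) (lineSum w) where
  toMap g g' x := (ContinuousLinearMap.single ℂ (fun _ : Fin r => ℂ) k).comp
    ((character (w k) (borelCocycle g g' x)) • ContinuousLinearMap.proj (R := ℂ) (0 : Fin 1))
  holomorphic g g' := by
    have h : ContDiff ℂ ω fun c : ℂ => (ContinuousLinearMap.single ℂ (fun _ : Fin r => ℂ) k).comp
        (c • ContinuousLinearMap.proj (R := ℂ) (φ := fun _ : Fin 1 => ℂ) (0 : Fin 1)) := by
      fun_prop
    exact h.contMDiff.comp_contMDiffOn (contMDiffOn_character (w k) g g')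
  compat g₁ g₂ g₃ g₄ x h₁ h₂ h₃ h₄ v := by
    have e : character (w k) (borelCocycle g₂ g₄ x) * character (w k) (borelCocycle g₁ g₂ x) =
        character (w k) (borelCocycle g₃ g₄ x) * character (w k) (borelCocycle g₁ g₃ x) := by
      rw [mul_comm, ← character_mul _ (borelCocycle_mem h₁ h₂) (borelCocycle_mem h₂ h₄), mul_comm,
        ← character_mul _ (borelCocycle_mem h₁ h₃) (borelCocycle_mem h₃ h₄)]
      simp [borelCocycle, mul_assoc]
    change (Pi.single k (character (w k) (borelCocycle g₂ g₄ x) *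
      (character (w k) (borelCocycle g₁ g₂ x) * v (0 : Fin 1))) : Fin r → ℂ) =
      diagCLM (fun k => character (w k) (borelCocycle g₃ g₄ x))
        (Pi.single k (character (w k) (borelCocycle g₁ g₃ x) * v (0 : Fin 1)))
    funext l
    rw [diagCLM_apply]
    rcases eq_or_ne l k with rfl | hl
    · rw [Pi.single_eq_same, Pi.single_eq_same, ← mul_assoc, ← mul_assoc, e]
    · rw [Pi.single_eq_of_ne hl, Pi.single_eq_of_ne hl, mul_zero]

theorem summand_isSubbundle {r : ℕ} (w : Fin r → ℤ × ℤ) (k : Fin r) :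
    (summand w k).IsSubbundle := by
  intro g g' x hx hx' u v huv
  have h0 := character_ne_zero (w k) (borelCocycle_mem hx hx')
  have := mul_left_cancel₀ h0 (Pi.single_injective k huv)
  funext i
  have hi : i = (0 : Fin 1) := Subsingleton.elim (α := Fin 1) _ _
  rw [hi]
  exact this

/-- No rank lies strictly between 0 and 1, so the condition on subbundles is vacuous. -/
theorem isSlopeStable_line (ω₀ : RealForm11) (w : Fin 1 → ℤ × ℤ) :
    IsSlopeStable ω₀ (lineSum w) :=
  ⟨one_pos, fun F _ _ h1 h2 => by
    change F.rank < 1 at h2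
    omega⟩

theorem isSlopePolystable_lineSum {r : ℕ} (w : Fin r → ℤ × ℤ) {n : ℤ}
    (h : ∀ a, (w a).1 + (w a).2 = n) : IsSlopePolystable stdForm (lineSum w) := by
  refine ⟨r, fun k => lineSum fun _ : Fin 1 => w k, summand w, 12 * n, fun k =>
    ⟨isSlopeStable_line _ _, hasSlope_lineSum _ one_ne_zero ?_⟩, fun i j x hx hj => ?_⟩
  · have := h k
    simp only [Finset.univ_unique, Finset.sum_singleton, Nat.cast_one, mul_one]
    rw [← this]
    push_cast
    rfl
  · have h0 : ∀ k, character (w k) (borelCocycle (i k) j x) ≠ 0 := fun k =>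
      character_ne_zero _ (borelCocycle_mem (hx k) hj)
    have e : (fun v : (∀ k : Fin r, Fin 1 → ℂ) => ∑ k, (summand w k).toMap (i k) j x (v k)) =
        fun v k => character (w k) (borelCocycle (i k) j x) * v k 0 := by
      funext v
      exact Finset.univ_sum_single fun k => character (w k) (borelCocycle (i k) j x) * v k 0
    change Function.Bijective
      fun v : (∀ k : Fin r, Fin 1 → ℂ) => ∑ k, (summand w k).toMap (i k) j x (v k)
    rw [e]
    refine ⟨fun u v huv => ?_, fun v =>
      ⟨fun k _ => (character (w k) (borelCocycle (i k) j x))⁻¹ * v k, ?_⟩⟩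
    · funext k l
      rw [Subsingleton.elim l 0]
      exact mul_left_cancel₀ (h0 k) (congrFun huv k)
    · funext k
      exact mul_inv_cancel_left₀ (h0 k) _

/-- The summand k has slope above the average, which is the slope of the whole bundle. -/
theorem isSlopeUnstable_lineSum {r : ℕ} (w : Fin r → ℤ × ℤ) (hr : 1 < r) (k : Fin r)
    (h : ∑ a, ((w a).1 + (w a).2 : ℝ) < r * ((w k).1 + (w k).2)) :
    IsSlopeUnstable stdForm (lineSum w) := by
  intro hs
  have r0 : (0 : ℝ) < r := by exact_mod_cast one_pos.trans hr
  have h1 : HasSlope stdForm (lineSum fun _ : Fin 1 => w k) (12 * ((w k).1 + (w k).2)) :=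
    hasSlope_lineSum _ one_ne_zero (by simp)
  have h2 : HasSlope stdForm (lineSum w) (12 * (∑ a, ((w a).1 + (w a).2 : ℝ)) / r) :=
    hasSlope_lineSum _ (by omega) (by field_simp)
  have := hs _ (summand w k) (summand_isSubbundle w k) one_pos hr _ _ h1 h2
  rw [le_div_iff₀ r0] at this
  linarith

/-! ### Phases of particular weights and the three examples. -/

theorem lineMetric_phaseIntegral_of_eq {r : ℕ} (w : Fin r → ℤ × ℤ) {c : ℂ}
    (h : ∀ a, phase (w a) = c) :
    (lineMetric w).phaseIntegral stdForm = ((3 * r : ℝ) : ℂ) * c := by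
  rw [lineMetric_phaseIntegral, Finset.sum_congr rfl fun a _ => h a]
  simp
  ring

/-- In this example and the next the three factors have arguments adding up to π. Both phases are
real and negative although s+t is 8 and 7. -/
theorem phase_two_six : phase (2, 6) = -160 := by
  simp only [phase]
  apply Complex.ext <;> simp <;> norm_num

theorem phase_three_four : phase (3, 4) = -130 := by
  simp only [phase]
  apply Complex.ext <;> simp <;> norm_num

theorem phase_comm (s t : ℤ) : phase (s, t) = phase (t, s) := by
  simp only [phase]
  ring

theorem phase_one_two : phase (1, 2) = ⟨-10, 30⟩ := by
  simp only [phase]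
  apply Complex.ext <;> simp <;> norm_num

theorem phase_one_three : phase (1, 3) = ⟨-28, 36⟩ := by
  simp only [phase]
  apply Complex.ext <;> simp <;> norm_num

theorem phase_two_two : phase (2, 2) = ⟨-32, 32⟩ := by
  simp only [phase]
  apply Complex.ext <;> simp <;> norm_num

theorem exists_isDHYM :
    ∃ (r : ℕ) (w : Fin r → ℤ × ℤ), 1 < r ∧
      (∃ h : HermitianMetric (lineSum w), IsInvariantMetric h ∧
        (∃ μ : ℝ, HasSlope stdForm (lineSum w) μ ∧ h.IsHYM stdForm (Real.pi / 8 * μ)) ∧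
        h.phaseIntegral stdForm ≠ 0 ∧ h.IsDHYM stdForm (h.phaseIntegral stdForm).arg) ∧
      IsSlopePolystable stdForm (lineSum w) := by
  have hn : ∀ a, ((![(1, 2), (2, 1)] : Fin 2 → ℤ × ℤ) a).1 +
      ((![(1, 2), (2, 1)] : Fin 2 → ℤ × ℤ) a).2 = 3 := by
    intro a; fin_cases a <;> rfl
  -- The phase is symmetric in s and t, so exchanging them preserves both the slope and the phase.
  have hp : ∀ a, phase ((![(1, 2), (2, 1)] : Fin 2 → ℤ × ℤ) a) = ⟨-10, 30⟩ := by
    intro a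
    fin_cases a
    · exact phase_one_two
    · exact (phase_comm 2 1).trans phase_one_two
  have hi := lineMetric_phaseIntegral_of_eq _ hp
  have h0 : (⟨-10, 30⟩ : ℂ) ≠ 0 := fun h => by
    have := congrArg Complex.re h
    norm_num at this
  refine ⟨2, ![(1, 2), (2, 1)], one_lt_two, ⟨lineMetric _, lineMetric_isInvariant _,
    ⟨36, hasSlope_lineSum _ two_ne_zero (by simp [Fin.sum_univ_two]; norm_num),
      lineMetric_isHYM _ hn (by norm_num)⟩, ?_, ?_⟩, isSlopePolystable_lineSum _ hn⟩
  · rw [hi]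
    exact mul_ne_zero (by norm_num) h0
  · rw [lineMetric_isDHYM_iff]
    intro a
    rw [hp, hi, Complex.arg_real_mul _ (by norm_num), exp_neg_arg_mul, Complex.ofReal_im]

theorem exists_not_isDHYM :
    ∃ (r : ℕ) (w : Fin r → ℤ × ℤ), 1 < r ∧
      (∃ h : HermitianMetric (lineSum w), IsInvariantMetric h ∧
        (∃ μ : ℝ, HasSlope stdForm (lineSum w) μ ∧ h.IsHYM stdForm (Real.pi / 8 * μ)) ∧
        ∀ θ : ℝ, ¬ h.IsDHYM stdForm θ) ∧
      IsSlopePolystable stdForm (lineSum w) := by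
  have hn : ∀ a, ((![(1, 3), (2, 2)] : Fin 2 → ℤ × ℤ) a).1 +
      ((![(1, 3), (2, 2)] : Fin 2 → ℤ × ℤ) a).2 = 4 := by
    intro a; fin_cases a <;> rfl
  refine ⟨2, ![(1, 3), (2, 2)], one_lt_two, ⟨lineMetric _, lineMetric_isInvariant _,
    ⟨48, hasSlope_lineSum _ two_ne_zero (by simp [Fin.sum_univ_two]; norm_num),
      lineMetric_isHYM _ hn (by norm_num)⟩, fun θ h => ?_⟩, isSlopePolystable_lineSum _ hn⟩
  rw [lineMetric_isDHYM_iff] at h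
  have h1 : (Complex.exp (-Complex.I * θ) * phase (1, 3)).im = 0 := h 0
  have h2 : (Complex.exp (-Complex.I * θ) * phase (2, 2)).im = 0 := h 1
  have he := Complex.exp_ne_zero (-Complex.I * θ)
  rw [phase_one_three, Complex.mul_im] at h1
  rw [phase_two_two, Complex.mul_im] at h2
  -- The phases -28+36i and -32+32i are linearly independent over ℝ, so the two real equations force
  -- the exponential to vanish.
  refine he (Complex.ext ?_ ?_)
  · change (Complex.exp (-Complex.I * θ)).re = 0
    linarith
  · change (Complex.exp (-Complex.I * θ)).im = 0
    linarith

theorem exists_isDHYM_and_isSlopeUnstable :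
    (∃ h : HermitianMetric (lineSum ![(2, 6), (3, 4)]), IsInvariantMetric h ∧
      (∀ c : ℝ, ¬ h.IsHYM stdForm c) ∧ h.phaseIntegral stdForm ≠ 0 ∧
      (h.phaseIntegral stdForm).arg = Real.pi ∧
      h.IsDHYM stdForm (h.phaseIntegral stdForm).arg) ∧
    IsSlopeUnstable stdForm (lineSum ![(2, 6), (3, 4)]) := by
  -- The value is 3(-160 - 130).
  have hi : (lineMetric ![(2, 6), (3, 4)]).phaseIntegral stdForm = ((-870 : ℝ) : ℂ) := by
    rw [lineMetric_phaseIntegral, Fin.sum_univ_two]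
    change 3 * (phase (2, 6) + phase (3, 4)) = _
    rw [phase_two_six, phase_three_four]
    norm_num
  have ha : ((lineMetric ![(2, 6), (3, 4)]).phaseIntegral stdForm).arg = Real.pi := by
    rw [hi]
    exact Complex.arg_ofReal_of_neg (by norm_num)
  refine ⟨⟨lineMetric _, lineMetric_isInvariant _,
    lineMetric_not_isHYM _ (a := 0) (b := 1) (by simp), ?_, ha, ?_⟩,
    isSlopeUnstable_lineSum _ one_lt_two 0 (by simp [Fin.sum_univ_two]; norm_num)⟩
  · rw [hi]
    norm_num
  · rw [ha, lineMetric_isDHYM_iff]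
    have e : Complex.exp (-Complex.I * Real.pi) = -1 := by
      rw [neg_mul, Complex.exp_neg, mul_comm, Complex.exp_pi_mul_I]
      norm_num
    intro a
    rw [e]
    fin_cases a
    · change (-1 * phase (2, 6)).im = 0
      rw [phase_two_six]
      norm_num
    · change (-1 * phase (3, 4)).im = 0
      rw [phase_three_four]
      norm_num

end FlagThreefold

end

theorem theorem1p1 :
    (∃! ω₀ : FlagThreefold.RealForm11, ω₀.IsKahler ∧ ω₀.IsInvariant ∧
      ω₀.RepresentsC1 FlagThreefold.tangentHolBundle) ∧
    ∀ ω₀ : FlagThreefold.RealForm11, ω₀.IsKahler → ω₀.IsInvariant →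
      ω₀.RepresentsC1 FlagThreefold.tangentHolBundle →
      (∃ (r : ℕ) (w : Fin r → ℤ × ℤ), 1 < r ∧
        (∃ h : FlagThreefold.HermitianMetric (FlagThreefold.lineSum w),
          FlagThreefold.IsInvariantMetric h ∧
          (∃ μ : ℝ, FlagThreefold.HasSlope ω₀ (FlagThreefold.lineSum w) μ ∧
            h.IsHYM ω₀ (Real.pi / 8 * μ)) ∧
          h.phaseIntegral ω₀ ≠ 0 ∧ h.IsDHYM ω₀ (h.phaseIntegral ω₀).arg) ∧
        FlagThreefold.IsSlopePolystable ω₀ (FlagThreefold.lineSum w)) ∧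
      (∃ (r : ℕ) (w : Fin r → ℤ × ℤ), 1 < r ∧
        (∃ h : FlagThreefold.HermitianMetric (FlagThreefold.lineSum w),
          FlagThreefold.IsInvariantMetric h ∧
          (∃ μ : ℝ, FlagThreefold.HasSlope ω₀ (FlagThreefold.lineSum w) μ ∧
            h.IsHYM ω₀ (Real.pi / 8 * μ)) ∧
          ∀ θ : ℝ, ¬ h.IsDHYM ω₀ θ) ∧
        FlagThreefold.IsSlopePolystable ω₀ (FlagThreefold.lineSum w)) ∧
      ((∃ h : FlagThreefold.HermitianMetric (FlagThreefold.lineSum ![(2, 6), (3, 4)]),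
          FlagThreefold.IsInvariantMetric h ∧
          (∀ c : ℝ, ¬ h.IsHYM ω₀ c) ∧
          h.phaseIntegral ω₀ ≠ 0 ∧ (h.phaseIntegral ω₀).arg = Real.pi ∧
          h.IsDHYM ω₀ (h.phaseIntegral ω₀).arg) ∧
        FlagThreefold.IsSlopeUnstable ω₀ (FlagThreefold.lineSum ![(2, 6), (3, 4)])) := by
  refine ⟨⟨FlagThreefold.stdForm, ⟨FlagThreefold.stdForm_isKahler,
    FlagThreefold.stdForm_isInvariant, FlagThreefold.stdForm_representsC1⟩,
    fun ω₀ h => FlagThreefold.eq_stdForm h.1 h.2.1 h.2.2⟩, fun ω₀ hK hI hC => ?_⟩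
  -- Uniqueness replaces the arbitrary form by the explicit one, for which all quantities have been
  -- computed.
  rw [FlagThreefold.eq_stdForm hK hI hC]
  exact ⟨FlagThreefold.exists_isDHYM, FlagThreefold.exists_not_isDHYM,
    FlagThreefold.exists_isDHYM_and_isSlopeUnstable⟩
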